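/- **Theorem 3 (Optimality of the private attack in the static $\Delta,\Delta_a$ model).** *Model.* Let $\lambda_h,\lambda_a>0$ and $\Delta,\Delta_a\ge 0$. Honest and adversarial blocks are mined at the arrival times of two independent Poisson processes of rates $\lambda_h$ and $\lambda_a$; every block extends an earlier block, starting from a genesis block mined at time $0$. Honest mining power is spread over infinitely many honest nodes, each honest block being mined by a different node. At every time each honest node holds a longest chain among the blocks it knows, and mines on it; it knows its own block at once, and whatever one honest node knows, all honest nodes know at most $\Delta$ later. The adversary chooses the parents of its blocks (it may use one arrival on several parents), the delivery of all blocks to honest nodes within these limits, and the tie-breaking; but an adversarial block may extend another adversarial block only if that one was mined at least $\Delta_a$ earlier. The adversarial subtree of an honest block or of genesis consists of the blocks that descend from it through adversarial blocks only. Put $$\lambda_{\mathrm{eff}}=\frac{\lambda_a}{1+\lambda_a\Delta_a},\qquad \lambda_{\mathrm{growth}}=\frac{\lambda_h}{1+\lambda_h\Delta}.$$ *Security.* A transaction is confirmed with depth $k$ by an honest node if it lies in a block of the chain held by that node which is followed there by at least $k$ blocks. Persistence fails at time $s$ if some transaction is confirmed by all honest nodes at time $s$, but is not confirmed by some honest node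 at some time $t>s+\Delta$. Liveness with waiting time $T$ fails at time $s$ if some transaction submitted to the network by an honest node at time $s$ (so that every honest block mined after $s+\Delta$ contains it, unless the chain extended by that block does) is not confirmed by some honest node at some time $t>s+T$. The protocol is secure against a class of attacks if for every $\varepsilon>0$ there are $k$ and $T$ such that, for every time $s\ge0$ at which the adversary may aim, persistence and liveness at $s$ each fail with probability at most $\varepsilon$. It is secure if this holds for all attacks, including those that know all arrival times in advance. In the private attack aimed at time $s$ the adversary mines a single private chain from genesis, each new block on top of a deepest private block mined at least $\Delta_a$ earlier, delays all honest blocks by $\Delta$, and publishes the private chain as soon as, after time $s+\Delta$, it is longer than every honest chain. *Claim.* 1. Almost surely, under every attack and for every honest block or genesis as root, the depth $D(t)$ reached by the adversarial subtree of that root by time $t$ satisfies $\limsup_{t\to\infty} D(t)/t\le\lambda_{\mathrm{eff}}$. Almost surely the private attack can be carried out for every aimed time, and the adversarial subtree of genesis in it satisfies $\liminf_{t\to\infty} D(t)/t\ge\lambda_{\mathrm{eff}}$. 2. Almost surely, under every attack the length $L(t)$ of the chain held at time $t$ by any given honest node satisfies $\liminf_{t\to\infty} L(t)/t\ge\lambda_{\mathrm{growth}}$;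 and if $L_s$ is the largest length that this node's chain can have at time $s$ in the private attack aimed at $s$, then $\limsup_{s\to\infty} L_s/s\le\lambda_{\mathrm{growth}}$. 3. If the protocol is secure against the private attack, it is secure against every class of attacks. It is secure if and only if $\lambda_{\mathrm{eff}}<\lambda_{\mathrm{growth}}$, and it is secure against the private attack if and only if $\lambda_{\mathrm{eff}}<\lambda_{\mathrm{growth}}$. 4. For every total rate $\lambda>0$, with $\lambda_a=\beta\lambda$ and $\lambda_h=(1-\beta)\lambda$, the equation $$\frac{\beta}{1+\beta\lambda\Delta_a}=\frac{1-\beta}{1+(1-\beta)\lambda\Delta}$$ has exactly one solution $\beta_{\mathrm{pa}}\in(0,1)$; for $\beta\in(0,1)$ the protocol is secure if and only if $\beta<\beta_{\mathrm{pa}}$; and both the security threshold $\beta^*$ (the supremum of the $\beta\in(0,1)$ for which the protocol is secure) and the private-attack threshold (the same supremum for security against the private attack alone) equal $\beta_{\mathrm{pa}}$. -/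

import Mathlib

open MeasureTheory ProbabilityTheory Filter Topology

namespace DelayRace

/-- Every block that can occur: the genesis block, the block mined at the `i`-th honest arrival, and
the blocks mined at the `j`-th adversarial arrival. An adversarial arrival may be used on several
parents at once (`adv j 0`, `adv j 1`, ...), as in proof-of-stake; a proof-of-work adversary uses
`adv j 0` only. Unused copies may sit on top of genesis and need never be shown to anybody. -/
inductive Block : Type
  | genesis : Block
  | honest (i : ℕ) : Block
  | adv (j m : ℕ) : Block

/-- Adversarial blocks. -/
def Block.IsAdv : Block → Prop
  | .genesis => False
  | .honest _ => False
  | .adv _ _ => True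

/-- The arrival times of the honest blocks (first component) and of the adversarial blocks
(second component). -/
abbrev Arrivals : Type := (ℕ → ℝ) × (ℕ → ℝ)

instance : IsProbabilityMeasure (expMeasure 1) := isProbabilityMeasure_expMeasure one_pos

/-- The law of the sequence of arrival times of a Poisson process of rate `r > 0`: partial sums of
independent exponential gaps of rate `r` (standard exponential gaps divided by `r`). -/
noncomputable def poissonArrivals (r : ℝ) : Measure (ℕ → ℝ) :=
  (Measure.infinitePi (fun _ : ℕ => expMeasure 1)).map
    (fun g n => (∑ i ∈ Finset.range (n + 1), g i) / r)

/-- Independent Poisson arrivals, honest ones at rate `lh` and adversarial ones at rate `la`. -/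
noncomputable def arrivalLaw (lh la : ℝ) : Measure Arrivals :=
  (poissonArrivals lh).prod (poissonArrivals la)

/-- The time at which a block is mined. -/
def mineTime (ω : Arrivals) : Block → ℝ
  | .genesis => 0
  | .honest i => ω.1 i
  | .adv j _ => ω.2 j

/-- Everything that happens in one run of the protocol. Honest mining power is spread over infinitely
many honest nodes, each of infinitesimal power: node `i` is the one that mines the `i`-th honest
block, and node `p` follows the protocol at all times `t`.
* `parent b` is the block that `b` extends;
* `view p t` is the set of blocks received by the honest node `p` before time `t`;
* `tip p t` is the last block of the chain held by the honest node `p` at time `t`. -/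
structure Play where
  parent : Block → Block
  view : ℕ → ℝ → Set Block
  tip : ℕ → ℝ → Block

/-- The height of a block: its distance to genesis in the block tree. -/
noncomputable def Play.height (x : Play) (b : Block) : ℕ :=
  sInf {n : ℕ | x.parent^[n] b = Block.genesis}

/-- `c` is a block of the chain that ends in `b`. -/
def Play.OnChain (x : Play) (c b : Block) : Prop :=
  ∃ n : ℕ, x.parent^[n] b = c

/-- The runs that an adversary can bring about in the static model with honest delay `Δ` and internal
adversarial delay `Δa`. The adversary chooses the parents of its own blocks, the delivery of
all blocks to the honest nodes, and the choice between longest chains of equal length. -/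
structure Admissible (Δ Δa : ℝ) (ω : Arrivals) (x : Play) : Prop where
  parent_genesis : x.parent Block.genesis = Block.genesis
  /-- a block extends a block mined earlier -/
  parent_earlier : ∀ b, b ≠ Block.genesis → mineTime ω (x.parent b) < mineTime ω b
  /-- an adversarial block reaches the other adversarial miners only after `Δa` -/
  adv_delay : ∀ j m i l, x.parent (.adv j m) = .adv i l → ω.2 i + Δa ≤ ω.2 j
  /-- honest miners extend the chain they hold -/
  honest_parent : ∀ i, x.parent (.honest i) = x.tip i (ω.1 i)
  /-- the chain held by an honest node is a longest one among those it knows -/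
  tip_mem : ∀ p t, x.tip p t ∈ x.view p t
  tip_longest : ∀ p t, ∀ b ∈ x.view p t, x.height b ≤ x.height (x.tip p t)
  genesis_mem : ∀ p t, Block.genesis ∈ x.view p t
  /-- only blocks that exist can be received -/
  view_past : ∀ p t, ∀ b ∈ x.view p t, b ≠ Block.genesis → mineTime ω b < t
  /-- blocks are received together with the chain they end -/
  view_parent : ∀ p t, ∀ b ∈ x.view p t, x.parent b ∈ x.view p t
  view_mono : ∀ p s t, s ≤ t → x.view p s ⊆ x.view p t
  /-- an honest node knows the block that it has mined -/
  own_mem : ∀ i t, ω.1 i < t → Block.honest i ∈ x.view i t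
  /-- what one honest node knows, all honest nodes know `Δ` later -/
  view_delay : ∀ p q s t, s + Δ ≤ t → x.view p s ⊆ x.view q t

/-- The depths reached by time `t` in the adversarial subtree of `root`: the blocks that descend from
`root` through adversarial blocks only. -/
def Play.subtreeDepths (x : Play) (ω : Arrivals) (root : Block) (t : ℝ) : Set ℕ :=
  {d | ∃ b, mineTime ω b ≤ t ∧ x.parent^[d] b = root ∧ ∀ k < d, (x.parent^[k] b).IsAdv}

/-- The maximum of `S t` grows at rate at most `r`: its upper limit after division by `t` is at
most `r`. -/
def GrowsAtMost (S : ℝ → Set ℕ) (r : ℝ) : Prop :=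
  ∀ ε > 0, ∀ᶠ t in atTop, ∀ d ∈ S t, (d : ℝ) ≤ (r + ε) * t

/-- The maximum of `S t` grows at rate at least `r`: its lower limit after division by `t` is at
least `r`. -/
def GrowsAtLeast (S : ℝ → Set ℕ) (r : ℝ) : Prop :=
  ∀ ε > 0, ∀ᶠ t in atTop, ∃ d ∈ S t, (r - ε) * t ≤ (d : ℝ)

/-- The effective growth rate of the adversarial chain. -/
noncomputable def lamEff (la Δa : ℝ) : ℝ := la / (1 + la * Δa)

/-- The growth rate of the honest chain. -/
noncomputable def lamGrowth (lh Δ : ℝ) : ℝ := lh / (1 + lh * Δ)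

/-- A transaction is given by the set `tx` of the blocks that contain it. The honest node `p` regards
it as confirmed at time `t`, with confirmation depth `k`, if it is contained in a block of
the chain held by `p` on top of which that chain has at least `k` further blocks. -/
def Confirmed (x : Play) (k : ℕ) (tx : Set Block) (p : ℕ) (t : ℝ) : Prop :=
  ∃ b ∈ tx, x.OnChain b (x.tip p t) ∧ x.height b + k ≤ x.height (x.tip p t)

/-- The transaction `tx` is submitted to the network by an honest node at time `s`: no older block
contains it, and every honest block mined after it has reached all honest nodes contains it
unless the chain extended by that block already does. -/
def Submitted (Δ : ℝ) (ω : Arrivals) (x : Play) (s : ℝ) (tx : Set Block) : Prop :=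
  (∀ b ∈ tx, s < mineTime ω b) ∧
    ∀ i, s + Δ < ω.1 i → ∃ b ∈ tx, x.OnChain b (.honest i)

/-- Persistence fails at time `s`: some transaction is confirmed by all honest nodes at time `s`, but
at some time after `s + Δ` some honest node does not regard it as confirmed. -/
def PersistenceFails (Δ : ℝ) (k : ℕ) (s : ℝ) (x : Play) : Prop :=
  ∃ tx : Set Block, (∀ p, Confirmed x k tx p s) ∧ ∃ t > s + Δ, ∃ p, ¬ Confirmed x k tx p t

/-- Liveness with waiting time `T` fails at time `s`: some transaction submitted at time `s` is, at some
time after `s + T`, not confirmed by some honest node. -/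
def LivenessFails (Δ : ℝ) (k : ℕ) (T s : ℝ) (ω : Arrivals) (x : Play) : Prop :=
  ∃ tx : Set Block, Submitted Δ ω x s tx ∧ ∃ t > s + T, ∃ p, ¬ Confirmed x k tx p t

/-- An attack: the runs that the adversary may bring about when it aims at time `s` and the arrivals
are `ω`. A strategy that determines the run is the special case of a single run. -/
abbrev Attack : Type := ℝ → Arrivals → Set Play

/-- The protocol is secure against an attack: for every `ε > 0` there are a confirmation depth and a
waiting time for which, whatever time the adversary aims at, persistence and liveness fail with
probability at most `ε` each. -/
def SecureAgainst (lh la Δ Δa : ℝ) (A : Attack) : Prop :=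
  ∀ ε : ℝ, 0 < ε → ∃ (k : ℕ) (T : ℝ), ∀ s : ℝ, 0 ≤ s →
    arrivalLaw lh la {ω | ∃ x ∈ A s ω, Admissible Δ Δa ω x ∧ PersistenceFails Δ k s x}
      ≤ ENNReal.ofReal ε ∧
    arrivalLaw lh la {ω | ∃ x ∈ A s ω, Admissible Δ Δa ω x ∧ LivenessFails Δ k T s ω x}
      ≤ ENNReal.ofReal ε

/-- The protocol is secure: the adversary may choose any admissible run, even with knowledge of all
arrivals. -/
def Secure (lh la Δ Δa : ℝ) : Prop :=
  SecureAgainst lh la Δ Δa (fun _ _ => Set.univ)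

/-- The blocks of the private chain that have reached all adversarial miners by time `t`. -/
def privateKnown (Δa : ℝ) (ω : Arrivals) (t : ℝ) : Set Block :=
  {b | b = .genesis ∨ ∃ i, b = .adv i 0 ∧ ω.2 i < t ∧ ω.2 i + Δa ≤ t}

/-- At time `r` the private chain is strictly longer than every chain of honest blocks. -/
def Overtakes (ω : Arrivals) (x : Play) (r : ℝ) : Prop :=
  ∃ j, ω.2 j < r ∧ ∀ i, ω.1 i < r → x.height (.honest i) < x.height (.adv j 0)

/-- In the private attack aimed at time `s` the private chain is public at time `t`: it has overtaken
the honest chain at some time after `s + Δ` and before `t`. -/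
def Released (Δ s : ℝ) (ω : Arrivals) (x : Play) (t : ℝ) : Prop :=
  ∃ r, s + Δ < r ∧ r < t ∧ Overtakes ω x r

/-- The private attack aimed at time `s`. The adversary mines one private chain from genesis, each new
block on top of a deepest private block it knows; it delays all honest blocks by `Δ`; and it
publishes the private chain as soon as that chain is longer than the honest one after time
`s + Δ`. -/
def PrivateAttack (Δ Δa : ℝ) : Attack := fun s ω =>
  {x | (∀ j, x.parent (.adv j 0) ∈ privateKnown Δa ω (ω.2 j) ∧
        ∀ b ∈ privateKnown Δa ω (ω.2 j), x.height b ≤ x.height (x.parent (.adv j 0))) ∧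
      (∀ j m, m ≠ 0 → x.parent (.adv j m) = .genesis) ∧
      ∀ p t, x.view p t =
        {b | b = .genesis ∨ (∃ i, b = .honest i ∧ (ω.1 i + Δ < t ∨ (i = p ∧ ω.1 i < t))) ∨
          (∃ j, b = .adv j 0 ∧ ω.2 j < t ∧ Released Δ s ω x t)}}

/-- The security threshold: the largest share of the total block rate `lam` that the adversary may
hold (as a supremum) with the protocol secure against all attacks. -/
noncomputable def securityThreshold (lam Δ Δa : ℝ) : ℝ :=
  sSup {β | β ∈ Set.Ioo (0 : ℝ) 1 ∧ Secure ((1 - β) * lam) (β * lam) Δ Δa}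

/-- The private attack threshold: the same with the private attack as the only attack. -/
noncomputable def privateAttackThreshold (lam Δ Δa : ℝ) : ℝ :=
  sSup {β | β ∈ Set.Ioo (0 : ℝ) 1 ∧
    SecureAgainst ((1 - β) * lam) (β * lam) Δ Δa (PrivateAttack Δ Δa)}

end DelayRace

open DelayRace

namespace DelayRace

/-! ### Independent sequences generated by a measure-preserving shift -/

section Iid

variable {S : Type*} [MeasurableSpace S]

/-! Both growth rates come from one renewal process. Thin a Poisson process of rate r greedily: keep
the first arrival, and after each kept arrival discard those less than d later. Because the process
restarts afresh at the end of a dead time (`IsMemoryless.map_past_after`), the gaps of the thinned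
process are d plus independent exponential variables (`IsMemoryless.map_thinGaps`), so the law of
large numbers gives it the rate r / (1 + r d). With d = Δa this is `lamEff`, with d = Δ it is
`lamGrowth`.

The block tree is tied to the thinned processes path by path. Consecutive adversarial blocks are at
least Δa apart, so their number is bounded by the thinned adversarial process
(`Admissible.thin_le_mineTime`). An honest block at a kept arrival sees the block of the previous
kept arrival, so honest heights are at least the thinned count
(`Admissible.lt_height_honest_thinIdx`). In the private attack both bounds are attained until the
release, which gives all statements on growth.

If `lamGrowth` ≤ `lamEff`, the difference of the n-th thinned times is a random walk with drift in
favour of the adversary or zero. By the central limit theorem the private chain is ahead at a late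
index n with a probability bounded away from 0 (`eventually_le_measure_thin_lt`); this covers the
case of equality. Such a lead after the aimed time discards every honest block
(`Admissible.persistenceFails_of_private`), however large the confirmation depth, as the aimed time
may be late.

If `lamEff` < `lamGrowth`, divide time into cells of length κ, whose contents are independent and
identically distributed (`map_cells`). The honest growth minus the adversarial growth in a cell has
a positive mean when κ is large, since effects at the ends cost at most one block per cell and
process (`gain_mean_pos`). The walk of these gains tends to infinity, so it has cuts: long runs of
cells with a single honest arrival and no adversarial one, away from which the walk loses at most M
in either direction. Any chain that misses the central honest block of a cut would have to extend an
earlier honest block by adversarial blocks only, and is then outgrown; so that block is on every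
chain held later, under every attack (`Admissible.onChain_cutBlock`). Long windows contain a cut
with high probability, uniformly in their position (`exists_window_isCut`). A cut shortly before s
gives persistence at s, one shortly after s gives liveness.

Hence security against everything and security against the private attack are the same inequality.
Its two sides are monotone in the adversarial share in opposite directions, which yields the
threshold. -/

theorem eq_infinitePi_of_forall_lt {ν : Measure S} [IsProbabilityMeasure ν] {μ : Measure (ℕ → S)}
    (h : ∀ (N : ℕ) (t : ℕ → Set S), (∀ i, MeasurableSet (t i)) →
      μ {x | ∀ i < N, x i ∈ t i} = ∏ i ∈ Finset.range N, ν (t i)) :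
    μ = Measure.infinitePi (fun _ => ν) := by
  classical
  refine Measure.eq_infinitePi _ fun s t ht => ?_
  obtain ⟨N, hN⟩ := s.exists_nat_subset_range
  have := h N (fun i => if i ∈ s then t i else Set.univ) (fun i => by
    split_ifs
    · exact ht i
    · exact MeasurableSet.univ)
  have e : {x : ℕ → S | ∀ i < N, x i ∈ (if i ∈ s then t i else Set.univ)} =
      Set.pi (s : Set ℕ) t := by
    ext x
    simp only [Set.mem_ofPred_eq, Set.mem_pi, Finset.mem_coe]
    constructor
    · intro hx i hi
      have := hx i (Finset.mem_range.1 (hN hi))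
      simpa [hi] using this
    · intro hx i _
      by_cases hi : i ∈ s
      · simpa [hi] using hx i hi
      · simp [hi]
  rw [e] at this
  rw [this, ← Finset.prod_subset hN]
  · exact Finset.prod_congr rfl fun i hi => by simp [hi]
  · intro i _ hi
    simp [hi]

theorem infinitePi_lt {ν : Measure S} [IsProbabilityMeasure ν] (N : ℕ) (t : ℕ → Set S)
    (ht : ∀ i, MeasurableSet (t i)) :
    Measure.infinitePi (fun _ : ℕ => ν) {x | ∀ i < N, x i ∈ t i} =
      ∏ i ∈ Finset.range N, ν (t i) := by
  rw [← Measure.infinitePi_pi (fun _ : ℕ => ν) (s := Finset.range N) (t := t) (fun i _ => ht i)]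
  congr 1
  ext x
  simp [Set.mem_pi]

/-- If `f` is independent of the measure-preserving shift `θ`, then the values of `f` along the
orbit of `θ` are independent with the law of `f`. -/
theorem map_orbit_eq_infinitePi {Ω : Type*} [MeasurableSpace Ω] {μ : Measure Ω}
    [IsProbabilityMeasure μ] {θ : Ω → Ω} {f : Ω → S} (hθ : Measurable θ) (hf : Measurable f)
    (h : μ.map (fun ω => (f ω, θ ω)) = (μ.map f).prod μ) :
    μ.map (fun ω n => f (θ^[n] ω)) = Measure.infinitePi (fun _ => μ.map f) := by
  have hm : Measurable (fun ω (n : ℕ) => f (θ^[n] ω)) :=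
    measurable_pi_lambda _ fun n => hf.comp (hθ.iterate n)
  have : IsProbabilityMeasure (μ.map f) := Measure.isProbabilityMeasure_map hf.aemeasurable
  have hset : ∀ (N : ℕ) (t : ℕ → Set S), (∀ i, MeasurableSet (t i)) →
      MeasurableSet {x : ℕ → S | ∀ i < N, x i ∈ t i} := by
    intro N t ht
    have : {x : ℕ → S | ∀ i < N, x i ∈ t i} = ⋂ i, ⋂ (_ : i < N), (fun x => x i) ⁻¹' (t i) := by
      ext; simp
    rw [this]
    exact MeasurableSet.iInter fun i => MeasurableSet.iInter fun _ => (measurable_pi_apply i) (ht i)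
  refine eq_infinitePi_of_forall_lt fun N => ?_
  induction N with
  | zero => intro t ht; rw [Measure.map_apply hm (hset 0 t ht)]; simp
  | succ N ih =>
    intro t ht
    have ih' := ih (fun i => t (i + 1)) (fun i => ht _)
    rw [Measure.map_apply hm (hset N _ fun i => ht _)] at ih'
    rw [Measure.map_apply hm (hset _ t ht), Finset.prod_range_succ', ← ih', mul_comm,
      ← Measure.prod_prod, ← h, Measure.map_apply (hf.prodMk hθ)]
    · congr 1
      ext ω
      simp only [Set.mem_preimage, Set.mem_ofPred_eq, Set.mem_prod, ← Function.iterate_succ_apply]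
      constructor
      · intro hx
        exact ⟨hx 0 (by omega), fun i hi => hx (i + 1) (by omega)⟩
      · rintro ⟨h0, h1⟩ i hi
        cases i with
        | zero => exact h0
        | succ i => exact h1 i (by omega)
    · exact (ht 0).prod (hm (hset N _ fun i => ht _))

theorem measurePreserving_of_map_prodMk {Ω : Type*} [MeasurableSpace Ω] {μ : Measure Ω}
    [IsProbabilityMeasure μ] {θ : Ω → Ω} {f : Ω → S} (hθ : Measurable θ) (hf : Measurable f)
    {ρ : Measure S} [IsProbabilityMeasure ρ]
    (h : μ.map (fun ω => (f ω, θ ω)) = ρ.prod μ) : MeasurePreserving θ μ μ := by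
  refine ⟨hθ, ?_⟩
  have := congrArg (Measure.map Prod.snd) h
  rw [Measure.map_map measurable_snd (hf.prodMk hθ)] at this
  have e : (Measure.map Prod.snd (ρ.prod μ)) = μ := by simp [Measure.map_snd_prod]
  rw [e] at this
  exact this

theorem map_fst_of_map_prodMk {Ω : Type*} [MeasurableSpace Ω] {μ : Measure Ω}
    [IsProbabilityMeasure μ] {θ : Ω → Ω} {f : Ω → S} (hθ : Measurable θ) (hf : Measurable f)
    {ρ : Measure S} [IsProbabilityMeasure ρ]
    (h : μ.map (fun ω => (f ω, θ ω)) = ρ.prod μ) : μ.map f = ρ := by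
  have := congrArg (Measure.map Prod.fst) h
  rw [Measure.map_map measurable_fst (hf.prodMk hθ)] at this
  have e : (Measure.map Prod.fst (ρ.prod μ)) = ρ := by simp [Measure.map_fst_prod]
  rw [e] at this
  exact this

/-- The shift of an independent sequence is independent of its first terms. -/
theorem map_head_shift_infinitePi {ν : Measure S} [IsProbabilityMeasure ν] :
    (Measure.infinitePi (fun _ : ℕ => ν)).map (fun x => (x 0, fun n => x (n + 1))) =
      ν.prod (Measure.infinitePi (fun _ : ℕ => ν)) := by
  set P := Measure.infinitePi (fun _ : ℕ => ν)
  have hind : IndepFun (fun x : ℕ → S => x 0) (fun x : ℕ → S => fun n => x (n + 1)) P := by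
    have hc : Measurable (fun p : S × (ℕ → S) => fun n : ℕ => Nat.casesOn (motive := fun _ => S) n p.1 p.2) := by
      refine measurable_pi_lambda _ fun n => ?_
      cases n with
      | zero => exact measurable_fst
      | succ n => exact (measurable_pi_apply n).comp measurable_snd
    -- Prepending an independent term with law ν reproduces the law P, so independence may be
    -- checked on the product space, where it is evident.
    have key : (ν.prod P).map
        (fun p : S × (ℕ → S) => fun n : ℕ => Nat.casesOn (motive := fun _ => S) n p.1 p.2) = P := by
      refine eq_infinitePi_of_forall_lt fun N t ht => ?_
      have hset : MeasurableSet {x : ℕ → S | ∀ i < N, x i ∈ t i} := by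
        have : {x : ℕ → S | ∀ i < N, x i ∈ t i} =
            ⋂ i, ⋂ (_ : i < N), (fun x => x i) ⁻¹' (t i) := by
          ext; simp
        rw [this]
        exact MeasurableSet.iInter fun i =>
          MeasurableSet.iInter fun _ => (measurable_pi_apply i) (ht i)
      rw [Measure.map_apply hc hset]
      cases N with
      | zero => simp
      | succ N =>
        rw [Finset.prod_range_succ', ← infinitePi_lt N _ (fun i => ht (i + 1)), mul_comm,
          ← Measure.prod_prod]
        congr 1
        ext p
        simp only [Set.mem_preimage, Set.mem_ofPred_eq, Set.mem_prod]
        constructor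
        · intro hx
          exact ⟨hx 0 (by omega), fun i hi => hx (i + 1) (by omega)⟩
        · rintro ⟨h0, h1⟩ i hi
          cases i with
          | zero => exact h0
          | succ i => exact h1 i (by omega)
    rw [indepFun_iff_map_prod_eq_prod_map_map (Measurable.aemeasurable (by fun_prop)) (Measurable.aemeasurable (by fun_prop)), ← key,
      Measure.map_map (by fun_prop) hc, Measure.map_map (by fun_prop) hc,
      Measure.map_map (by fun_prop) hc]
    change (ν.prod P).map id = ((ν.prod P).map Prod.fst).prod ((ν.prod P).map Prod.snd)
    simp [Measure.map_fst_prod, Measure.map_snd_prod]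
  rw [(indepFun_iff_map_prod_eq_prod_map_map (Measurable.aemeasurable (by fun_prop)) (Measurable.aemeasurable (by fun_prop))).1 hind]
  congr 1
  · exact Measure.infinitePi_map_eval (fun _ : ℕ => ν) 0
  · exact Measure.map_infinitePi_infinitePi_of_inj (P := fun _ : ℕ => ν) (add_left_injective 1)

end Iid

/-! ### Arrival sequences and the memoryless property -/

/-- The arrival sequence with first arrival at time `p.1` after which the arrivals `p.2` follow. -/
def arrivalCons (p : ℝ × (ℕ → ℝ)) : ℕ → ℝ
  | 0 => p.1
  | n + 1 => p.1 + p.2 n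

/-- The arrivals after the first one, timed from there. -/
def arrivalTail (T : ℕ → ℝ) : ℕ → ℝ := fun n => T (n + 1) - T 0

/-- The number of arrivals before time `t`. -/
noncomputable def arrivalCount (T : ℕ → ℝ) (t : ℝ) : ℕ := sInf {n | t ≤ T n}

/-- The arrivals at or after time `t`, timed from there. -/
noncomputable def arrivalAfter (t : ℝ) (T : ℕ → ℝ) : ℕ → ℝ :=
  fun n => T (arrivalCount T t + n) - t

/-- The arrivals before time `t`. -/
noncomputable def arrivalPast (t : ℝ) (T : ℕ → ℝ) : ℕ → ℝ := fun n => min (T n) t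

/-- Sequences that can be arrival times of a simple point process on the positive half-line. -/
structure RegularArrivals (T : ℕ → ℝ) : Prop where
  strictMono : StrictMono T
  pos : 0 < T 0
  tendsto : Tendsto T atTop atTop

theorem measurable_arrivalCons : Measurable arrivalCons := by
  refine measurable_pi_lambda _ fun n => ?_
  cases n with
  | zero => exact measurable_fst
  | succ n => exact measurable_fst.add ((measurable_pi_apply n).comp measurable_snd)

theorem measurable_arrivalTail : Measurable arrivalTail := by
  unfold arrivalTail; fun_prop

theorem measurable_arrivalPast (t : ℝ) : Measurable (arrivalPast t) := by
  unfold arrivalPast; fun_prop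

theorem arrivalCount_eq_iff {T : ℕ → ℝ} {t : ℝ} {n : ℕ} (h : ∃ m, t ≤ T m) :
    arrivalCount T t = n ↔ (∀ k < n, T k < t) ∧ t ≤ T n := by
  constructor
  · rintro rfl
    refine ⟨fun k hk => ?_, Nat.sInf_mem (s := {n | t ≤ T n}) h⟩
    by_contra hc
    exact absurd (Nat.sInf_le (s := {n | t ≤ T n}) (not_lt.1 hc)) (not_le.2 hk)
  · rintro ⟨h1, h2⟩
    refine le_antisymm (Nat.sInf_le (s := {n | t ≤ T n}) h2) ?_
    by_contra hc
    have := Nat.sInf_mem (s := {n | t ≤ T n}) ⟨n, h2⟩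
    exact absurd (h1 _ (not_le.1 hc)) (not_lt.2 this)

theorem measurable_arrivalCount (t : ℝ) : Measurable (fun T => arrivalCount T t) := by
  refine measurable_to_countable' fun n => ?_
  have hM : ∀ m : ℕ, MeasurableSet {T : ℕ → ℝ | t ≤ T m} := fun m =>
    measurableSet_le measurable_const (measurable_pi_apply m)
  have hE : MeasurableSet {T : ℕ → ℝ | ∃ m, t ≤ T m} := by
    rw [Set.ofPred_exists]; exact MeasurableSet.iUnion hM
  have hN : MeasurableSet {T : ℕ → ℝ | (∀ k < n, T k < t) ∧ t ≤ T n} := by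
    have : {T : ℕ → ℝ | (∀ k < n, T k < t) ∧ t ≤ T n} =
        (⋂ k, ⋂ (_ : k < n), {T : ℕ → ℝ | t ≤ T k}ᶜ) ∩ {T : ℕ → ℝ | t ≤ T n} := by
      ext; simp
    rw [this]
    exact (MeasurableSet.iInter fun k => MeasurableSet.iInter fun _ => (hM k).compl).inter (hM n)
  -- If no arrival reaches `t`, the infimum of the empty set is 0, so this event contributes to the
  -- level `n = 0`.
  have : (fun T => arrivalCount T t) ⁻¹' {n} =
      ({T : ℕ → ℝ | ∃ m, t ≤ T m} ∩ {T : ℕ → ℝ | (∀ k < n, T k < t) ∧ t ≤ T n}) ∪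
        ({T : ℕ → ℝ | ∃ m, t ≤ T m}ᶜ ∩ {_T | n = 0}) := by
    ext T
    simp only [Set.mem_preimage, Set.mem_singleton_iff, Set.mem_union, Set.mem_inter_iff,
      Set.mem_compl_iff, Set.mem_ofPred_eq]
    by_cases h : ∃ m, t ≤ T m
    · rw [arrivalCount_eq_iff h]; simp [h]
    · have : {n | t ≤ T n} = ∅ := by
        ext m; simp only [Set.mem_ofPred_eq, Set.mem_empty_iff_false, iff_false]
        exact fun hm => h ⟨m, hm⟩
      simp only [h, arrivalCount, this, Nat.sInf_empty]
      simp [eq_comm]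
  rw [this]
  exact (hE.inter hN).union (hE.compl.inter (MeasurableSet.const _))

theorem measurable_arrivalAfter (t : ℝ) : Measurable (arrivalAfter t) := by
  refine measurable_pi_lambda _ fun n => Measurable.sub_const ?_ t
  have h : Measurable (fun p : (ℕ → ℝ) × ℕ => p.1 p.2) :=
    measurable_from_prod_countable_left fun m => measurable_pi_apply m
  exact h.comp (measurable_id.prodMk ((measurable_arrivalCount t).add_const n))

theorem RegularArrivals.exists_le {T : ℕ → ℝ} (h : RegularArrivals T) (t : ℝ) :
    ∃ m, t ≤ T m := (h.tendsto.eventually_ge_atTop t).exists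

theorem RegularArrivals.lt_arrivalCount {T : ℕ → ℝ} (h : RegularArrivals T) {t : ℝ} {n : ℕ} :
    n < arrivalCount T t ↔ T n < t := by
  obtain ⟨h1, h2⟩ := (arrivalCount_eq_iff (h.exists_le t)).1 rfl
  refine ⟨h1 n, fun hn => ?_⟩
  by_contra hc
  exact absurd (h2.trans (h.strictMono.monotone (not_lt.1 hc))) (not_le.2 hn)

theorem RegularArrivals.arrivalCount_le {T : ℕ → ℝ} (h : RegularArrivals T) {t : ℝ} {n : ℕ} :
    arrivalCount T t ≤ n ↔ t ≤ T n := by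
  rw [← not_lt, h.lt_arrivalCount, not_lt]

/-- A law of arrival times that has independent gaps with the law `ν`, and is memoryless. -/
structure IsMemoryless (ν : Measure ℝ) (μ : Measure (ℕ → ℝ)) : Prop where
  cons : (ν.prod μ).map arrivalCons = μ
  memoryless : ∀ t : ℝ, 0 ≤ t → (ν.restrict (Set.Ici t)).map (fun x => x - t) = ν (Set.Ici t) • ν
  regular : ∀ᵐ T ∂μ, RegularArrivals T

/-! ### Restarting a memoryless arrival process at a fixed time -/

section

variable {ν : Measure ℝ} {μ : Measure (ℕ → ℝ)} [IsProbabilityMeasure ν] [IsProbabilityMeasure μ]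

omit [IsProbabilityMeasure ν] [IsProbabilityMeasure μ] in
theorem IsMemoryless.map_head_tail (h : IsMemoryless ν μ) :
    μ.map (fun T => (T 0, arrivalTail T)) = ν.prod μ := by
  have hm : Measurable (fun T : ℕ → ℝ => (T 0, arrivalTail T)) :=
    (measurable_pi_apply 0).prodMk measurable_arrivalTail
  nth_rw 1 [← h.cons]
  rw [Measure.map_map hm measurable_arrivalCons]
  convert Measure.map_id using 2
  funext p
  refine Prod.ext rfl ?_
  funext n
  simp [arrivalTail, arrivalCons]

theorem measurableSet_arrivalCount_eq (n : ℕ) :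
    MeasurableSet {p : ℝ × (ℕ → ℝ) | (∀ k < n, p.2 k < p.1) ∧ p.1 ≤ p.2 n} := by
  have hm : ∀ k : ℕ, Measurable fun p : ℝ × (ℕ → ℝ) => p.2 k := fun k => by fun_prop
  have : {p : ℝ × (ℕ → ℝ) | (∀ k < n, p.2 k < p.1) ∧ p.1 ≤ p.2 n} =
      (⋂ k, ⋂ (_ : k < n), {p : ℝ × (ℕ → ℝ) | p.2 k < p.1}) ∩
        {p : ℝ × (ℕ → ℝ) | p.1 ≤ p.2 n} := by
    ext; simp
  rw [this]
  exact (MeasurableSet.iInter fun k => MeasurableSet.iInter fun _ =>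
    measurableSet_lt (hm k) measurable_fst).inter (measurableSet_le measurable_fst (hm n))

/-- Induction on the number `n` of arrivals before `t`. For `n = 0` the past is the constant `t`,
and only the first gap has to be restarted, which is the memoryless property of `ν`. Otherwise
condition on the first arrival `x < t`: the remaining arrivals have the law `μ` again, and the claim
for `n` applies at time `t - x`. -/
theorem IsMemoryless.measure_past_after (h : IsMemoryless ν μ) (n : ℕ) :
    ∀ t : ℝ, 0 ≤ t → ∀ B C : Set (ℕ → ℝ), MeasurableSet B → MeasurableSet C →
      μ {T | ((∀ k < n, T k < t) ∧ t ≤ T n) ∧ arrivalPast t T ∈ B ∧ (fun k => T (n + k) - t) ∈ C} =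
        μ {T | ((∀ k < n, T k < t) ∧ t ≤ T n) ∧ arrivalPast t T ∈ B} * μ C := by
  induction n with
  | zero =>
    intro t ht B C hB hC
    have hsub : ∀ᵐ T ∂μ, Monotone T := h.regular.mono fun T hT => hT.strictMono.monotone
    have hpast : ∀ T : ℕ → ℝ, Monotone T → t ≤ T 0 → arrivalPast t T = fun _ => t := by
      intro T hT h0
      funext k
      exact min_eq_right (h0.trans (hT (Nat.zero_le k)))
    by_cases hB' : (fun _ => t) ∈ B
    · have e1 : μ {T | ((∀ k < 0, T k < t) ∧ t ≤ T 0) ∧ arrivalPast t T ∈ B ∧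
          (fun k => T (0 + k) - t) ∈ C} = μ {T | t ≤ T 0 ∧ (fun k => T k - t) ∈ C} := by
        refine measure_congr ?_
        filter_upwards [hsub] with T hT
        refine propext ?_
        change (((∀ k < 0, T k < t) ∧ t ≤ T 0) ∧ arrivalPast t T ∈ B ∧
          (fun k => T (0 + k) - t) ∈ C) ↔ (t ≤ T 0 ∧ (fun k => T k - t) ∈ C)
        simp only [zero_add]
        constructor
        · rintro ⟨⟨_, h1⟩, _, h2⟩; exact ⟨h1, h2⟩
        · rintro ⟨h1, h2⟩
          exact ⟨⟨fun k hk => absurd hk (by omega), h1⟩, by rwa [hpast T hT h1], h2⟩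
      have e2 : μ {T | ((∀ k < 0, T k < t) ∧ t ≤ T 0) ∧ arrivalPast t T ∈ B} =
          μ {T | t ≤ T 0} := by
        refine measure_congr ?_
        filter_upwards [hsub] with T hT
        refine propext ?_
        change (((∀ k < 0, T k < t) ∧ t ≤ T 0) ∧ arrivalPast t T ∈ B) ↔ (t ≤ T 0)
        constructor
        · rintro ⟨⟨_, h1⟩, _⟩; exact h1
        · intro h1
          exact ⟨⟨fun k hk => absurd hk (by omega), h1⟩, by rwa [hpast T hT h1]⟩
      rw [e1, e2]
      have mS : Measurable (fun T : ℕ → ℝ => fun k => T k - t) := by fun_prop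
      have m0 : MeasurableSet {T : ℕ → ℝ | t ≤ T 0} :=
        measurableSet_le measurable_const (measurable_pi_apply 0)
      have m1 : MeasurableSet {T : ℕ → ℝ | t ≤ T 0 ∧ (fun k => T k - t) ∈ C} := m0.inter (mS hC)
      have hν : μ {T | t ≤ T 0} = ν (Set.Ici t) := by
        rw [← h.cons, Measure.map_apply measurable_arrivalCons m0]
        have : arrivalCons ⁻¹' {T | t ≤ T 0} = (Set.Ici t) ×ˢ Set.univ := by
          ext p; simp [arrivalCons]
        rw [this, Measure.prod_prod]
        simp
      rw [hν]
      nth_rw 1 [← h.cons]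
      rw [Measure.map_apply measurable_arrivalCons m1]
      have : arrivalCons ⁻¹' {T | t ≤ T 0 ∧ (fun k => T k - t) ∈ C} =
          (Set.Ici t ×ˢ Set.univ) ∩
            (Prod.map (fun x => x - t) id) ⁻¹' (arrivalCons ⁻¹' C) := by
        ext p
        simp only [Set.mem_preimage, Set.mem_ofPred_eq, Set.mem_inter_iff, Set.mem_prod,
          Set.mem_univ, and_true, Set.mem_Ici]
        refine and_congr Iff.rfl ?_
        have : (fun k => arrivalCons p k - t) = arrivalCons (Prod.map (fun x => x - t) id p) := by
          funext k
          cases k with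
          | zero => rfl
          | succ k => simp only [arrivalCons, Prod.map]; simp; ring
        rw [this]
      rw [this, Set.inter_comm, ← Measure.restrict_apply]
      · rw [← Measure.prod_restrict, Measure.restrict_univ, ← Measure.map_apply,
          ← Measure.map_prod_map, h.memoryless t ht, Measure.map_id, Measure.prod_smul_left,
          Measure.smul_apply, ← Measure.map_apply measurable_arrivalCons hC, h.cons, smul_eq_mul]
        all_goals first | exact (measurable_arrivalCons hC) | fun_prop
      · exact (Measurable.prodMap (by fun_prop) measurable_id) (measurable_arrivalCons hC)
    · have e1 : μ {T | ((∀ k < 0, T k < t) ∧ t ≤ T 0) ∧ arrivalPast t T ∈ B} = 0 := by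
        rw [measure_eq_zero_iff_ae_notMem]
        filter_upwards [hsub] with T hT
        rintro ⟨⟨_, h1⟩, h2⟩
        rw [hpast T hT h1] at h2
        exact hB' h2
      rw [e1, zero_mul]
      refine measure_mono_null ?_ e1
      rintro T ⟨h1, h2, _⟩
      exact ⟨h1, h2⟩
  | succ n ih =>
    intro t ht B C hB hC
    have hmB : ∀ k : ℕ, Measurable fun T : ℕ → ℝ => T k := fun k => measurable_pi_apply k
    have mE : MeasurableSet {T : ℕ → ℝ | (∀ k < n + 1, T k < t) ∧ t ≤ T (n + 1)} :=
      (measurable_const.prodMk measurable_id) (measurableSet_arrivalCount_eq (n + 1))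
    have mS : Measurable (fun T : ℕ → ℝ => fun k => T (n + 1 + k) - t) := by fun_prop
    have m1 : MeasurableSet {T : ℕ → ℝ | ((∀ k < n + 1, T k < t) ∧ t ≤ T (n + 1)) ∧
        arrivalPast t T ∈ B ∧ (fun k => T (n + 1 + k) - t) ∈ C} :=
      mE.inter ((measurable_arrivalPast t hB).inter (mS hC))
    have m2 : MeasurableSet {T : ℕ → ℝ | ((∀ k < n + 1, T k < t) ∧ t ≤ T (n + 1)) ∧
        arrivalPast t T ∈ B} := mE.inter (measurable_arrivalPast t hB)
    have hE : ∀ (x : ℝ) (S : ℕ → ℝ), ((∀ k < n + 1, arrivalCons (x, S) k < t) ∧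
        t ≤ arrivalCons (x, S) (n + 1)) ↔ x < t ∧ (∀ k < n, S k < t - x) ∧ t - x ≤ S n := by
      intro x S
      constructor
      · rintro ⟨h1, h2⟩
        refine ⟨h1 0 (by omega), fun k hk => ?_, ?_⟩
        · have := h1 (k + 1) (by omega)
          simp only [arrivalCons] at this
          linarith
        · simp only [arrivalCons] at h2
          linarith
      · rintro ⟨h1, h2, h3⟩
        refine ⟨fun k hk => ?_, ?_⟩
        · cases k with
          | zero => exact h1
          | succ k =>
            have := h2 k (by omega)
            simp only [arrivalCons]
            linarith
        · simp only [arrivalCons]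
          linarith
    have hP : ∀ (x : ℝ) (S : ℕ → ℝ), x < t → arrivalPast t (arrivalCons (x, S)) =
        arrivalCons (x, arrivalPast (t - x) S) := by
      intro x S hx
      funext k
      cases k with
      | zero => exact min_eq_left hx.le
      | succ k =>
        simp only [arrivalPast, arrivalCons]
        rw [← min_add_add_left]
        congr 1
        ring
    have hS : ∀ (x : ℝ) (S : ℕ → ℝ), (fun k => arrivalCons (x, S) (n + 1 + k) - t) =
        fun k => S (n + k) - (t - x) := by
      intro x S
      funext k
      rw [show n + 1 + k = (n + k) + 1 by ring]
      simp only [arrivalCons]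
      ring
    nth_rw 1 [← h.cons]
    nth_rw 2 [← h.cons]
    rw [Measure.map_apply measurable_arrivalCons m1, Measure.map_apply measurable_arrivalCons m2,
      Measure.prod_apply (measurable_arrivalCons m1), Measure.prod_apply (measurable_arrivalCons m2),
      ← lintegral_mul_const _ (measurable_measure_prodMk_left (measurable_arrivalCons m2))]
    refine lintegral_congr fun x => ?_
    by_cases hx : x < t
    · have := ih (t - x) (by linarith) ((fun S => arrivalCons (x, S)) ⁻¹' B) C
        ((measurable_arrivalCons.comp (measurable_const.prodMk measurable_id)) hB) hC
      convert this using 2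
      · ext S
        simp only [Set.mem_preimage, Set.mem_ofPred_eq, hE, hS]
        simp only [hx, true_and, hP x S hx]
      · congr 1
        ext S
        simp only [Set.mem_preimage, Set.mem_ofPred_eq, hE]
        simp only [hx, true_and, hP x S hx]
    · have e1 : Prod.mk x ⁻¹' (arrivalCons ⁻¹' {T : ℕ → ℝ | ((∀ k < n + 1, T k < t) ∧
          t ≤ T (n + 1)) ∧ arrivalPast t T ∈ B ∧ (fun k => T (n + 1 + k) - t) ∈ C}) = ∅ := by
        ext S
        simp only [Set.mem_preimage, Set.mem_ofPred_eq, hE]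
        simp [hx]
      have e2 : Prod.mk x ⁻¹' (arrivalCons ⁻¹' {T : ℕ → ℝ | ((∀ k < n + 1, T k < t) ∧
          t ≤ T (n + 1)) ∧ arrivalPast t T ∈ B}) = ∅ := by
        ext S
        simp only [Set.mem_preimage, Set.mem_ofPred_eq, hE]
        simp [hx]
      rw [e1, e2]
      simp

/-- The arrivals after a fixed time are independent of those before, and have the same law as the
whole process. -/
theorem IsMemoryless.map_past_after (h : IsMemoryless ν μ) {t : ℝ} (ht : 0 ≤ t) :
    μ.map (fun T => (arrivalPast t T, arrivalAfter t T)) = (μ.map (arrivalPast t)).prod μ := by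
  have hm : Measurable fun T => (arrivalPast t T, arrivalAfter t T) :=
    (measurable_arrivalPast t).prodMk (measurable_arrivalAfter t)
  have : IsProbabilityMeasure (μ.map (arrivalPast t)) :=
    Measure.isProbabilityMeasure_map (measurable_arrivalPast t).aemeasurable
  symm
  refine Measure.prod_eq fun B C hB hC => ?_
  rw [Measure.map_apply hm (hB.prod hC), Measure.map_apply (measurable_arrivalPast t) hB]
  have mE : ∀ n, MeasurableSet {T : ℕ → ℝ | (∀ k < n, T k < t) ∧ t ≤ T n} := fun n =>
    (measurable_const.prodMk measurable_id) (measurableSet_arrivalCount_eq n)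
  have hdis : Pairwise (Function.onFun Disjoint
      fun n : ℕ => {T : ℕ → ℝ | (∀ k < n, T k < t) ∧ t ≤ T n}) := by
    intro a b hab
    refine Set.disjoint_left.2 ?_
    rintro T ⟨h1, h2⟩ ⟨h3, h4⟩
    rcases lt_or_gt_of_ne hab with hlt | hlt
    · exact absurd (h3 a hlt) (not_lt.2 h2)
    · exact absurd (h1 b hlt) (not_lt.2 h4)
  -- The number of arrivals before `t` is almost surely finite, so its values partition the space,
  -- and on each part the restarted process is an ordinary shift.
  have hcover : ∀ D : Set (ℕ → ℝ), MeasurableSet D →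
      μ D = ∑' n : ℕ, μ ({T : ℕ → ℝ | (∀ k < n, T k < t) ∧ t ≤ T n} ∩ D) := by
    intro D hD
    rw [← measure_iUnion]
    · refine measure_congr ?_
      filter_upwards [h.regular] with T hT
      refine propext ⟨fun hTD => Set.mem_iUnion.2 ⟨arrivalCount T t, ?_, hTD⟩, fun hTD => ?_⟩
      · exact (arrivalCount_eq_iff (hT.exists_le t)).1 rfl
      · obtain ⟨n, hn⟩ := Set.mem_iUnion.1 hTD
        exact hn.2
    · intro a b hab
      exact (hdis hab).mono Set.inter_subset_left Set.inter_subset_left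
    · exact fun n => (mE n).inter hD
  rw [hcover _ (hm (hB.prod hC)), hcover _ (measurable_arrivalPast t hB), ← ENNReal.tsum_mul_right]
  refine tsum_congr fun n => ?_
  convert h.measure_past_after n t ht B C hB hC using 2
  · ext T
    simp only [Set.mem_inter_iff, Set.mem_preimage, Set.mem_prod, Set.mem_ofPred_eq]
    constructor
    · rintro ⟨h1, h2, h3⟩
      refine ⟨h1, h2, ?_⟩
      have := (arrivalCount_eq_iff ⟨n, h1.2⟩).2 h1
      have e : arrivalAfter t T = fun k => T (n + k) - t := by
        funext k
        change T (arrivalCount T t + k) - t = _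
        rw [this]
      rwa [e] at h3
    · rintro ⟨h1, h2, h3⟩
      refine ⟨h1, h2, ?_⟩
      have := (arrivalCount_eq_iff ⟨n, h1.2⟩).2 h1
      have e : arrivalAfter t T = fun k => T (n + k) - t := by
        funext k
        change T (arrivalCount T t + k) - t = _
        rw [this]
      rwa [e]
  · rfl

end

/-! ### Exponential gaps and Poisson arrivals -/

theorem expMeasure_one_eq : expMeasure 1 = volume.withDensity (exponentialPDF 1) := rfl

instance : NullSingletonClass (expMeasure 1) := by
  rw [expMeasure_one_eq]
  exact ⟨fun x => withDensity_absolutelyContinuous _ _ (measure_singleton x)⟩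

theorem expMeasure_one_Ici {x : ℝ} (hx : 0 ≤ x) :
    expMeasure 1 (Set.Ici x) = ENNReal.ofReal (Real.exp (-x)) := by
  have h1 : expMeasure 1 (Set.Iic x) = ENNReal.ofReal (1 - Real.exp (-x)) := by
    rw [expMeasure_one_eq, withDensity_apply _ measurableSet_Iic,
      lintegral_exponentialPDF_eq_antiDeriv one_pos, if_pos hx, one_mul]
  have h2 : expMeasure 1 (Set.Ici x) = expMeasure 1 (Set.Ioi x) := measure_congr Ioi_ae_eq_Ici.symm
  rw [h2, ← Set.compl_Iic, measure_compl measurableSet_Iic (measure_ne_top _ _), measure_univ, h1,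
    ← ENNReal.ofReal_one, ← ENNReal.ofReal_sub]
  · congr 1; ring
  · simp [hx]

theorem integrable_expMeasure_one_iff {f : ℝ → ℝ} :
    Integrable f (expMeasure 1) ↔ IntegrableOn (fun x => Real.exp (-x) * f x) (Set.Ioi 0) := by
  have hm : Measurable fun x => Real.toNNReal (exponentialPDFReal 1 x) := by fun_prop
  have e : expMeasure 1 =
      volume.withDensity (fun x => ((Real.toNNReal (exponentialPDFReal 1 x) : NNReal) : ENNReal)) :=
    rfl
  rw [e, integrable_withDensity_iff_integrable_smul hm, ← integrable_indicator_iff measurableSet_Ioi]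
  refine integrable_congr ?_
  filter_upwards [Measure.ae_ne volume (0 : ℝ)] with x hx
  rw [NNReal.smul_def, Real.coe_toNNReal _ (exponentialPDFReal_nonneg one_pos x)]
  rcases lt_or_gt_of_ne hx with h | h
  · rw [Set.indicator_of_notMem (by simpa using h.le)]
    simp [exponentialPDFReal, gammaPDFReal, not_le.2 h]
  · rw [Set.indicator_of_mem (by simpa using h)]
    simp [exponentialPDFReal, gammaPDFReal, h.le]

theorem integral_expMeasure_one {f : ℝ → ℝ} :
    ∫ x, f x ∂(expMeasure 1) = ∫ x in Set.Ioi 0, Real.exp (-x) * f x := by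
  have hm : Measurable fun x => Real.toNNReal (exponentialPDFReal 1 x) := by fun_prop
  have e : expMeasure 1 =
      volume.withDensity (fun x => ((Real.toNNReal (exponentialPDFReal 1 x) : NNReal) : ENNReal)) :=
    rfl
  rw [e, integral_withDensity_eq_integral_smul hm, ← integral_indicator measurableSet_Ioi]
  refine integral_congr_ae ?_
  filter_upwards [Measure.ae_ne volume (0 : ℝ)] with x hx
  rw [NNReal.smul_def, Real.coe_toNNReal _ (exponentialPDFReal_nonneg one_pos x)]
  rcases lt_or_gt_of_ne hx with h | h
  · rw [Set.indicator_of_notMem (by simpa using h.le)]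
    simp [exponentialPDFReal, gammaPDFReal, not_le.2 h]
  · rw [Set.indicator_of_mem (by simpa using h)]
    simp [exponentialPDFReal, gammaPDFReal, h.le]

theorem memLp_id_expMeasure_one : MemLp (fun x : ℝ => x) 2 (expMeasure 1) := by
  rw [memLp_two_iff_integrable_sq (by fun_prop), integrable_expMeasure_one_iff]
  refine (Real.GammaIntegral_convergent (s := 3) (by norm_num)).congr_fun (fun x hx => ?_)
    measurableSet_Ioi
  norm_num

theorem integral_id_expMeasure_one : ∫ x, x ∂(expMeasure 1) = 1 := by
  rw [integral_expMeasure_one]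
  have := Real.Gamma_eq_integral (s := 2) (by norm_num)
  rw [Real.Gamma_two] at this
  rw [this]
  refine setIntegral_congr_fun measurableSet_Ioi fun x _ => ?_
  norm_num

/-- The law of the gaps between the arrivals of a Poisson process of rate `r`. -/
noncomputable def expGap (r : ℝ) : Measure ℝ := (expMeasure 1).map (fun x => x / r)

instance (r : ℝ) : IsProbabilityMeasure (expGap r) :=
  Measure.isProbabilityMeasure_map (by fun_prop)

theorem expGap_Ici {r x : ℝ} (hr : 0 < r) (hx : 0 ≤ x) :
    expGap r (Set.Ici x) = ENNReal.ofReal (Real.exp (-(x * r))) := by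
  rw [expGap, Measure.map_apply (by fun_prop) measurableSet_Ici, ← expMeasure_one_Ici (by positivity)]
  congr 1
  ext y
  simp [le_div_iff₀ hr]

theorem nullSingletonClass_expGap {r : ℝ} (hr : 0 < r) : NullSingletonClass (expGap r) := by
  refine ⟨fun x => ?_⟩
  rw [expGap, Measure.map_apply (by fun_prop) (measurableSet_singleton x)]
  have : (fun y => y / r) ⁻¹' {x} = {x * r} := by
    ext y
    simp [div_eq_iff hr.ne']
  rw [this, measure_singleton]

theorem ae_pos_expGap {r : ℝ} (hr : 0 < r) : ∀ᵐ x ∂expGap r, 0 < x := by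
  have : NullSingletonClass (expGap r) := nullSingletonClass_expGap hr
  have h0 : expGap r (Set.Ici 0)ᶜ = 0 := by
    rw [measure_compl measurableSet_Ici (measure_ne_top _ _), measure_univ, expGap_Ici hr le_rfl]
    simp
  filter_upwards [measure_eq_zero_iff_ae_notMem.1 h0, Measure.ae_ne (expGap r) 0] with x h1 h2
  simp only [Set.mem_compl_iff, Set.mem_Ici, not_not] at h1
  exact lt_of_le_of_ne h1 (Ne.symm h2)

theorem expGap_memoryless {r : ℝ} (hr : 0 < r) {t : ℝ} (ht : 0 ≤ t) :
    ((expGap r).restrict (Set.Ici t)).map (fun x => x - t) = expGap r (Set.Ici t) • expGap r := by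
  have hm : Measurable (fun x : ℝ => x - t) := by fun_prop
  refine Measure.ext_of_Ici _ _ fun a => ?_
  rw [Measure.map_apply hm measurableSet_Ici,
    Measure.restrict_apply (hm measurableSet_Ici), Measure.smul_apply, smul_eq_mul]
  rcases le_total 0 a with ha | ha
  · have : (fun x => x - t) ⁻¹' Set.Ici a ∩ Set.Ici t = Set.Ici (a + t) := by
      ext x
      simp only [Set.mem_inter_iff, Set.mem_preimage, Set.mem_Ici]
      constructor
      · rintro ⟨h1, _⟩; linarith
      · intro h; constructor <;> linarith
    rw [this, expGap_Ici hr ht, expGap_Ici hr ha, expGap_Ici hr (by positivity),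
      ← ENNReal.ofReal_mul (Real.exp_nonneg _), ← Real.exp_add]
    congr 2; ring
  · have h1 : (fun x => x - t) ⁻¹' Set.Ici a ∩ Set.Ici t = Set.Ici t := by
      ext x
      simp only [Set.mem_inter_iff, Set.mem_preimage, Set.mem_Ici]
      constructor
      · rintro ⟨_, h1⟩; linarith
      · intro h; constructor <;> linarith
    have h2 : expGap r (Set.Ici a) = 1 := by
      refine le_antisymm prob_le_one ?_
      calc (1 : ENNReal) = expGap r (Set.Ici 0) := by rw [expGap_Ici hr le_rfl]; simp
        _ ≤ _ := measure_mono (Set.Ici_subset_Ici.2 ha)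
    rw [h1, h2, mul_one]

theorem memLp_id_expGap (r : ℝ) : MemLp (fun x : ℝ => x) 2 (expGap r) := by
  rw [expGap, memLp_map_measure_iff (by fun_prop) (by fun_prop)]
  simpa [Function.comp_def, div_eq_mul_inv] using memLp_id_expMeasure_one.mul_const r⁻¹

theorem integrable_id_expGap (r : ℝ) : Integrable (fun x : ℝ => x) (expGap r) :=
  memLp_one_iff_integrable.1 ((memLp_id_expGap r).mono_exponent (by norm_num))

theorem integral_id_expGap (r : ℝ) : ∫ x, x ∂(expGap r) = 1 / r := by
  rw [expGap, integral_map (by fun_prop) (by fun_prop), integral_div, integral_id_expMeasure_one]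

/-- An atomless law is not constant. This keeps the Gaussian limit of the race nondegenerate. -/
theorem variance_id_expGap_pos {r : ℝ} (hr : 0 < r) : 0 < Var[fun x : ℝ => x; expGap r] := by
  have : NullSingletonClass (expGap r) := nullSingletonClass_expGap hr
  refine lt_of_le_of_ne (variance_nonneg _ _) fun h => ?_
  have h1 := ae_eq_integral_of_variance_eq_zero (memLp_id_expGap r) h.symm
  have h2 := Measure.ae_ne (expGap r) (∫ x, x ∂expGap r)
  obtain ⟨x, hx1, hx2⟩ := (h1.and h2).exists
  exact hx2 hx1

theorem ae_tendsto_sum_infinitePi {S : Type*} [MeasurableSpace S] {ν : Measure S}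
    [IsProbabilityMeasure ν] {X : S → ℝ} (hX : Measurable X) (hi : Integrable X ν) :
    ∀ᵐ x ∂Measure.infinitePi (fun _ : ℕ => ν),
      Tendsto (fun n : ℕ => (∑ i ∈ Finset.range n, X (x i)) / n) atTop (𝓝 (∫ s, X s ∂ν)) := by
  set P := Measure.infinitePi (fun _ : ℕ => ν)
  have hlaw : ∀ i, P.map (fun x => x i) = ν := fun i =>
    Measure.infinitePi_map_eval (fun _ : ℕ => ν) i
  have hmp : ∀ i, MeasurePreserving (fun x : ℕ → S => x i) P ν := fun i =>
    ⟨measurable_pi_apply i, hlaw i⟩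
  have hind : iIndepFun (fun (i : ℕ) (x : ℕ → S) => X (x i)) P :=
    iIndepFun_infinitePi (X := fun _ => X) (fun _ => hX)
  have := strong_law_ae_real (μ := P) (fun (i : ℕ) (x : ℕ → S) => X (x i))
    ((hmp 0).integrable_comp_of_integrable hi) (fun i j hij => hind.indepFun hij) (fun i => by
      refine ⟨(hX.comp (measurable_pi_apply i)).aemeasurable,
        (hX.comp (measurable_pi_apply 0)).aemeasurable, ?_⟩
      change P.map (X ∘ fun x => x i) = P.map (X ∘ fun x => x 0)
      rw [← Measure.map_map hX (measurable_pi_apply i), hlaw,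
        ← Measure.map_map hX (measurable_pi_apply 0), hlaw])
  convert this using 4
  rw [← hlaw 0, integral_map (measurable_pi_apply 0).aemeasurable hX.aestronglyMeasurable]

/-- The arrival times with the given gaps, which are rescaled by the rate. -/
noncomputable def partialSums (r : ℝ) (g : ℕ → ℝ) : ℕ → ℝ :=
  fun n => (∑ i ∈ Finset.range (n + 1), g i) / r

theorem measurable_partialSums (r : ℝ) : Measurable (partialSums r) := by
  unfold partialSums; fun_prop

instance (r : ℝ) : IsProbabilityMeasure (poissonArrivals r) :=
  Measure.isProbabilityMeasure_map (measurable_partialSums r).aemeasurable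

instance (lh la : ℝ) : IsProbabilityMeasure (arrivalLaw lh la) := by
  unfold arrivalLaw; infer_instance

theorem measurableSet_regularArrivals : MeasurableSet {T : ℕ → ℝ | RegularArrivals T} := by
  have e : {T : ℕ → ℝ | RegularArrivals T} = (⋂ n : ℕ, {T : ℕ → ℝ | T n < T (n + 1)}) ∩
      ({T : ℕ → ℝ | 0 < T 0} ∩ ⋂ N : ℕ, ⋃ m : ℕ, {T : ℕ → ℝ | (N : ℝ) ≤ T m}) := by
    ext T
    simp only [Set.mem_ofPred_eq, Set.mem_inter_iff, Set.mem_iInter, Set.mem_iUnion]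
    constructor
    · intro h
      exact ⟨fun n => h.strictMono n.lt_succ_self, h.pos, fun N => h.exists_le N⟩
    · rintro ⟨h1, h2, h3⟩
      have hm : StrictMono T := strictMono_nat_of_lt_succ h1
      refine ⟨hm, h2, tendsto_atTop_atTop_of_monotone hm.monotone fun b => ?_⟩
      obtain ⟨N, hN⟩ := exists_nat_ge b
      obtain ⟨m, hm⟩ := h3 N
      exact ⟨m, hN.trans hm⟩
  have hk : ∀ k : ℕ, Measurable fun T : ℕ → ℝ => T k := fun k => measurable_pi_apply k
  rw [e]
  exact (MeasurableSet.iInter fun n => measurableSet_lt (hk _) (hk _)).inter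
    ((measurableSet_lt measurable_const (hk _)).inter (MeasurableSet.iInter fun N =>
      MeasurableSet.iUnion fun m => measurableSet_le measurable_const (hk _)))

theorem ae_regular_poissonArrivals {r : ℝ} (hr : 0 < r) :
    ∀ᵐ T ∂poissonArrivals r, RegularArrivals T := by
  have hpos : ∀ᵐ g ∂Measure.infinitePi (fun _ : ℕ => expMeasure 1), ∀ i, 0 < g i := by
    rw [ae_all_iff]
    intro i
    have h1 : ∀ᵐ x ∂expMeasure 1, 0 < x := by
      have := ae_pos_expGap (r := 1) one_pos
      have e : expGap 1 = expMeasure 1 := by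
        rw [expGap]; simp
      rwa [e] at this
    exact (measurePreserving_eval_infinitePi (fun _ : ℕ => expMeasure 1) i).quasiMeasurePreserving.ae h1
  have hlln := ae_tendsto_sum_infinitePi (ν := expMeasure 1) (X := fun x => x) measurable_id
    (memLp_one_iff_integrable.1 (memLp_id_expMeasure_one.mono_exponent (by norm_num)))
  rw [integral_id_expMeasure_one] at hlln
  have key : ∀ᵐ g ∂Measure.infinitePi (fun _ : ℕ => expMeasure 1),
      RegularArrivals (partialSums r g) := by
    filter_upwards [hpos, hlln] with g h1 h2
    refine ⟨strictMono_nat_of_lt_succ fun n => ?_, ?_, ?_⟩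
    · simp only [partialSums]
      rw [Finset.sum_range_succ _ (n + 1)]
      have := h1 (n + 1)
      gcongr
      linarith
    · simp only [partialSums, Finset.sum_range_one, zero_add]
      exact div_pos (h1 0) hr
    · have h3 : Tendsto (fun n : ℕ => ∑ i ∈ Finset.range n, g i) atTop atTop := by
        have := h2.pos_mul_atTop one_pos tendsto_natCast_atTop_atTop
        refine this.congr' ?_
        filter_upwards [eventually_gt_atTop 0] with n hn
        have : (n : ℝ) ≠ 0 := by positivity
        field_simp
      exact ((tendsto_add_atTop_iff_nat 1).2 h3).atTop_div_const hr
  exact (ae_map_iff (measurable_partialSums r).aemeasurable measurableSet_regularArrivals).2 key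

theorem isMemoryless_poissonArrivals {r : ℝ} (hr : 0 < r) :
    IsMemoryless (expGap r) (poissonArrivals r) where
  memoryless := fun _ ht => expGap_memoryless hr ht
  regular := ae_regular_poissonArrivals hr
  cons := by
    have hp : poissonArrivals r =
      (Measure.infinitePi (fun _ : ℕ => expMeasure 1)).map (partialSums r) := rfl
    rw [hp, expGap, Measure.map_prod_map _ _ (by fun_prop) (measurable_partialSums r),
      ← map_head_shift_infinitePi,
      Measure.map_map (Measurable.prodMap (by fun_prop) (measurable_partialSums r)) (by fun_prop),
      Measure.map_map measurable_arrivalCons]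
    · congr 1
      funext g n
      cases n with
      | zero => simp [arrivalCons, partialSums]
      | succ n =>
        simp only [Function.comp_apply, Prod.map, arrivalCons, partialSums]
        rw [Finset.sum_range_succ' _ (n + 1)]
        ring
    · exact (Measurable.prodMap (by fun_prop) (measurable_partialSums r)).comp (by fun_prop)

/-! ### Greedily thinned arrivals -/

/-- Drop the first arrival and all arrivals less than `d` after it. -/
noncomputable def thinStep (d : ℝ) (T : ℕ → ℝ) : ℕ → ℝ := arrivalAfter d (arrivalTail T)

/-- The indices of the arrivals that remain if, after each arrival that is kept, those less than `d`
later are dropped. -/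
noncomputable def thinIdx (d : ℝ) (T : ℕ → ℝ) : ℕ → ℕ
  | 0 => 0
  | n + 1 => thinIdx d T n + 1 +
      arrivalCount (fun k => T (thinIdx d T n + 1 + k) - T (thinIdx d T n)) d

/-- The arrival times that remain if, after each arrival that is kept, those less than `d` later are
dropped. -/
noncomputable def thin (d : ℝ) (T : ℕ → ℝ) : ℕ → ℝ := fun n => T (thinIdx d T n)

theorem thinIdx_strictMono (d : ℝ) (T : ℕ → ℝ) : StrictMono (thinIdx d T) :=
  strictMono_nat_of_lt_succ fun n => by rw [thinIdx]; omega

theorem RegularArrivals.thinned {T : ℕ → ℝ} (h : RegularArrivals T) (d : ℝ) :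
    RegularArrivals (thin d T) where
  strictMono := h.strictMono.comp (thinIdx_strictMono d T)
  pos := h.pos
  tendsto := h.tendsto.comp (thinIdx_strictMono d T).tendsto_atTop

theorem RegularArrivals.thin_gap {T : ℕ → ℝ} (h : RegularArrivals T) (d : ℝ) (n : ℕ) :
    thin d T n + d ≤ thin d T (n + 1) := by
  have hex : ∃ m, d ≤ (fun k => T (thinIdx d T n + 1 + k) - T (thinIdx d T n)) m := by
    obtain ⟨m, hm⟩ := h.exists_le (T (thinIdx d T n) + d)
    exact ⟨m, by have := h.strictMono.monotone (by omega : m ≤ thinIdx d T n + 1 + m); simp; linarith⟩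
  have := ((arrivalCount_eq_iff hex).1 rfl).2
  change T (thinIdx d T n) + d ≤ T (thinIdx d T (n + 1))
  rw [thinIdx]
  linarith

/-- Greedy choice is the fastest: the next kept arrival is the first one that respects the spacing.
All comparisons of chains with the thinned process are inductions with this as their step. -/
theorem thinIdx_succ_le {T : ℕ → ℝ} {d : ℝ} {n j : ℕ}
    (hj : thinIdx d T n < j) (hd : thin d T n + d ≤ T j) : thinIdx d T (n + 1) ≤ j := by
  rw [thinIdx]
  obtain ⟨m, rfl⟩ : ∃ m, j = thinIdx d T n + 1 + m := ⟨j - (thinIdx d T n + 1), by omega⟩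
  have : arrivalCount (fun k => T (thinIdx d T n + 1 + k) - T (thinIdx d T n)) d ≤ m := by
    refine Nat.sInf_le ?_
    simp only [Set.mem_ofPred_eq]
    have : T (thinIdx d T n) + d ≤ T (thinIdx d T n + 1 + m) := hd
    linarith
  omega

theorem RegularArrivals.thin_succ_le {T : ℕ → ℝ} (h : RegularArrivals T) {d : ℝ} {n j : ℕ}
    (hj : thin d T n < T j) (hd : thin d T n + d ≤ T j) : thin d T (n + 1) ≤ T j :=
  h.strictMono.monotone (thinIdx_succ_le (h.strictMono.lt_iff_lt.1 hj) hd)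

theorem RegularArrivals.thin_zero_le {T : ℕ → ℝ} (h : RegularArrivals T) {d : ℝ} (j : ℕ) :
    thin d T 0 ≤ T j := h.strictMono.monotone (Nat.zero_le j)

/-- Iterating `thinStep` restarts the clock at the end of the dead time that follows each kept
arrival; so the first arrival of the iterate is the part of the next thinned gap beyond `d`. -/
theorem thinStep_iterate_succ (d : ℝ) (T : ℕ → ℝ) (n : ℕ) :
    (thinStep d)^[n + 1] T = fun k => T (thinIdx d T (n + 1) + k) - (thin d T n + d) := by
  have step : ∀ (i : ℕ) (b : ℝ), thinStep d (fun k => T (i + k) - b) = fun k =>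
      T (i + 1 + arrivalCount (fun k => T (i + 1 + k) - T i) d + k) - (T i + d) := by
    intro i b
    have e : arrivalTail (fun k => T (i + k) - b) = fun k => T (i + 1 + k) - T i := by
      funext k
      simp only [arrivalTail, add_zero]
      rw [show i + (k + 1) = i + 1 + k by ring]
      ring
    rw [thinStep, e]
    funext k
    simp only [arrivalAfter]
    rw [← add_assoc (i + 1)]
    ring
  induction n with
  | zero =>
    have := step 0 0
    simp only [sub_zero, zero_add] at this
    rw [Function.iterate_succ_apply', Function.iterate_zero_apply, this]
    simp only [thin, thinIdx, zero_add]
  | succ n ih =>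
    rw [Function.iterate_succ_apply', ih, step]
    simp only [thin]
    rw [← thinIdx]

theorem thin_eq_sum (d : ℝ) (T : ℕ → ℝ) (n : ℕ) :
    thin d T n = (∑ i ∈ Finset.range (n + 1), (thinStep d)^[i] T 0) + n * d := by
  induction n with
  | zero => simp [thin, thinIdx]
  | succ n ih =>
    rw [Finset.sum_range_succ, thinStep_iterate_succ]
    push_cast
    simp only [add_zero]
    have : thin d T (n + 1) = T (thinIdx d T (n + 1)) := rfl
    rw [← this]
    linarith

theorem thin_succ_eq (d : ℝ) (T : ℕ → ℝ) (n : ℕ) :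
    thin d T (n + 1) = thin d T n + d + (thinStep d)^[n + 1] T 0 := by
  rw [thinStep_iterate_succ]
  simp [thin]

theorem measurable_thinStep (d : ℝ) : Measurable (thinStep d) :=
  (measurable_arrivalAfter d).comp measurable_arrivalTail

theorem measurable_thinGaps (d : ℝ) :
    Measurable fun (T : ℕ → ℝ) (n : ℕ) => (thinStep d)^[n] T 0 :=
  measurable_pi_lambda _ fun n => (measurable_pi_apply 0).comp ((measurable_thinStep d).iterate n)

theorem measurable_thin (d : ℝ) : Measurable (thin d) := by
  refine measurable_pi_lambda _ fun n => ?_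
  simp only [thin_eq_sum]
  refine Measurable.add_const (Finset.measurable_fun_sum _ fun i _ => ?_) _
  exact (measurable_pi_apply i).comp (measurable_thinGaps d)

section

variable {ν : Measure ℝ} {μ : Measure (ℕ → ℝ)} [IsProbabilityMeasure ν] [IsProbabilityMeasure μ]

theorem IsMemoryless.measurePreserving_after (h : IsMemoryless ν μ) {t : ℝ} (ht : 0 ≤ t) :
    MeasurePreserving (arrivalAfter t) μ μ := by
  have : IsProbabilityMeasure (μ.map (arrivalPast t)) :=
    Measure.isProbabilityMeasure_map (measurable_arrivalPast t).aemeasurable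
  exact measurePreserving_of_map_prodMk (measurable_arrivalAfter t) (measurable_arrivalPast t)
    (h.map_past_after ht)

/-- The first arrival is independent of the tail, and restarting the tail a time `d` later does not
change its law. This is the hypothesis of `map_orbit_eq_infinitePi`. -/
theorem IsMemoryless.map_head_thinStep (h : IsMemoryless ν μ) {d : ℝ} (hd : 0 ≤ d) :
    μ.map (fun T => (T 0, thinStep d T)) = ν.prod μ := by
  have e : (fun T : ℕ → ℝ => (T 0, thinStep d T)) =
      Prod.map id (arrivalAfter d) ∘ fun T => (T 0, arrivalTail T) := rfl
  rw [e, ← Measure.map_map (by exact measurable_id.prodMap (measurable_arrivalAfter d))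
    ((measurable_pi_apply 0).prodMk measurable_arrivalTail), h.map_head_tail,
    ← Measure.map_prod_map _ _ measurable_id (measurable_arrivalAfter d), Measure.map_id,
    (h.measurePreserving_after hd).map_eq]

/-- The gaps of the thinned process, after the dead time, are independent with the same law. -/
theorem IsMemoryless.map_thinGaps (h : IsMemoryless ν μ) {d : ℝ} (hd : 0 ≤ d) :
    μ.map (fun (T : ℕ → ℝ) (n : ℕ) => (thinStep d)^[n] T 0) =
      Measure.infinitePi (fun _ : ℕ => ν) := by
  have h1 := h.map_head_thinStep hd
  have h2 : μ.map (fun T => T 0) = ν :=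
    map_fst_of_map_prodMk (f := fun T : ℕ → ℝ => T 0) (measurable_thinStep d)
      (measurable_pi_apply 0) h1
  have := map_orbit_eq_infinitePi (f := fun T : ℕ → ℝ => T 0) (measurable_thinStep d)
    (measurable_pi_apply 0) (by rw [h2]; exact h1)
  rwa [h2] at this

end

/-- A node has its own block only strictly after the mining time, so honest delivery needs a gap
strictly longer than the delay. Greedy thinning gives only a weak inequality; the strict one holds
almost surely, as exponential gaps are positive. -/
theorem ae_thin_gap_lt {r : ℝ} (hr : 0 < r) {d : ℝ} (hd : 0 ≤ d) :
    ∀ᵐ T ∂poissonArrivals r, ∀ n, thin d T n + d < thin d T (n + 1) := by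
  have h1 : ∀ᵐ g ∂Measure.infinitePi (fun _ : ℕ => expGap r), ∀ i, 0 < g i := by
    rw [ae_all_iff]
    intro i
    exact (measurePreserving_eval_infinitePi (fun _ : ℕ => expGap r) i).quasiMeasurePreserving.ae
      (ae_pos_expGap hr)
  rw [← (isMemoryless_poissonArrivals hr).map_thinGaps hd] at h1
  filter_upwards [ae_of_ae_map (measurable_thinGaps d).aemeasurable h1] with T hT n
  rw [thin_succ_eq]
  linarith [hT (n + 1)]

theorem ae_tendsto_thin_div {r : ℝ} (hr : 0 < r) {d : ℝ} (hd : 0 ≤ d) :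
    ∀ᵐ T ∂poissonArrivals r, Tendsto (fun n : ℕ => thin d T n / n) atTop (𝓝 (1 / r + d)) := by
  have h1 := ae_tendsto_sum_infinitePi (ν := expGap r) (X := fun x => x) measurable_id
    (integrable_id_expGap r)
  rw [integral_id_expGap, ← (isMemoryless_poissonArrivals hr).map_thinGaps hd] at h1
  filter_upwards [ae_of_ae_map (measurable_thinGaps d).aemeasurable h1] with T hT
  have h2 := (tendsto_add_atTop_iff_nat 1).2 hT
  have h3 : Tendsto (fun n : ℕ => ((n : ℝ) + 1) / n) atTop (𝓝 1) := by
    have := (tendsto_one_div_atTop_nhds_zero_nat (𝕜 := ℝ)).const_add 1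
    rw [add_zero] at this
    refine this.congr' ?_
    filter_upwards [eventually_gt_atTop 0] with n hn
    have : (n : ℝ) ≠ 0 := by positivity
    field_simp
  have h4 := (h2.mul h3).add_const d
  rw [mul_one] at h4
  refine h4.congr' ?_
  filter_upwards [eventually_gt_atTop 0] with n hn
  have : (n : ℝ) ≠ 0 := by positivity
  rw [thin_eq_sum]
  push_cast
  field_simp

/-- The counting process of arrivals with the asymptotic gap `m` has the rate `m⁻¹`. -/
theorem RegularArrivals.tendsto_arrivalCount_div {T : ℕ → ℝ} (h : RegularArrivals T) {m : ℝ}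
    (hm : 0 < m) (hT : Tendsto (fun n : ℕ => T n / n) atTop (𝓝 m)) :
    Tendsto (fun t : ℝ => (arrivalCount T t : ℝ) / t) atTop (𝓝 m⁻¹) := by
  have hc : Tendsto (fun t : ℝ => arrivalCount T t) atTop atTop := by
    refine tendsto_atTop.2 fun n => ?_
    filter_upwards [eventually_gt_atTop (T n)] with t ht
    exact (h.lt_arrivalCount.2 ht).le
  have h1 : Tendsto (fun t : ℝ => T (arrivalCount T t) / (arrivalCount T t : ℝ)) atTop (𝓝 m) :=
    hT.comp hc
  -- The time `t` lies between the arrivals with indices `arrivalCount T t - 1` and `arrivalCount T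
  -- t`; both bounds must have the same limit.
  have h0 : Tendsto (fun n : ℕ => T (n - 1) / n) atTop (𝓝 m) := by
    rw [← tendsto_add_atTop_iff_nat 1]
    have h3 : Tendsto (fun n : ℕ => (n : ℝ) / (n + 1)) atTop (𝓝 1) :=
      tendsto_natCast_div_add_atTop 1
    have h4 := hT.mul h3
    rw [mul_one] at h4
    refine h4.congr' ?_
    filter_upwards [eventually_gt_atTop 0] with n hn
    have : (n : ℝ) ≠ 0 := by positivity
    simp only [Nat.add_sub_cancel]
    push_cast
    field_simp
  have h2 : Tendsto (fun t : ℝ => T (arrivalCount T t - 1) / (arrivalCount T t : ℝ)) atTop (𝓝 m) :=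
    h0.comp hc
  have h3 : Tendsto (fun t : ℝ => t / (arrivalCount T t : ℝ)) atTop (𝓝 m) := by
    refine tendsto_of_tendsto_of_tendsto_of_le_of_le' h2 h1 ?_ ?_
    · filter_upwards [hc.eventually_ge_atTop 1] with t ht
      gcongr
      exact (h.lt_arrivalCount.1 (by omega : arrivalCount T t - 1 < arrivalCount T t)).le
    · filter_upwards with t
      gcongr
      exact h.arrivalCount_le.1 le_rfl
  have h4 := h3.inv₀ hm.ne'
  refine h4.congr fun t => ?_
  rw [inv_div]

theorem ae_tendsto_thinCount_div {r : ℝ} (hr : 0 < r) {d : ℝ} (hd : 0 ≤ d) :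
    ∀ᵐ T ∂poissonArrivals r,
      Tendsto (fun t : ℝ => (arrivalCount (thin d T) t : ℝ) / t) atTop (𝓝 (r / (1 + r * d))) := by
  filter_upwards [ae_tendsto_thin_div hr hd, ae_regular_poissonArrivals hr] with T h1 h2
  have := (h2.thinned d).tendsto_arrivalCount_div (by positivity) h1
  convert this using 2
  field_simp

/-! ### Block trees -/

theorem mineTime_pos {ω : Arrivals} (h1 : RegularArrivals ω.1) (h2 : RegularArrivals ω.2) {b : Block}
    (hb : b ≠ .genesis) : 0 < mineTime ω b := by
  cases b with
  | genesis => exact absurd rfl hb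
  | honest i => exact h1.pos.trans_le (h1.strictMono.monotone (Nat.zero_le i))
  | adv j m => exact h2.pos.trans_le (h2.strictMono.monotone (Nat.zero_le j))

theorem mineTime_nonneg {ω : Arrivals} (h1 : RegularArrivals ω.1) (h2 : RegularArrivals ω.2)
    (b : Block) : 0 ≤ mineTime ω b := by
  by_cases hb : b = .genesis
  · subst hb; exact le_rfl
  · exact (mineTime_pos h1 h2 hb).le

section

variable {Δ Δa : ℝ} {ω : Arrivals} {x : Play}

/-- Mining times strictly decrease along parents, and regular arrivals leave only finitely many of
them below a given time. Without this fact the infimum in `Play.height` might be the default value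
0. -/
theorem Admissible.exists_iterate_eq_genesis (hx : Admissible Δ Δa ω x) (h1 : RegularArrivals ω.1)
    (h2 : RegularArrivals ω.2) (b : Block) : ∃ n, x.parent^[n] b = .genesis := by
  have key : ∀ N : ℕ, ∀ b : Block,
      arrivalCount ω.1 (mineTime ω b) + arrivalCount ω.2 (mineTime ω b) ≤ N →
        ∃ n, x.parent^[n] b = .genesis := by
    intro N
    induction N with
    | zero =>
      intro b hb
      by_cases hbg : b = .genesis
      · exact ⟨0, hbg⟩
      · refine ⟨1, ?_⟩
        by_contra hp
        have hlt := hx.parent_earlier b hbg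
        simp only [Function.iterate_one] at hp
        generalize hpb : x.parent b = c at hp hlt
        cases c with
        | genesis => exact hp rfl
        | honest i => have := (h1.lt_arrivalCount (t := mineTime ω b) (n := i)).2 hlt; omega
        | adv j m => have := (h2.lt_arrivalCount (t := mineTime ω b) (n := j)).2 hlt; omega
    | succ N ih =>
      intro b hb
      by_cases hbg : b = .genesis
      · exact ⟨0, hbg⟩
      by_cases hp : x.parent b = .genesis
      · exact ⟨1, hp⟩
      have hlt := hx.parent_earlier b hbg
      have hle1 : arrivalCount ω.1 (mineTime ω (x.parent b)) ≤ arrivalCount ω.1 (mineTime ω b) :=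
        h1.arrivalCount_le.2 (hlt.le.trans (h1.arrivalCount_le.1 le_rfl))
      have hle2 : arrivalCount ω.2 (mineTime ω (x.parent b)) ≤ arrivalCount ω.2 (mineTime ω b) :=
        h2.arrivalCount_le.2 (hlt.le.trans (h2.arrivalCount_le.1 le_rfl))
      have : arrivalCount ω.1 (mineTime ω (x.parent b)) +
          arrivalCount ω.2 (mineTime ω (x.parent b)) ≤ N := by
        generalize hpb : x.parent b = c at hp hlt hle1 hle2
        cases c with
        | genesis => exact absurd rfl hp
        | honest i =>
          have e1 := (h1.lt_arrivalCount (t := mineTime ω b) (n := i)).2 hlt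
          have e2 : arrivalCount ω.1 (mineTime ω (.honest i)) ≤ i := h1.arrivalCount_le.2 le_rfl
          omega
        | adv j m =>
          have e1 := (h2.lt_arrivalCount (t := mineTime ω b) (n := j)).2 hlt
          have e2 : arrivalCount ω.2 (mineTime ω (.adv j m)) ≤ j := h2.arrivalCount_le.2 le_rfl
          omega
      obtain ⟨n, hn⟩ := ih _ this
      exact ⟨n + 1, by rwa [Function.iterate_succ_apply]⟩
  exact key _ b le_rfl

theorem Play.height_genesis (x : Play) : x.height .genesis = 0 :=
  Nat.le_zero.1 (Nat.sInf_le (s := {n : ℕ | x.parent^[n] Block.genesis = Block.genesis}) rfl)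

theorem Admissible.iterate_height (hx : Admissible Δ Δa ω x) (h1 : RegularArrivals ω.1)
    (h2 : RegularArrivals ω.2) (b : Block) : x.parent^[x.height b] b = .genesis :=
  Nat.sInf_mem (s := {n : ℕ | x.parent^[n] b = Block.genesis})
    (hx.exists_iterate_eq_genesis h1 h2 b)

theorem Play.iterate_ne_genesis {b : Block} {k : ℕ} (hk : k < x.height b) :
    x.parent^[k] b ≠ .genesis := fun h =>
  absurd (Nat.sInf_le (s := {n : ℕ | x.parent^[n] b = Block.genesis}) h) (not_le.2 hk)

theorem Admissible.height_eq (hx : Admissible Δ Δa ω x) (h1 : RegularArrivals ω.1)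
    (h2 : RegularArrivals ω.2) {b : Block} (hb : b ≠ .genesis) :
    x.height b = x.height (x.parent b) + 1 := by
  have hpos : x.height b ≠ 0 := by
    intro h0
    have := hx.iterate_height h1 h2 b
    rw [h0] at this
    exact hb this
  obtain ⟨n, hn⟩ := Nat.exists_eq_succ_of_ne_zero hpos
  have e1 : x.height (x.parent b) ≤ n := by
    refine Nat.sInf_le ?_
    have := hx.iterate_height h1 h2 b
    rw [hn] at this
    exact this
  have e2 : x.height b ≤ x.height (x.parent b) + 1 := by
    refine Nat.sInf_le ?_
    exact hx.iterate_height h1 h2 (x.parent b)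
  omega

theorem Admissible.height_iterate (hx : Admissible Δ Δa ω x) (h1 : RegularArrivals ω.1)
    (h2 : RegularArrivals ω.2) (b : Block) (n : ℕ) :
    x.height (x.parent^[n] b) = x.height b - n := by
  induction n with
  | zero => rfl
  | succ n ih =>
    rw [Function.iterate_succ_apply']
    by_cases hg : x.parent^[n] b = .genesis
    · rw [hg, hx.parent_genesis, x.height_genesis]
      rw [hg, x.height_genesis] at ih
      omega
    · have := hx.height_eq h1 h2 hg
      omega

theorem Admissible.honest_mem_view (hx : Admissible Δ Δa ω x) {i p : ℕ} {t : ℝ}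
    (h : ω.1 i + Δ < t) : Block.honest i ∈ x.view p t :=
  hx.view_delay i p (t - Δ) t (by linarith) (hx.own_mem i (t - Δ) (by linarith))

theorem Admissible.height_honest_le_tip (hx : Admissible Δ Δa ω x) {i p : ℕ} {t : ℝ}
    (h : ω.1 i + Δ < t) : x.height (.honest i) ≤ x.height (x.tip p t) :=
  hx.tip_longest p t _ (hx.honest_mem_view h)

theorem Admissible.height_honest (hx : Admissible Δ Δa ω x) (h1 : RegularArrivals ω.1)
    (h2 : RegularArrivals ω.2) (i : ℕ) :
    x.height (.honest i) = x.height (x.tip i (ω.1 i)) + 1 := by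
  rw [hx.height_eq h1 h2 (by simp), hx.honest_parent]

/-- More than Δ after the previous kept arrival, its block is known to every honest node, so the new
kept block is strictly higher. Blocks at discarded arrivals and adversarial blocks can only help. -/
theorem Admissible.lt_height_honest_thinIdx (hx : Admissible Δ Δa ω x) (h1 : RegularArrivals ω.1)
    (h2 : RegularArrivals ω.2) (hg : ∀ n, thin Δ ω.1 n + Δ < thin Δ ω.1 (n + 1)) (n : ℕ) :
    n < x.height (.honest (thinIdx Δ ω.1 n)) := by
  induction n with
  | zero => rw [hx.height_honest h1 h2]; omega
  | succ n ih =>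
    rw [hx.height_honest h1 h2]
    have := hx.height_honest_le_tip (p := thinIdx Δ ω.1 (n + 1)) (hg n)
    have e : thin Δ ω.1 (n + 1) = ω.1 (thinIdx Δ ω.1 (n + 1)) := rfl
    rw [e] at this
    omega

theorem Admissible.arrivalCount_thin_le_height (hx : Admissible Δ Δa ω x)
    (h1 : RegularArrivals ω.1) (h2 : RegularArrivals ω.2)
    (hg : ∀ n, thin Δ ω.1 n + Δ < thin Δ ω.1 (n + 1)) (p : ℕ) (t : ℝ) :
    arrivalCount (thin Δ ω.1) (t - Δ) ≤ x.height (x.tip p t) := by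
  rcases Nat.eq_zero_or_pos (arrivalCount (thin Δ ω.1) (t - Δ)) with h0 | h0
  · omega
  · have h3 : thin Δ ω.1 (arrivalCount (thin Δ ω.1) (t - Δ) - 1) < t - Δ :=
      (h1.thinned Δ).lt_arrivalCount.1 (by omega)
    have h4 := hx.lt_height_honest_thinIdx h1 h2 hg (arrivalCount (thin Δ ω.1) (t - Δ) - 1)
    have h5 : x.height (.honest (thinIdx Δ ω.1 (arrivalCount (thin Δ ω.1) (t - Δ) - 1))) ≤
        x.height (x.tip p t) := hx.height_honest_le_tip (by
      have : thin Δ ω.1 (arrivalCount (thin Δ ω.1) (t - Δ) - 1) =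
        ω.1 (thinIdx Δ ω.1 (arrivalCount (thin Δ ω.1) (t - Δ) - 1)) := rfl
      linarith)
    omega

/-- Adversarial blocks along a chain are Δa apart, and the greedy selection reaches any number of
points spaced in this way first. -/
theorem Admissible.thin_le_mineTime (hx : Admissible Δ Δa ω x) (h2 : RegularArrivals ω.2) (d : ℕ) :
    ∀ b : Block, (∀ k < d + 1, (x.parent^[k] b).IsAdv) → thin Δa ω.2 d ≤ mineTime ω b := by
  induction d with
  | zero =>
    intro b hb
    have := hb 0 (by omega)
    cases b with
    | genesis => exact absurd this id
    | honest i => exact absurd this id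
    | adv j m => exact h2.thin_zero_le j
  | succ d ih =>
    intro b hb
    have hb0 := hb 0 (by omega)
    have hp := ih (x.parent b) (fun k hk => by
      have := hb (k + 1) (by omega)
      rwa [Function.iterate_succ_apply] at this)
    have hb1 := hb 1 (by omega)
    cases b with
    | genesis => exact absurd hb0 id
    | honest i => exact absurd hb0 id
    | adv j m =>
      simp only [Function.iterate_one] at hb1
      have hlt := hx.parent_earlier (.adv j m) (by simp)
      generalize hc : x.parent (.adv j m) = c at hp hb1 hlt
      cases c with
      | genesis => exact absurd hb1 id
      | honest i => exact absurd hb1 id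
      | adv i l =>
        have hd := hx.adv_delay j m i l hc
        simp only [mineTime] at hp hlt ⊢
        exact h2.thin_succ_le (by linarith) (by linarith)

/-- The additional 1 allows for a block mined exactly at time `t`, which `arrivalCount` does not
count. -/
theorem Admissible.subtreeDepths_le (hx : Admissible Δ Δa ω x) (h2 : RegularArrivals ω.2)
    {root : Block} {t : ℝ} {d : ℕ} (hd : d ∈ x.subtreeDepths ω root t) :
    d ≤ arrivalCount (thin Δa ω.2) t + 1 := by
  obtain ⟨b, hbt, -, hb⟩ := hd
  by_contra hc
  have h3 := hx.thin_le_mineTime h2 (arrivalCount (thin Δa ω.2) t + 1)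
    b (fun k hk => hb k (by omega))
  have h4 : t ≤ thin Δa ω.2 (arrivalCount (thin Δa ω.2) t) :=
    (h2.thinned Δa).arrivalCount_le.1 le_rfl
  have h5 := (h2.thinned Δa).strictMono (Nat.lt_succ_self (arrivalCount (thin Δa ω.2) t))
  simp only [Nat.succ_eq_add_one] at h5
  linarith

/-! ### The private attack -/

theorem released_mono {s t t' : ℝ} (htt : t ≤ t') (h : Released Δ s ω x t) :
    Released Δ s ω x t' := by
  obtain ⟨r, h1, h2, h3⟩ := h
  exact ⟨r, h1, h2.trans_le htt, h3⟩

/-- Before the release a miner sees only honest blocks, and those of other nodes only after the full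
delay Δ. Each node mines a single block, so early knowledge of its own block never helps it to mine;
hence honest heights are at most those along the greedy selection. -/
theorem Admissible.thin_le_of_lt_height (hx : Admissible Δ Δa ω x) (h1 : RegularArrivals ω.1)
    (h2 : RegularArrivals ω.2) {s : ℝ} (hp : x ∈ PrivateAttack Δ Δa s ω) {τ : ℝ}
    (hτ : ¬ Released Δ s ω x τ) (n : ℕ) :
    ∀ i, ω.1 i ≤ τ → n < x.height (.honest i) → thin Δ ω.1 n ≤ ω.1 i := by
  induction n with
  | zero => intro i _ _; exact h1.thin_zero_le i
  | succ n ih =>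
    intro i hi hn
    rw [hx.height_honest h1 h2] at hn
    have hmem := hx.tip_mem i (ω.1 i)
    generalize x.tip i (ω.1 i) = b at hn hmem
    rw [hp.2.2] at hmem
    rcases hmem with rfl | ⟨i', rfl, h⟩ | ⟨j, rfl, _, hr⟩
    · rw [x.height_genesis] at hn; omega
    · rcases h with h | ⟨_, h⟩
      · rcases le_total 0 Δ with hΔ | hΔ
        · have := ih i' (by linarith) (by omega)
          exact h1.thin_succ_le (by linarith) (by linarith)
        · have hv := hx.view_past i (ω.1 i) (.honest i') (by
            rw [hp.2.2]; exact Or.inr (Or.inl ⟨i', rfl, Or.inl h⟩)) (by simp)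
          simp only [mineTime] at hv
          have := ih i' (by linarith) (by omega)
          exact h1.thin_succ_le (by linarith) (by linarith)
      · have hv := hx.view_past i (ω.1 i) (.honest i') (by
            rw [hp.2.2]; exact Or.inr (Or.inl ⟨i', rfl, Or.inr ⟨by assumption, h⟩⟩)) (by simp)
        have e : i' = i := by assumption
        subst e
        exact absurd h (lt_irrefl _)
    · exact absurd (released_mono hi hr) hτ

theorem Admissible.thin_lt_of_lt_height_tip (hx : Admissible Δ Δa ω x) (h1 : RegularArrivals ω.1)
    (h2 : RegularArrivals ω.2) {s : ℝ} (hp : x ∈ PrivateAttack Δ Δa s ω) {t : ℝ}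
    (ht : ¬ Released Δ s ω x t) {n p : ℕ} (hn : n < x.height (x.tip p t)) :
    ∃ i, x.tip p t = .honest i ∧ ω.1 i < t ∧ thin Δ ω.1 n ≤ ω.1 i := by
  have hmem := hx.tip_mem p t
  generalize x.tip p t = b at hn hmem ⊢
  have hv := hx.view_past p t b hmem
  rw [hp.2.2] at hmem
  rcases hmem with rfl | ⟨i', rfl, h⟩ | ⟨j, rfl, _, hr⟩
  · rw [x.height_genesis] at hn; omega
  · have := hv (by simp)
    simp only [mineTime] at this
    exact ⟨i', rfl, this, hx.thin_le_of_lt_height h1 h2 hp ht n i' this.le hn⟩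
  · exact absurd hr ht

theorem not_released_self (hΔ : 0 ≤ Δ) (s : ℝ) : ¬ Released Δ s ω x s := by
  rintro ⟨r, h1, h2, -⟩
  linarith

theorem Admissible.height_tip_le_of_private (hx : Admissible Δ Δa ω x) (hΔ : 0 ≤ Δ)
    (h1 : RegularArrivals ω.1) (h2 : RegularArrivals ω.2) {s : ℝ}
    (hp : x ∈ PrivateAttack Δ Δa s ω) (p : ℕ) :
    x.height (x.tip p s) ≤ arrivalCount (thin Δ ω.1) s := by
  by_contra hc
  obtain ⟨i, -, h3, h4⟩ := hx.thin_lt_of_lt_height_tip h1 h2 hp (not_released_self hΔ s) (not_le.1 hc)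
  have := (h1.thinned Δ).arrivalCount_le.1 (le_refl (arrivalCount (thin Δ ω.1) s))
  linarith

theorem Admissible.lt_height_adv_thinIdx (hx : Admissible Δ Δa ω x) (h1 : RegularArrivals ω.1)
    (h2 : RegularArrivals ω.2) {s : ℝ} (hp : x ∈ PrivateAttack Δ Δa s ω) (n : ℕ) :
    n < x.height (.adv (thinIdx Δa ω.2 n) 0) := by
  induction n with
  | zero => rw [hx.height_eq h1 h2 (by simp)]; omega
  | succ n ih =>
    rw [hx.height_eq h1 h2 (by simp)]
    have := (hp.1 (thinIdx Δa ω.2 (n + 1))).2 (.adv (thinIdx Δa ω.2 n) 0)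
      (Or.inr ⟨_, rfl, h2.strictMono (thinIdx_strictMono Δa ω.2 (Nat.lt_succ_self n)),
        h2.thin_gap Δa n⟩)
    omega

/-- With `Admissible.lt_height_adv_thinIdx` this identifies the private chain with the thinned
adversarial process: height `n + 1` is first reached at its point of index `n`. -/
theorem Admissible.thin_le_of_lt_height_adv (hx : Admissible Δ Δa ω x) (h1 : RegularArrivals ω.1)
    (h2 : RegularArrivals ω.2) {s : ℝ} (hp : x ∈ PrivateAttack Δ Δa s ω) (n : ℕ) :
    ∀ j, n < x.height (.adv j 0) → thin Δa ω.2 n ≤ ω.2 j := by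
  induction n with
  | zero => intro j _; exact h2.thin_zero_le j
  | succ n ih =>
    intro j hn
    rw [hx.height_eq h1 h2 (by simp)] at hn
    have hk := (hp.1 j).1
    generalize x.parent (.adv j 0) = b at hn hk
    rcases hk with rfl | ⟨i, rfl, h3, h4⟩
    · rw [x.height_genesis] at hn; omega
    · have := ih i (by omega)
      exact h2.thin_succ_le (by linarith) (by linarith)

theorem iterate_parent_private {s : ℝ} (hg : x.parent .genesis = .genesis)
    (hp : x ∈ PrivateAttack Δ Δa s ω) (j n : ℕ) :
    x.parent^[n] (.adv j 0) = .genesis ∨ ∃ i, x.parent^[n] (.adv j 0) = .adv i 0 := by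
  induction n with
  | zero => exact Or.inr ⟨j, rfl⟩
  | succ n ih =>
    rw [Function.iterate_succ_apply']
    rcases ih with h | ⟨i, h⟩
    · rw [h]; exact Or.inl hg
    · rw [h]
      rcases (hp.1 i).1 with h | ⟨i', h, -⟩
      · exact Or.inl h
      · exact Or.inr ⟨i', h⟩

theorem Admissible.height_mem_subtreeDepths (hx : Admissible Δ Δa ω x) (h1 : RegularArrivals ω.1)
    (h2 : RegularArrivals ω.2) {s : ℝ} (hp : x ∈ PrivateAttack Δ Δa s ω) {j : ℕ} {t : ℝ}
    (hj : ω.2 j ≤ t) : x.height (.adv j 0) ∈ x.subtreeDepths ω .genesis t := by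
  refine ⟨.adv j 0, hj, hx.iterate_height h1 h2 _, fun k hk => ?_⟩
  rcases iterate_parent_private hx.parent_genesis hp j k with h | ⟨i, h⟩
  · exact absurd h (Play.iterate_ne_genesis hk)
  · rw [h]; trivial

theorem Admissible.exists_subtreeDepths_private (hx : Admissible Δ Δa ω x)
    (h1 : RegularArrivals ω.1) (h2 : RegularArrivals ω.2) {s : ℝ}
    (hp : x ∈ PrivateAttack Δ Δa s ω) {t : ℝ} (ht : 0 ≤ t) :
    ∃ d ∈ x.subtreeDepths ω .genesis t, arrivalCount (thin Δa ω.2) t ≤ d := by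
  rcases Nat.eq_zero_or_pos (arrivalCount (thin Δa ω.2) t) with h0 | h0
  · exact ⟨0, ⟨.genesis, ht, rfl, fun k hk => absurd hk (by omega)⟩, by omega⟩
  · have h3 : thin Δa ω.2 (arrivalCount (thin Δa ω.2) t - 1) < t :=
      (h2.thinned Δa).lt_arrivalCount.1 (by omega)
    refine ⟨_, hx.height_mem_subtreeDepths h1 h2 hp
      (j := thinIdx Δa ω.2 (arrivalCount (thin Δa ω.2) t - 1)) h3.le, ?_⟩
    have := hx.lt_height_adv_thinIdx h1 h2 hp (arrivalCount (thin Δa ω.2) t - 1)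
    omega

end

/-! ### Growth rates -/

theorem GrowsAtMost.of_tendsto {S : ℝ → Set ℕ} {r : ℝ} {c : ℝ → ℝ}
    (hc : Tendsto (fun t => c t / t) atTop (𝓝 r)) (h : ∀ᶠ t in atTop, ∀ d ∈ S t, (d : ℝ) ≤ c t) :
    GrowsAtMost S r := by
  intro ε hε
  filter_upwards [hc.eventually_le_const (show r < r + ε by linarith), h, eventually_gt_atTop 0]
    with t h1 h2 h3 d hd
  rw [div_le_iff₀ h3] at h1
  exact (h2 d hd).trans h1

theorem GrowsAtLeast.of_tendsto {S : ℝ → Set ℕ} {r : ℝ} {c : ℝ → ℝ}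
    (hc : Tendsto (fun t => c t / t) atTop (𝓝 r)) (h : ∀ᶠ t in atTop, ∃ d ∈ S t, c t ≤ (d : ℝ)) :
    GrowsAtLeast S r := by
  intro ε hε
  filter_upwards [hc.eventually_const_le (show r - ε < r by linarith), h, eventually_gt_atTop 0]
    with t h1 h2 h3
  obtain ⟨d, hd, h4⟩ := h2
  rw [le_div_iff₀ h3] at h1
  exact ⟨d, hd, h1.trans h4⟩

theorem tendsto_comp_sub_div {c : ℝ → ℝ} {r : ℝ} (hc : Tendsto (fun t => c t / t) atTop (𝓝 r))
    (a : ℝ) : Tendsto (fun t => c (t - a) / t) atTop (𝓝 r) := by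
  have h1 : Tendsto (fun t : ℝ => t - a) atTop atTop := tendsto_atTop_add_const_right _ (-a) tendsto_id
  have h2 := hc.comp h1
  have h3 : Tendsto (fun t : ℝ => (t - a) / t) atTop (𝓝 1) := by
    have : Tendsto (fun t : ℝ => 1 - a / t) atTop (𝓝 (1 - 0)) :=
      tendsto_const_nhds.sub (tendsto_const_nhds.div_atTop tendsto_id)
    rw [sub_zero] at this
    refine this.congr' ?_
    filter_upwards [eventually_gt_atTop 0] with t ht
    field_simp
  have h4 := h2.mul h3
  rw [mul_one] at h4
  refine h4.congr' ?_
  filter_upwards [eventually_gt_atTop a, eventually_gt_atTop 0] with t ht ht0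
  have : t - a ≠ 0 := by linarith [sub_pos.2 ht] |> fun h : 0 < t - a => h.ne'
  simp only [Function.comp_apply]
  field_simp

theorem tendsto_add_one_div {c : ℝ → ℝ} {r : ℝ} (hc : Tendsto (fun t => c t / t) atTop (𝓝 r)) :
    Tendsto (fun t => (c t + 1) / t) atTop (𝓝 r) := by
  have := hc.add (tendsto_const_nhds.div_atTop (tendsto_id (α := ℝ)) : Tendsto (fun t : ℝ => 1 / t) atTop (𝓝 0))
  rw [add_zero] at this
  refine this.congr fun t => ?_
  rw [add_div]

theorem ae_arrivalLaw_fst {lh la : ℝ} {p : (ℕ → ℝ) → Prop} (h : ∀ᵐ T ∂poissonArrivals lh, p T) :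
    ∀ᵐ ω ∂arrivalLaw lh la, p ω.1 :=
  (Measure.quasiMeasurePreserving_fst (μ := poissonArrivals lh) (ν := poissonArrivals la)).ae h

theorem ae_arrivalLaw_snd {lh la : ℝ} {p : (ℕ → ℝ) → Prop} (h : ∀ᵐ T ∂poissonArrivals la, p T) :
    ∀ᵐ ω ∂arrivalLaw lh la, p ω.2 :=
  (Measure.quasiMeasurePreserving_snd (μ := poissonArrivals lh) (ν := poissonArrivals la)).ae h

theorem ae_subtree_growsAtMost {lh la Δ Δa : ℝ} (hla : 0 < la) (hΔa : 0 ≤ Δa) :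
    ∀ᵐ ω ∂arrivalLaw lh la, ∀ x, Admissible Δ Δa ω x → ∀ root : Block,
      GrowsAtMost (x.subtreeDepths ω root) (lamEff la Δa) := by
  filter_upwards [ae_arrivalLaw_snd (ae_regular_poissonArrivals hla),
    ae_arrivalLaw_snd (ae_tendsto_thinCount_div hla hΔa)] with ω h2 h3 x hx root
  exact GrowsAtMost.of_tendsto (tendsto_add_one_div h3) (Eventually.of_forall fun t d hd => by
    exact_mod_cast hx.subtreeDepths_le h2 hd)

theorem ae_private_growsAtLeast {lh la Δ Δa : ℝ} (hlh : 0 < lh) (hla : 0 < la) (hΔa : 0 ≤ Δa) :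
    ∀ᵐ ω ∂arrivalLaw lh la, ∀ s, ∀ x ∈ PrivateAttack Δ Δa s ω, Admissible Δ Δa ω x →
      GrowsAtLeast (x.subtreeDepths ω .genesis) (lamEff la Δa) := by
  filter_upwards [ae_arrivalLaw_fst (ae_regular_poissonArrivals hlh),
    ae_arrivalLaw_snd (ae_regular_poissonArrivals hla),
    ae_arrivalLaw_snd (ae_tendsto_thinCount_div hla hΔa)] with ω h1 h2 h3 s x hp hx
  refine GrowsAtLeast.of_tendsto h3 ?_
  filter_upwards [eventually_ge_atTop 0] with t ht
  obtain ⟨d, hd, hle⟩ := hx.exists_subtreeDepths_private h1 h2 hp ht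
  exact ⟨d, hd, by exact_mod_cast hle⟩

theorem ae_honest_growsAtLeast {lh la Δ Δa : ℝ} (hlh : 0 < lh) (hla : 0 < la) (hΔ : 0 ≤ Δ) :
    ∀ᵐ ω ∂arrivalLaw lh la, ∀ x, Admissible Δ Δa ω x → ∀ p,
      GrowsAtLeast (fun t => {x.height (x.tip p t)}) (lamGrowth lh Δ) := by
  filter_upwards [ae_arrivalLaw_fst (ae_regular_poissonArrivals hlh),
    ae_arrivalLaw_snd (ae_regular_poissonArrivals hla),
    ae_arrivalLaw_fst (ae_thin_gap_lt hlh hΔ),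
    ae_arrivalLaw_fst (ae_tendsto_thinCount_div hlh hΔ)] with ω h1 h2 hg h3 x hx p
  refine GrowsAtLeast.of_tendsto
    (tendsto_comp_sub_div (c := fun t => (arrivalCount (thin Δ ω.1) t : ℝ)) h3 Δ)
    (Eventually.of_forall fun t => ⟨_, rfl, ?_⟩)
  exact_mod_cast hx.arrivalCount_thin_le_height h1 h2 hg p t

theorem ae_private_growsAtMost {lh la Δ Δa : ℝ} (hlh : 0 < lh) (hla : 0 < la) (hΔ : 0 ≤ Δ) :
    ∀ᵐ ω ∂arrivalLaw lh la, ∀ p,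
      GrowsAtMost (fun s => {d | ∃ x ∈ PrivateAttack Δ Δa s ω, Admissible Δ Δa ω x ∧
        d = x.height (x.tip p s)}) (lamGrowth lh Δ) := by
  filter_upwards [ae_arrivalLaw_fst (ae_regular_poissonArrivals hlh),
    ae_arrivalLaw_snd (ae_regular_poissonArrivals hla),
    ae_arrivalLaw_fst (ae_tendsto_thinCount_div hlh hΔ)] with ω h1 h2 h3 p
  refine GrowsAtMost.of_tendsto h3 (Eventually.of_forall fun s d hd => ?_)
  obtain ⟨x, hp, hx, rfl⟩ := hd
  exact_mod_cast hx.height_tip_le_of_private hΔ h1 h2 hp p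

/-! ### The private attack can be carried out -/

/-- Well-founded recursion for a functional that looks only at smaller arguments: value `i` no
longer changes after `i + 1` iterations from any start. -/
theorem exists_recursive {α : Type*} [Inhabited α] (F : (ℕ → α) → ℕ → α)
    (h : ∀ f g i, (∀ k < i, f k = g k) → F f i = F g i) : ∃ f : ℕ → α, ∀ i, f i = F f i := by
  have key : ∀ m n i, i < m → i < n → (F^[m] fun _ => default) i = (F^[n] fun _ => default) i := by
    intro m
    induction m with
    | zero => intro n i hi; omega
    | succ m ih =>
      intro n i hi hn
      obtain ⟨n, rfl⟩ : ∃ n', n = n' + 1 := ⟨n - 1, by omega⟩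
      rw [Function.iterate_succ_apply', Function.iterate_succ_apply']
      exact h _ _ _ fun k hk => ih n k (by omega) (by omega)
  refine ⟨fun i => (F^[i + 1] fun _ => default) i, fun i => ?_⟩
  simp only
  rw [Function.iterate_succ_apply']
  exact h _ _ _ fun k hk => key _ _ k hk (by omega)

/-- The heights in a private attack, given those of the honest and of the adversarial blocks. -/
def heightOf (hH hA : ℕ → ℕ) : Block → ℕ
  | .genesis => 0
  | .honest i => hH i
  | .adv j 0 => hA j
  | .adv _ (_ + 1) => 1

/-- What the honest node `p` knows at time `t` in the private attack, given the heights. -/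
def privateView (Δ s : ℝ) (ω : Arrivals) (hH hA : ℕ → ℕ) (p : ℕ) (t : ℝ) : Set Block :=
  {b | b = .genesis ∨ (∃ i, b = .honest i ∧ (ω.1 i + Δ < t ∨ (i = p ∧ ω.1 i < t))) ∨
    (∃ j, b = .adv j 0 ∧ ω.2 j < t ∧
      ∃ r, s + Δ < r ∧ r < t ∧ ∃ j, ω.2 j < r ∧ ∀ i, ω.1 i < r → hH i < hA j)}

theorem finite_setOf_mineTime_lt {ω : Arrivals} (h1 : RegularArrivals ω.1)
    (h2 : RegularArrivals ω.2) (t : ℝ) :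
    {b : Block | b = .genesis ∨ (∃ i, b = .honest i ∧ ω.1 i < t) ∨
      ∃ j, b = .adv j 0 ∧ ω.2 j < t}.Finite := by
  have : {b : Block | b = .genesis ∨ (∃ i, b = .honest i ∧ ω.1 i < t) ∨
      ∃ j, b = .adv j 0 ∧ ω.2 j < t} ⊆ {.genesis} ∪
        (Block.honest '' Set.Iio (arrivalCount ω.1 t) ∪
          (fun j => Block.adv j 0) '' Set.Iio (arrivalCount ω.2 t)) := by
    rintro b (rfl | ⟨i, rfl, hi⟩ | ⟨j, rfl, hj⟩)
    · exact Or.inl rfl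
    · exact Or.inr (Or.inl ⟨i, h1.lt_arrivalCount.2 hi, rfl⟩)
    · exact Or.inr (Or.inr ⟨j, h2.lt_arrivalCount.2 hj, rfl⟩)
  exact ((Set.finite_singleton _).union
    (((Set.finite_Iio _).image _).union ((Set.finite_Iio _).image _))).subset this

theorem sSup_image_eq {S : Set Block} {f : Block → ℕ} {b : Block} (hb : b ∈ S)
    (hmax : ∀ c ∈ S, f c ≤ f b) : sSup (f '' S) = f b :=
  (IsGreatest.csSup_eq ⟨⟨b, hb, rfl⟩, by rintro _ ⟨c, hc, rfl⟩; exact hmax c hc⟩)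

theorem Play.height_eq_of_forall {x : Play} {f : Block → ℕ} (h0 : f .genesis = 0)
    (h : ∀ b, b ≠ .genesis → f b = f (x.parent b) + 1) (b : Block) : x.height b = f b := by
  have key : ∀ k, ∀ b, k ≤ f b → f (x.parent^[k] b) = f b - k := by
    intro k
    induction k with
    | zero => intro b _; rfl
    | succ k ih =>
      intro b hk
      have hb : b ≠ .genesis := by rintro rfl; omega
      have := h b hb
      rw [Function.iterate_succ_apply, ih _ (by omega)]
      omega
  refine le_antisymm (Nat.sInf_le ?_) ?_
  · have := key (f b) b le_rfl
    rw [Nat.sub_self] at this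
    by_contra hne
    have := h _ hne
    omega
  · refine le_csInf ⟨f b, ?_⟩ ?_
    · have := key (f b) b le_rfl
      rw [Nat.sub_self] at this
      by_contra hne
      have := h _ hne
      omega
    · intro n hn
      by_contra hlt
      have := key n b (by omega)
      rw [hn, h0] at this
      omega

/-- Views depend on the release, the release on heights, and heights on the parents, which are
chosen from views. The circle is broken by constructing the heights first, by recursion along the
arrivals; tips and parents are then chosen as highest known blocks, and the heights of the resulting
tree are the prescribed ones. -/
theorem exists_privateAttack {Δ Δa : ℝ} (hΔ : 0 ≤ Δ) {ω : Arrivals}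
    (h1 : RegularArrivals ω.1) (h2 : RegularArrivals ω.2) (s : ℝ) :
    ∃ x ∈ PrivateAttack Δ Δa s ω, Admissible Δ Δa ω x := by
  -- Private miners know no honest block, so the honest heights may be set to 0 here.
  obtain ⟨hA, hhA⟩ : ∃ hA : ℕ → ℕ, ∀ j,
      hA j = sSup (heightOf 0 hA '' privateKnown Δa ω (ω.2 j)) + 1 := by
    refine exists_recursive
      (fun hA j => sSup (heightOf 0 hA '' privateKnown Δa ω (ω.2 j)) + 1) fun f g i hfg => ?_
    congr 2
    refine Set.image_congr ?_
    rintro b (rfl | ⟨k, rfl, hk, -⟩)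
    · rfl
    · exact hfg k (h2.strictMono.lt_iff_lt.1 hk)
  obtain ⟨hH, hhH⟩ : ∃ hH : ℕ → ℕ, ∀ i,
      hH i = sSup (heightOf hH hA '' privateView Δ s ω hH hA i (ω.1 i)) + 1 := by
    refine exists_recursive
      (fun hH i => sSup (heightOf hH hA '' privateView Δ s ω hH hA i (ω.1 i)) + 1)
      fun f g i hfg => ?_
    -- A release before the mining time of block `i` compares private heights with honest blocks
    -- mined still earlier, so the view involves only honest heights of index below `i`.
    have hview : privateView Δ s ω f hA i (ω.1 i) = privateView Δ s ω g hA i (ω.1 i) := by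
      have : ∀ r, r < ω.1 i → ((∃ j, ω.2 j < r ∧ ∀ i, ω.1 i < r → f i < hA j) ↔
          (∃ j, ω.2 j < r ∧ ∀ i, ω.1 i < r → g i < hA j)) := by
        intro r hr
        refine exists_congr fun j => and_congr_right fun _ => forall_congr' fun k =>
          imp_congr_right fun hk => ?_
        rw [hfg k (h1.strictMono.lt_iff_lt.1 (hk.trans hr))]
      ext b
      simp only [privateView, Set.mem_ofPred_eq]
      refine or_congr Iff.rfl (or_congr Iff.rfl (exists_congr fun j => and_congr_right fun _ =>
        and_congr_right fun _ => exists_congr fun r => and_congr_right fun _ =>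
        and_congr_right fun hr => this r hr))
    rw [hview]
    congr 2
    refine Set.image_congr ?_
    rintro b (rfl | ⟨k, rfl, hk⟩ | ⟨j, rfl, -⟩)
    · rfl
    · refine hfg k (h1.strictMono.lt_iff_lt.1 ?_)
      rcases hk with hk | ⟨_, hk⟩ <;> linarith
    · rfl
  set ht := heightOf hH hA with hht
  have hviewfin : ∀ p t, (privateView Δ s ω hH hA p t).Finite := by
    intro p t
    refine (finite_setOf_mineTime_lt h1 h2 t).subset ?_
    rintro b (rfl | ⟨k, rfl, hk⟩ | ⟨j, rfl, hj, -⟩)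
    · exact Or.inl rfl
    · exact Or.inr (Or.inl ⟨k, rfl, by rcases hk with hk | ⟨_, hk⟩ <;> linarith⟩)
    · exact Or.inr (Or.inr ⟨j, rfl, hj⟩)
  have hknownfin : ∀ t, (privateKnown Δa ω t).Finite := by
    intro t
    refine (finite_setOf_mineTime_lt h1 h2 t).subset ?_
    rintro b (rfl | ⟨j, rfl, hj, -⟩)
    · exact Or.inl rfl
    · exact Or.inr (Or.inr ⟨j, rfl, hj⟩)
  have htip : ∀ p t, ∃ b ∈ privateView Δ s ω hH hA p t,
      ∀ c ∈ privateView Δ s ω hH hA p t, ht c ≤ ht b := fun p t =>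
    Set.exists_max_image _ ht (hviewfin p t) ⟨.genesis, Or.inl rfl⟩
  choose tip htip1 htip2 using htip
  have hpar : ∀ j, ∃ b ∈ privateKnown Δa ω (ω.2 j),
      ∀ c ∈ privateKnown Δa ω (ω.2 j), ht c ≤ ht b := fun j =>
    Set.exists_max_image _ ht (hknownfin _) ⟨.genesis, Or.inl rfl⟩
  choose par hpar1 hpar2 using hpar
  let parent : Block → Block := fun b => match b with
    | .genesis => .genesis
    | .honest i => tip i (ω.1 i)
    | .adv j 0 => par j
    | .adv _ (_ + 1) => .genesis
  let x : Play := ⟨parent, privateView Δ s ω hH hA, tip⟩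
  -- The prescribed heights vanish at genesis and increase by one from parent to child; this
  -- determines the height.
  have hheight : ∀ b, x.height b = ht b := by
    refine Play.height_eq_of_forall rfl fun b hb => ?_
    cases b with
    | genesis => exact absurd rfl hb
    | honest i =>
      change hH i = ht (tip i (ω.1 i)) + 1
      rw [hhH, sSup_image_eq (htip1 i _) (htip2 i _)]
    | adv j m =>
      cases m with
      | zero =>
        change hA j = ht (par j) + 1
        rw [hhA, ← sSup_image_eq (hpar1 j) (hpar2 j)]
        congr 2
        refine Set.image_congr ?_
        rintro b (rfl | ⟨k, rfl, -⟩) <;> rfl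
      | succ m => rfl
  have hrel : ∀ t, Released Δ s ω x t ↔
      ∃ r, s + Δ < r ∧ r < t ∧ ∃ j, ω.2 j < r ∧ ∀ i, ω.1 i < r → hH i < hA j := by
    intro t
    simp only [Released, Overtakes, hheight]
    rfl
  have hview : ∀ p t, x.view p t =
        {b | b = .genesis ∨ (∃ i, b = .honest i ∧ (ω.1 i + Δ < t ∨ (i = p ∧ ω.1 i < t))) ∨
          (∃ j, b = .adv j 0 ∧ ω.2 j < t ∧ Released Δ s ω x t)} := by
    intro p t
    simp only [hrel]
    rfl
  have hvt : ∀ p t, ∀ b ∈ x.view p t, b ≠ .genesis → mineTime ω b < t := by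
    rintro p t b (rfl | ⟨k, rfl, hk⟩ | ⟨j, rfl, hj, -⟩) hb
    · exact absurd rfl hb
    · change ω.1 k < t
      rcases hk with hk | ⟨_, hk⟩ <;> linarith
    · exact hj
  have hearlier : ∀ b, b ≠ .genesis → mineTime ω (x.parent b) < mineTime ω b := by
    intro b hb
    by_cases hp : x.parent b = .genesis
    · rw [hp]; exact mineTime_pos h1 h2 hb
    cases b with
    | genesis => exact absurd rfl hb
    | honest i => exact hvt i (ω.1 i) _ (htip1 i (ω.1 i)) hp
    | adv j m =>
      cases m with
      | zero =>
        change mineTime ω (par j) < ω.2 j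
        rcases hpar1 j with h | ⟨k, h, hk, -⟩
        · exact absurd h hp
        · rw [h]; exact hk
      | succ m => exact absurd rfl hp
  refine ⟨x, ⟨fun j => ⟨hpar1 j, ?_⟩, ?_, hview⟩, ?_⟩
  · intro b hb
    rw [hheight, hheight]
    exact hpar2 j b hb
  · intro j m hm
    cases m with
    | zero => exact absurd rfl hm
    | succ m => rfl
  · refine ⟨rfl, hearlier, ?_, fun i => rfl, htip1, ?_, fun p t => Or.inl rfl, hvt, ?_, ?_, ?_, ?_⟩
    · intro j m i l h
      cases m with
      | zero =>
        change par j = .adv i l at h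
        rcases hpar1 j with h' | ⟨k, h', -, hk⟩
        · rw [h] at h'; cases h'
        · rw [h] at h'; cases h'; exact hk
      | succ m => cases h
    · intro p t b hb
      rw [hheight, hheight]
      exact htip2 p t b hb
    · intro p t b hb
      rw [hview] at hb ⊢
      rcases hb with rfl | ⟨k, rfl, hk⟩ | ⟨j, rfl, hj, hr⟩
      · exact Or.inl rfl
      · have hkt : ω.1 k < t := by rcases hk with hk | ⟨_, hk⟩ <;> linarith
        have hm : x.parent (.honest k) ∈ x.view k (ω.1 k) := htip1 k (ω.1 k)
        generalize x.parent (.honest k) = c at hm ⊢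
        rw [hview] at hm
        rcases hm with rfl | ⟨i, rfl, hi⟩ | ⟨j, rfl, hj, hr⟩
        · exact Or.inl rfl
        · refine Or.inr (Or.inl ⟨i, rfl, Or.inl ?_⟩)
          rcases hi with hi | ⟨rfl, hi⟩
          · linarith
          · exact absurd hi (lt_irrefl _)
        · exact Or.inr (Or.inr ⟨j, rfl, hj.trans hkt, released_mono hkt.le hr⟩)
      · change par j = _ ∨ (∃ i, par j = _ ∧ _) ∨ ∃ i, par j = _ ∧ _
        rcases hpar1 j with h | ⟨k, h, hk, -⟩
        · exact Or.inl h
        · exact Or.inr (Or.inr ⟨k, h, hk.trans hj, hr⟩)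
    · intro p t t' htt b hb
      rw [hview] at hb ⊢
      rcases hb with rfl | ⟨k, rfl, hk⟩ | ⟨j, rfl, hj, hr⟩
      · exact Or.inl rfl
      · refine Or.inr (Or.inl ⟨k, rfl, ?_⟩)
        rcases hk with hk | ⟨h, hk⟩
        · exact Or.inl (by linarith)
        · exact Or.inr ⟨h, by linarith⟩
      · exact Or.inr (Or.inr ⟨j, rfl, hj.trans_le htt, released_mono htt hr⟩)
    · intro i t hi
      rw [hview]
      exact Or.inr (Or.inl ⟨i, rfl, Or.inr ⟨rfl, hi⟩⟩)
    · intro p q t t' htt b hb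
      rw [hview] at hb ⊢
      rcases hb with rfl | ⟨k, rfl, hk⟩ | ⟨j, rfl, hj, hr⟩
      · exact Or.inl rfl
      · refine Or.inr (Or.inl ⟨k, rfl, Or.inl ?_⟩)
        rcases hk with hk | ⟨h, hk⟩ <;> linarith
      · exact Or.inr (Or.inr ⟨j, rfl, by linarith, released_mono (by linarith) hr⟩)

theorem ae_exists_privateAttack {lh la Δ Δa : ℝ} (hlh : 0 < lh) (hla : 0 < la) (hΔ : 0 ≤ Δ) :
    ∀ᵐ ω ∂arrivalLaw lh la, ∀ s, ∃ x ∈ PrivateAttack Δ Δa s ω, Admissible Δ Δa ω x := by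
  filter_upwards [ae_arrivalLaw_fst (ae_regular_poissonArrivals hlh),
    ae_arrivalLaw_snd (ae_regular_poissonArrivals hla)] with ω h1 h2 s
  exact exists_privateAttack hΔ h1 h2 s

/-! ### When the adversary is fast, the private attack succeeds -/

section

variable {A B C D : Type*} [MeasurableSpace A] [MeasurableSpace B] [MeasurableSpace C]
  [MeasurableSpace D]

theorem measurePreserving_prodProdProdComm (α : Measure A) (β : Measure B) (γ : Measure C)
    (δ : Measure D) [IsProbabilityMeasure α] [IsProbabilityMeasure β] [IsProbabilityMeasure γ]
    [IsProbabilityMeasure δ] :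
    MeasurePreserving (fun p : (A × B) × C × D => ((p.1.1, p.2.1), p.1.2, p.2.2))
      ((α.prod β).prod (γ.prod δ)) ((α.prod γ).prod (β.prod δ)) := by
  have e1 := measurePreserving_prodAssoc α β (γ.prod δ)
  have e2 := (MeasurePreserving.id α).prod ((measurePreserving_prodAssoc β γ δ).symm)
  have e3 := (MeasurePreserving.id α).prod
    ((Measure.measurePreserving_swap (μ := β) (ν := γ)).prod (MeasurePreserving.id δ))
  have e4 := (MeasurePreserving.id α).prod (measurePreserving_prodAssoc γ β δ)
  have e5 := (measurePreserving_prodAssoc α γ (β.prod δ)).symm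
  exact e5.comp (e4.comp (e3.comp (e2.comp e1)))

/-- Two independent systems, each with an observable that is independent of its measure-preserving
shift, form one such system. -/
theorem map_prodMk_prod {S S' Ω Ω' : Type*} [MeasurableSpace S] [MeasurableSpace S']
    [MeasurableSpace Ω] [MeasurableSpace Ω'] {μ : Measure Ω} {μ' : Measure Ω'}
    [IsProbabilityMeasure μ] [IsProbabilityMeasure μ'] {θ : Ω → Ω} {θ' : Ω' → Ω'} {f : Ω → S}
    {f' : Ω' → S'} {ρ : Measure S} {ρ' : Measure S'} [IsProbabilityMeasure ρ]
    [IsProbabilityMeasure ρ'] (hθ : Measurable θ) (hf : Measurable f) (hθ' : Measurable θ')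
    (hf' : Measurable f') (h : μ.map (fun ω => (f ω, θ ω)) = ρ.prod μ)
    (h' : μ'.map (fun ω => (f' ω, θ' ω)) = ρ'.prod μ') :
    (μ.prod μ').map (fun ω => ((f ω.1, f' ω.2), (θ ω.1, θ' ω.2))) =
      (ρ.prod ρ').prod (μ.prod μ') := by
  have h1 : MeasurePreserving (fun ω => (f ω, θ ω)) μ (ρ.prod μ) := ⟨hf.prodMk hθ, h⟩
  have h2 : MeasurePreserving (fun ω => (f' ω, θ' ω)) μ' (ρ'.prod μ') := ⟨hf'.prodMk hθ', h'⟩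
  exact ((measurePreserving_prodProdProdComm ρ μ ρ' μ').comp (h1.prod h2)).map_eq

end

theorem iterate_prodMap {A B : Type*} (f : A → A) (g : B → B) (n : ℕ) (p : A × B) :
    (fun ω : A × B => (f ω.1, g ω.2))^[n] p = (f^[n] p.1, g^[n] p.2) := by
  induction n with
  | zero => rfl
  | succ n ih => rw [Function.iterate_succ_apply', ih, Function.iterate_succ_apply',
      Function.iterate_succ_apply']

/-- The pairs of gaps of the thinned honest and adversarial arrivals are independent. -/
theorem map_thinGaps_arrivalLaw {lh la Δ Δa : ℝ} (hlh : 0 < lh) (hla : 0 < la) (hΔ : 0 ≤ Δ)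
    (hΔa : 0 ≤ Δa) :
    (arrivalLaw lh la).map
        (fun ω (n : ℕ) => ((thinStep Δ)^[n] ω.1 0, (thinStep Δa)^[n] ω.2 0)) =
      Measure.infinitePi (fun _ => (expGap lh).prod (expGap la)) := by
  have hf : Measurable fun T : ℕ → ℝ => T 0 := measurable_pi_apply 0
  have h := map_prodMk_prod (measurable_thinStep Δ) hf (measurable_thinStep Δa) hf
    ((isMemoryless_poissonArrivals hlh).map_head_thinStep hΔ)
    ((isMemoryless_poissonArrivals hla).map_head_thinStep hΔa)
  have hθ : Measurable fun ω : Arrivals => (thinStep Δ ω.1, thinStep Δa ω.2) :=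
    ((measurable_thinStep Δ).comp measurable_fst).prodMk
      ((measurable_thinStep Δa).comp measurable_snd)
  have hF : Measurable fun ω : Arrivals => (ω.1 0, ω.2 0) :=
    (hf.comp measurable_fst).prodMk (hf.comp measurable_snd)
  have h2 := map_fst_of_map_prodMk hθ hF h
  have h3 := map_orbit_eq_infinitePi (μ := arrivalLaw lh la) hθ hF (by
    change _ = (((poissonArrivals lh).prod (poissonArrivals la)).map _).prod _
    rw [h2]; exact h)
  simp only [iterate_prodMap] at h3
  rw [h3]
  congr 1
  funext _
  exact h2

/-- A random walk with nonpositive drift is below any given level at late times with a probability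
bounded away from `0`. -/
theorem exists_le_measure_sum_lt {S : Type*} [MeasurableSpace S] {ν : Measure S}
    [IsProbabilityMeasure ν] {X : S → ℝ} (hX : Measurable X) (h2 : MemLp X 2 ν)
    (hv : 0 < Var[X; ν]) (hm : ∫ s, X s ∂ν ≤ 0) (C : ℝ) :
    ∃ q : ENNReal, 0 < q ∧ ∀ᶠ n : ℕ in atTop,
      q ≤ Measure.infinitePi (fun _ : ℕ => ν) {x | ∑ i ∈ Finset.range n, X (x i) < C} := by
  set P := Measure.infinitePi (fun _ : ℕ => ν)
  have hmp : ∀ i, MeasurePreserving (fun x : ℕ → S => x i) P ν := fun i =>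
    measurePreserving_eval_infinitePi (fun _ : ℕ => ν) i
  have hind : iIndepFun (fun (i : ℕ) (x : ℕ → S) => X (x i)) P :=
    iIndepFun_infinitePi (X := fun _ => X) (fun _ => hX)
  have hident : ∀ i : ℕ, IdentDistrib (fun x : ℕ → S => X (x i)) (fun x => X (x 0)) P P := by
    intro i
    refine ⟨(hX.comp (measurable_pi_apply i)).aemeasurable,
        (hX.comp (measurable_pi_apply 0)).aemeasurable, ?_⟩
    change P.map (X ∘ fun x => x i) = P.map (X ∘ fun x => x 0)
    rw [← Measure.map_map hX (measurable_pi_apply i), (hmp i).map_eq,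
        ← Measure.map_map hX (measurable_pi_apply 0), (hmp 0).map_eq]
  have hvar : Var[fun x : ℕ → S => X (x 0); P] = Var[X; ν] := (hmp 0).variance_fun_comp hX.aemeasurable
  have hmean : ∫ x : ℕ → S, X (x 0) ∂P = ∫ s, X s ∂ν := by
    have := integral_map (μ := P) (φ := fun x : ℕ → S => x 0) (f := X)
      (measurable_pi_apply 0).aemeasurable hX.aestronglyMeasurable
    rw [(hmp 0).map_eq] at this
    exact this.symm
  set v := Var[fun x : ℕ → S => X (x 0); P].toNNReal with hvdef
  have hv0 : v ≠ 0 := by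
    rw [hvdef, hvar]
    exact (Real.toNNReal_pos.2 hv).ne'
  have hclt := tendstoInDistribution_inv_sqrt_mul_sum_sub
    (X := fun (i : ℕ) (x : ℕ → S) => X (x i)) (P := P) (P' := gaussianReal 0 v)
    (Y := fun y => y) ⟨measurable_id.aemeasurable, Measure.map_id⟩ (h2.comp_measurePreserving (hmp 0))
    hind hident
  -- The Gaussian limit charges the open half-line below -1, and weak convergence bounds the masses
  -- of open sets from below. The law of large numbers would not suffice when the drift is 0.
  have hopen := ProbabilityMeasure.le_liminf_measure_open_of_tendsto hclt.tendsto
    (isOpen_Iio (a := (-1 : ℝ)))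
  simp only [ProbabilityMeasure.coe_mk] at hopen
  have hpos : 0 < (gaussianReal 0 v).map (fun y => y) (Set.Iio (-1 : ℝ)) := by
    have e : (gaussianReal 0 v).map (fun y => y) = gaussianReal 0 v := Measure.map_id
    rw [e, pos_iff_ne_zero]
    intro h0
    have := gaussianReal_absolutelyContinuous' 0 hv0 h0
    simp at this
  obtain ⟨q, hq0, hq1⟩ := ENNReal.lt_iff_exists_nnreal_btwn.1 hpos
  refine ⟨q, hq0, ?_⟩
  have hev := eventually_lt_of_lt_liminf (hq1.trans_le hopen)
  have hsq : Tendsto (fun n : ℕ => Real.sqrt n) atTop atTop :=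
    Real.tendsto_sqrt_atTop.comp tendsto_natCast_atTop_atTop
  -- As the mean is at most 0, a normalised centred sum below -1 puts the walk below `-√n`, which is
  -- below `C` once `√n > -C`.
  filter_upwards [hev, hsq.eventually_gt_atTop (-C), hsq.eventually_gt_atTop 0] with n h3 h4 h5
  refine h3.le.trans ?_
  rw [Measure.map_apply_of_aemeasurable (hclt.forall_aemeasurable n) measurableSet_Iio]
  refine measure_mono fun x hx => ?_
  simp only [Set.mem_preimage, Set.mem_Iio] at hx
  rw [hmean, inv_mul_lt_iff₀ h5] at hx
  have h6 : (n : ℝ) * ∫ s, X s ∂ν ≤ 0 := mul_nonpos_of_nonneg_of_nonpos (by positivity) hm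
  simp only [Set.mem_ofPred_eq]
  linarith

theorem eventually_le_measure_thin_lt {lh la Δ Δa : ℝ} (hlh : 0 < lh) (hla : 0 < la) (hΔ : 0 ≤ Δ)
    (hΔa : 0 ≤ Δa) (h : lamGrowth lh Δ ≤ lamEff la Δa) :
    ∃ q : ENNReal, 0 < q ∧ ∀ᶠ n : ℕ in atTop,
      q ≤ arrivalLaw lh la {ω | thin Δa ω.2 n < thin Δ ω.1 n} := by
  set ν := (expGap lh).prod (expGap la)
  let X : ℝ × ℝ → ℝ := fun p => (-p.1) + (p.2 + (Δa - Δ))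
  have hX : Measurable X := by fun_prop
  have m1 : MemLp (fun x : ℝ => -x) 2 (expGap lh) := (memLp_id_expGap lh).neg
  have m2 : MemLp (fun x : ℝ => x + (Δa - Δ)) 2 (expGap la) :=
    (memLp_id_expGap la).add (memLp_const _)
  have h2 : MemLp X 2 ν := (m1.comp_fst _).add (m2.comp_snd _)
  have hv : 0 < Var[X; ν] := by
    have : Var[X; ν] = Var[fun x : ℝ => -x; expGap lh] +
        Var[fun x : ℝ => x + (Δa - Δ); expGap la] :=
      variance_add_prod (X := fun x : ℝ => -x) (Y := fun x : ℝ => x + (Δa - Δ)) m1 m2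
    rw [this]
    have h3 : Var[fun x : ℝ => -x; expGap lh] = Var[fun x : ℝ => x; expGap lh] := variance_fun_neg
    rw [h3]
    have := variance_id_expGap_pos hlh
    have := variance_nonneg (fun x : ℝ => x + (Δa - Δ)) (expGap la)
    linarith
  have hm : ∫ s, X s ∂ν ≤ 0 := by
    have i1 : Integrable (fun p : ℝ × ℝ => -p.1) ν := (m1.integrable one_le_two).comp_fst (expGap la)
    have i2 : Integrable (fun p : ℝ × ℝ => p.2 + (Δa - Δ)) ν :=
      (m2.integrable one_le_two).comp_snd (expGap lh)
    have : ∫ s, X s ∂ν = (∫ p, -p.1 ∂ν) + ∫ p, (p.2 + (Δa - Δ)) ∂ν := integral_add i1 i2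
    rw [this, integral_fun_fst (fun x : ℝ => -x), integral_fun_snd (fun x : ℝ => x + (Δa - Δ)),
      integral_neg, integral_add (integrable_id_expGap la) (integrable_const _),
      integral_id_expGap, integral_id_expGap]
    simp only [probReal_univ, integral_const, smul_eq_mul, one_mul]
    have h4 : 1 / la + Δa ≤ 1 / lh + Δ := by
      have e1 : lamGrowth lh Δ = (1 / lh + Δ)⁻¹ := by rw [lamGrowth]; field_simp
      have e2 : lamEff la Δa = (1 / la + Δa)⁻¹ := by rw [lamEff]; field_simp
      rw [e1, e2] at h
      exact (inv_le_inv₀ (by positivity) (by positivity)).1 h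
    linarith
  -- The thinned time of index `n` contains `n + 1` exponential gaps but only `n` dead times. The
  -- walk of length `n + 1` counts one difference of delays too many, which the level `Δa - Δ`
  -- compensates.
  obtain ⟨q, hq, hev⟩ := exists_le_measure_sum_lt hX h2 hv hm (Δa - Δ)
  refine ⟨q, hq, ?_⟩
  filter_upwards [(tendsto_add_atTop_nat 1).eventually hev] with n hn
  rw [← map_thinGaps_arrivalLaw hlh hla hΔ hΔa, Measure.map_apply] at hn
  · refine hn.trans (measure_mono fun ω hω => ?_)
    simp only [Set.mem_preimage, Set.mem_ofPred_eq] at hω ⊢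
    rw [thin_eq_sum, thin_eq_sum]
    simp only [X, Finset.sum_add_distrib, Finset.sum_neg_distrib, Finset.sum_const,
      Finset.card_range, nsmul_eq_mul] at hω
    push_cast at hω
    linarith
  · exact measurable_pi_lambda _ fun n =>
      (((measurable_pi_apply n).comp (measurable_thinGaps Δ)).comp measurable_fst).prodMk
        (((measurable_pi_apply n).comp (measurable_thinGaps Δa)).comp measurable_snd)
  · exact measurableSet_lt (Finset.measurable_fun_sum _ fun i _ => hX.comp (measurable_pi_apply i))
      measurable_const

/-! ### From an overtaking private chain to a failure of persistence -/

section

variable {Δ Δa : ℝ} {ω : Arrivals} {x : Play}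

theorem Admissible.iterate_parent_not_released (hx : Admissible Δ Δa ω x) {s : ℝ}
    (hp : x ∈ PrivateAttack Δ Δa s ω) {t : ℝ} (ht : ¬ Released Δ s ω x t) {i : ℕ} (hi : ω.1 i < t)
    (n : ℕ) : x.parent^[n] (.honest i) = .genesis ∨
      ∃ i', x.parent^[n] (.honest i) = .honest i' ∧ ω.1 i' < t := by
  induction n with
  | zero => exact Or.inr ⟨i, rfl, hi⟩
  | succ n ih =>
    rw [Function.iterate_succ_apply']
    rcases ih with h | ⟨i', h, hi'⟩
    · rw [h]; exact Or.inl hx.parent_genesis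
    · rw [h, hx.honest_parent]
      have hmem := hx.tip_mem i' (ω.1 i')
      generalize x.tip i' (ω.1 i') = b at hmem ⊢
      have hv := hx.view_past i' _ b hmem
      rw [hp.2.2] at hmem
      rcases hmem with rfl | ⟨k, rfl, -⟩ | ⟨j, rfl, -, hr⟩
      · exact Or.inl rfl
      · exact Or.inr ⟨k, rfl, (hv (by simp)).trans hi'⟩
      · exact absurd (released_mono hi'.le hr) ht

theorem exists_gap_after {T : ℕ → ℝ} (h : RegularArrivals T) (τ : ℝ) :
    ∃ u > τ, ∀ i, T i < u → T i ≤ τ := by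
  classical
  have hex : ∃ i, τ < T i := (h.tendsto.eventually_gt_atTop τ).exists
  refine ⟨T (Nat.find hex), Nat.find_spec hex, fun i hi => ?_⟩
  exact not_lt.1 (Nat.find_min hex (h.strictMono.lt_iff_lt.1 hi))

/-- If the private chain overtakes the honest one late enough, then the private attack undoes a deep
confirmation. -/
theorem Admissible.persistenceFails_of_private (hx : Admissible Δ Δa ω x) (hΔ : 0 ≤ Δ)
    (h1 : RegularArrivals ω.1) (h2 : RegularArrivals ω.2)
    (hg : ∀ n, thin Δ ω.1 n + Δ < thin Δ ω.1 (n + 1)) {s : ℝ}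
    (hp : x ∈ PrivateAttack Δ Δa s ω) {k : ℕ} (hk : thin Δ ω.1 k < s - Δ)
    (hex : ∃ n, thin Δa ω.2 n < thin Δ ω.1 n ∧ s + Δ < thin Δ ω.1 n) :
    PersistenceFails Δ k s x := by
  classical
  -- Take the least index at which the thinned adversarial process wins the race late enough. This
  -- pins down the release.
  obtain ⟨hn1, hn2⟩ := Nat.find_spec hex
  have hmin : ∀ m < Nat.find hex, ¬ _ := fun m hm => Nat.find_min hex hm
  set n := Nat.find hex
  set τ := max (thin Δa ω.2 n) (s + Δ)
  have hunrel : ¬ Released Δ s ω x τ := by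
    rintro ⟨r, hr1, hr2, j, hj, hov⟩
    obtain ⟨m, hm⟩ : ∃ m, x.height (.adv j 0) = m + 1 :=
      ⟨_, hx.height_eq h1 h2 (by simp)⟩
    have h3 := hx.thin_le_of_lt_height_adv h1 h2 hp m j (by omega)
    have h4 : r ≤ thin Δ ω.1 m := by
      by_contra hc
      have := hov (thinIdx Δ ω.1 m) (not_le.1 hc)
      have := hx.lt_height_honest_thinIdx h1 h2 hg m
      omega
    have hnm : n ≤ m := by
      by_contra hc
      exact hmin m (not_le.1 hc) ⟨by linarith, by linarith⟩
    have h5 := (h2.thinned Δa).strictMono.monotone hnm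
    exact absurd hr2 (not_lt.2 (max_le (by linarith) hr1.le))
  -- No honest block is mined strictly between `τ` and `u`. Honest heights therefore stay at most
  -- `n` before `u`, while the private chain has height above `n` by `τ`.
  obtain ⟨u, hu, hgap⟩ := exists_gap_after h1 τ
  have hlow : ∀ i, ω.1 i < u → x.height (.honest i) ≤ n := by
    intro i hi
    by_contra hc
    have h3 := hx.thin_le_of_lt_height h1 h2 hp hunrel n i (hgap i hi) (not_le.1 hc)
    have h4 := hgap i hi
    have : τ < thin Δ ω.1 n := max_lt hn1 hn2
    linarith
  have hadv := hx.lt_height_adv_thinIdx h1 h2 hp n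
  have hτ1 : ω.2 (thinIdx Δa ω.2 n) ≤ τ := le_max_left _ _
  have hτ2 : s + Δ ≤ τ := le_max_right _ _
  have hov : Released Δ s ω x ((τ + 2 * u) / 3) := by
    -- Overtaking, release and observation are separated by strict inequalities, so two distinct
    -- times strictly between `τ` and `u` are used.
    refine ⟨(2 * τ + u) / 3, by linarith, by linarith, thinIdx Δa ω.2 n, by linarith, fun i hi => ?_⟩
    have := hlow i (by linarith)
    omega
  -- The transaction contained in all honest blocks: the unreleased chains at time `s` consist of
  -- honest blocks above genesis, so it is deeply confirmed there, whereas the released private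
  -- chain contains none of them.
  refine ⟨Set.range Block.honest, fun p => ?_, (τ + 2 * u) / 3, by linarith, 0, ?_⟩
  · have hheight : k < x.height (x.tip p s) := by
      have := hx.height_honest_le_tip (i := thinIdx Δ ω.1 k) (p := p) (t := s) (by
        have : ω.1 (thinIdx Δ ω.1 k) < s - Δ := hk
        linarith)
      have := hx.lt_height_honest_thinIdx h1 h2 hg k
      omega
    obtain ⟨i, hi1, hi2, -⟩ := hx.thin_lt_of_lt_height_tip h1 h2 hp (not_released_self hΔ s) hheight
    have hb := hx.height_iterate h1 h2 (x.tip p s) k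
    rcases hx.iterate_parent_not_released hp (not_released_self hΔ s) hi2 k with h | ⟨i', h, -⟩
    · rw [← hi1] at h
      rw [h, x.height_genesis] at hb
      omega
    · rw [← hi1] at h
      refine ⟨.honest i', ⟨i', rfl⟩, ⟨k, h⟩, ?_⟩
      rw [← h, hb]
      omega
  · rintro ⟨b, ⟨i, rfl⟩, ⟨m, hm⟩, -⟩
    have hmem := hx.tip_mem 0 ((τ + 2 * u) / 3)
    have hlong := hx.tip_longest 0 ((τ + 2 * u) / 3) (.adv (thinIdx Δa ω.2 n) 0) (by
      rw [hp.2.2]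
      exact Or.inr (Or.inr ⟨_, rfl, by linarith, hov⟩))
    generalize x.tip 0 ((τ + 2 * u) / 3) = c at hm hmem hlong
    have hv := hx.view_past 0 _ c hmem
    rw [hp.2.2] at hmem
    rcases hmem with rfl | ⟨i', rfl, -⟩ | ⟨j, rfl, -⟩
    · rw [x.height_genesis] at hlong; omega
    · have h3 := hv (by simp)
      simp only [mineTime] at h3
      have := hlow i' (by linarith)
      omega
    · rcases iterate_parent_private hx.parent_genesis hp j m with h | ⟨i', h⟩ <;>
        rw [h] at hm <;> cases hm

end

theorem tendsto_measure_zero_of_ae {Ω : Type*} [MeasurableSpace Ω] {μ : Measure Ω}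
    [IsFiniteMeasure μ] {A : ℕ → Set Ω} (hA : ∀ n, MeasurableSet (A n))
    (h : ∀ᵐ ω ∂μ, ∀ᶠ n in atTop, ω ∉ A n) : Tendsto (fun n => μ (A n)) atTop (𝓝 0) := by
  have := tendsto_measure_of_ae_tendsto_indicator_of_isFiniteMeasure (μ := μ) (A := ∅) atTop
    MeasurableSet.empty hA (h.mono fun ω hω => hω.mono fun n hn => by simpa using hn)
  rwa [measure_empty] at this

theorem exists_measure_le_le {Ω : Type*} [MeasurableSpace Ω] (μ : Measure Ω) [IsFiniteMeasure μ]
    {f : Ω → ℝ} (hf : Measurable f) {ε : ENNReal} (hε : 0 < ε) :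
    ∃ M : ℕ, μ {ω | (M : ℝ) ≤ f ω} ≤ ε := by
  have h := tendsto_measure_zero_of_ae (μ := μ) (A := fun n : ℕ => {ω | (n : ℝ) ≤ f ω})
    (fun n => measurableSet_le measurable_const hf) (Eventually.of_forall fun ω => by
      filter_upwards [tendsto_natCast_atTop_atTop.eventually_gt_atTop (f ω)] with n hn
      simpa using hn)
  exact (h.eventually_le_const hε).exists

theorem tendsto_measure_thin_le {lh la : ℝ} (hlh : 0 < lh) (Δ c : ℝ) :
    Tendsto (fun n : ℕ => arrivalLaw lh la {ω | thin Δ ω.1 n ≤ c}) atTop (𝓝 0) := by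
  have hm : ∀ n : ℕ, Measurable fun ω : Arrivals => thin Δ ω.1 n := fun n =>
    ((measurable_pi_apply n).comp (measurable_thin Δ)).comp measurable_fst
  refine tendsto_measure_zero_of_ae (fun n => measurableSet_le (hm n) measurable_const) ?_
  filter_upwards [ae_arrivalLaw_fst (ae_regular_poissonArrivals hlh)] with ω h1
  filter_upwards [(h1.thinned Δ).tendsto.eventually_gt_atTop c] with n hn
  simpa using hn

/-- Aim so late that the honest chain has buried a block to depth `k`, then race at an index `n` so
large that its thinned honest arrival comes after the aimed time plus Δ. Each requirement fails with
probability at most `q / 4`, and the race is won with probability at least `q`. Security at level `q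
/ 4` would thus give `q ≤ 3 q / 4`. -/
theorem not_secureAgainst_privateAttack {lh la Δ Δa : ℝ} (hlh : 0 < lh) (hla : 0 < la) (hΔ : 0 ≤ Δ)
    (hΔa : 0 ≤ Δa) (h : lamGrowth lh Δ ≤ lamEff la Δa) :
    ¬ SecureAgainst lh la Δ Δa (PrivateAttack Δ Δa) := by
  intro hsec
  obtain ⟨q, hq0, hq⟩ := eventually_le_measure_thin_lt hlh hla hΔ hΔa h
  have hq1 : q ≤ 1 := by
    obtain ⟨n, hn⟩ := hq.exists
    exact hn.trans prob_le_one
  have hqt : q ≠ ⊤ := ne_top_of_le_ne_top ENNReal.one_ne_top hq1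
  have hq4 : 0 < q / 4 := ENNReal.div_pos hq0.ne' (by simp)
  have hq4t : q / 4 ≠ ⊤ := ENNReal.div_ne_top hqt (by simp)
  obtain ⟨k, T, hkT⟩ := hsec (q / 4).toReal (ENNReal.toReal_pos hq4.ne' hq4t)
  rw [ENNReal.ofReal_toReal hq4t] at hkT
  have hmk : Measurable fun ω : Arrivals => thin Δ ω.1 k + Δ :=
    (((measurable_pi_apply k).comp (measurable_thin Δ)).comp measurable_fst).add_const Δ
  obtain ⟨M, hM⟩ := exists_measure_le_le (arrivalLaw lh la) hmk hq4
  have hs := (hkT (max (M : ℝ) 0) (le_max_right _ _)).1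
  obtain ⟨n, hn1, hn2⟩ := (hq.and
    ((tendsto_measure_thin_le (la := la) hlh Δ (max (M : ℝ) 0 + Δ)).eventually_le_const hq4)).exists
  have hsub : ∀ᵐ ω ∂arrivalLaw lh la, ω ∈ {ω : Arrivals | thin Δa ω.2 n < thin Δ ω.1 n} →
      ω ∈ ({ω | ∃ x ∈ PrivateAttack Δ Δa (max (M : ℝ) 0) ω, Admissible Δ Δa ω x ∧
        PersistenceFails Δ k (max (M : ℝ) 0) x} ∪ {ω : Arrivals | (M : ℝ) ≤ thin Δ ω.1 k + Δ}) ∪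
        {ω : Arrivals | thin Δ ω.1 n ≤ max (M : ℝ) 0 + Δ} := by
    filter_upwards [ae_arrivalLaw_fst (ae_regular_poissonArrivals hlh),
      ae_arrivalLaw_snd (ae_regular_poissonArrivals hla),
      ae_arrivalLaw_fst (ae_thin_gap_lt hlh hΔ)] with ω h1 h2 hg hω
    by_cases hb1 : (M : ℝ) ≤ thin Δ ω.1 k + Δ
    · exact Or.inl (Or.inr hb1)
    by_cases hb2 : thin Δ ω.1 n ≤ max (M : ℝ) 0 + Δ
    · exact Or.inr hb2
    obtain ⟨x, hp, hx⟩ := exists_privateAttack (Δa := Δa) hΔ h1 h2 (max (M : ℝ) 0)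
    refine Or.inl (Or.inl ⟨x, hp, hx, hx.persistenceFails_of_private hΔ h1 h2 hg hp ?_
      ⟨n, hω, not_le.1 hb2⟩⟩)
    have := le_max_left (M : ℝ) 0
    linarith [not_le.1 hb1]
  have h3 : q ≤ q / 4 + q / 4 + q / 4 :=
    calc q ≤ _ := hn1
      _ ≤ _ := measure_mono_ae hsub
      _ ≤ _ := measure_union_le _ _
      _ ≤ _ := add_le_add_left (measure_union_le _ _) _
      _ ≤ q / 4 + q / 4 + q / 4 := add_le_add (add_le_add hs hM) hn2
  have h4 : q.toReal ≤ (q / 4 + q / 4 + q / 4).toReal :=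
    ENNReal.toReal_mono (by simp [hq4t]) h3
  have h5 : 0 < q.toReal := ENNReal.toReal_pos hq0.ne' hqt
  rw [ENNReal.toReal_add (by simp [hq4t]) hq4t, ENNReal.toReal_add hq4t hq4t,
    ENNReal.toReal_div] at h4
  simp only [ENNReal.toReal_ofNat] at h4
  linarith

/-! ### Cut points of random walks with positive drift -/

section

variable {S : Type*} [MeasurableSpace S] {ν : Measure S} [IsProbabilityMeasure ν]

/-- The sequence `x` from index `m` on. -/
def shiftSeq (m : ℕ) (x : ℕ → S) : ℕ → S := fun n => x (m + n)

theorem measurable_shiftSeq (m : ℕ) : Measurable (shiftSeq m : (ℕ → S) → ℕ → S) := by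
  unfold shiftSeq; fun_prop

/-- An event that depends on the first `m` terms only is independent of every event of the later
terms. The proof conditions on one term at a time. -/
theorem infinitePi_inter_shiftSeq (m : ℕ) : ∀ A B : Set (ℕ → S), MeasurableSet A →
    MeasurableSet B → (∀ x y : ℕ → S, (∀ i < m, x i = y i) → x ∈ A → y ∈ A) →
    Measure.infinitePi (fun _ : ℕ => ν) (A ∩ shiftSeq m ⁻¹' B) =
      Measure.infinitePi (fun _ : ℕ => ν) A * Measure.infinitePi (fun _ : ℕ => ν) B := by
  set P := Measure.infinitePi (fun _ : ℕ => ν)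
  let cons : S × (ℕ → S) → ℕ → S := fun p n => Nat.casesOn (motive := fun _ => S) n p.1 p.2
  have hc : Measurable cons := by
    refine measurable_pi_lambda _ fun n => ?_
    cases n with
    | zero => exact measurable_fst
    | succ n => exact (measurable_pi_apply n).comp measurable_snd
  have hP : (ν.prod P).map cons = P := by
    rw [← map_head_shift_infinitePi, Measure.map_map hc (by fun_prop)]
    convert Measure.map_id using 2
    funext x n
    cases n <;> rfl
  induction m with
  | zero =>
    intro A B hA hB hdep
    have hid : (shiftSeq 0 ⁻¹' B : Set (ℕ → S)) = B := by
      have : (shiftSeq 0 : (ℕ → S) → ℕ → S) = id := by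
        funext x n; simp [shiftSeq]
      rw [this, Set.preimage_id]
    rw [hid]
    rcases A.eq_empty_or_nonempty with rfl | ⟨x, hx⟩
    · simp
    · have : A = Set.univ := Set.eq_univ_of_forall fun y => hdep x y (fun i hi => absurd hi (by omega)) hx
      rw [this]
      simp
  | succ m ih =>
    intro A B hA hB hdep
    have hAB := hA.inter (measurable_shiftSeq (m + 1) hB)
    nth_rw 1 [← hP]
    nth_rw 2 [← hP]
    rw [Measure.map_apply hc hAB, Measure.map_apply hc hA, Measure.prod_apply (hc hAB),
      Measure.prod_apply (hc hA), ← lintegral_mul_const _ (measurable_measure_prodMk_left (hc hA))]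
    refine lintegral_congr fun s => ?_
    have hs : Measurable fun y : ℕ → S => cons (s, y) := hc.comp (measurable_const.prodMk measurable_id)
    have := ih ((fun y => cons (s, y)) ⁻¹' A) B (hs hA) hB (fun x y hxy hx => by
      refine hdep _ _ (fun i hi => ?_) hx
      cases i with
      | zero => rfl
      | succ i => exact hxy i (by omega))
    refine Eq.trans ?_ this
    congr 1
    ext y
    simp only [Set.mem_preimage, Set.mem_inter_iff]
    refine and_congr Iff.rfl ?_
    have : shiftSeq (m + 1) (cons (s, y)) = shiftSeq m y := by
      funext n
      simp only [shiftSeq]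
      rw [show m + 1 + n = (m + n) + 1 by ring]
    rw [this]

theorem infinitePi_preimage_shiftSeq (m : ℕ) {B : Set (ℕ → S)} (hB : MeasurableSet B) :
    Measure.infinitePi (fun _ : ℕ => ν) (shiftSeq m ⁻¹' B) =
      Measure.infinitePi (fun _ : ℕ => ν) B := by
  have := infinitePi_inter_shiftSeq (ν := ν) m Set.univ B MeasurableSet.univ hB
    (fun _ _ _ _ => trivial)
  simpa using this

/-- The sequence `x` with its first `N` terms in reversed order. -/
def reverseSeq (N : ℕ) (x : ℕ → S) : ℕ → S := fun i => x (if i < N then N - 1 - i else i)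

/-- A permutation of coordinates preserves the product law. The losses of the walk before a cut are
dips of the reversed walk, so estimates for the forward walk apply to both sides. -/
theorem infinitePi_preimage_reverseSeq (N : ℕ) {B : Set (ℕ → S)} (hB : MeasurableSet B) :
    Measure.infinitePi (fun _ : ℕ => ν) (reverseSeq N ⁻¹' B) =
      Measure.infinitePi (fun _ : ℕ => ν) B := by
  have hinj : Function.Injective fun i : ℕ => if i < N then N - 1 - i else i := by
    intro i j hij
    simp only at hij
    split_ifs at hij <;> omega
  have h := Measure.map_infinitePi_infinitePi_of_inj (P := fun _ : ℕ => ν) hinj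
  have hm : Measurable (reverseSeq N : (ℕ → S) → ℕ → S) := by unfold reverseSeq; fun_prop
  rw [← Measure.map_apply hm hB]
  congr 1

omit [MeasurableSpace S] in
theorem sum_Ico_eq_sum_reverseSeq (X : S → ℝ) {N n : ℕ} (hn : n ≤ N) (x : ℕ → S) :
    ∑ i ∈ Finset.Ico n N, X (x i) = ∑ i ∈ Finset.range (N - n), X (reverseSeq N x i) := by
  have h1 : ∑ i ∈ Finset.range (N - n), X (reverseSeq N x i) =
      ∑ i ∈ Finset.range (N - n), (fun k => X (x (n + k))) (N - n - 1 - i) := by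
    refine Finset.sum_congr rfl fun i hi => ?_
    have := Finset.mem_range.1 hi
    simp only [reverseSeq]
    rw [if_pos (by omega)]
    congr 2
    omega
  rw [h1, Finset.sum_range_reflect (fun k => X (x (n + k))) (N - n), Finset.sum_Ico_eq_sum_range]

/-- `q` is the centre of `2 * K + 1` terms in `L`, and neither before nor after them does the walk
with the steps `X` lose more than `M`. -/
def IsCut (X : S → ℝ) (L : Set S) (K : ℕ) (M : ℝ) (x : ℕ → S) (q : ℕ) : Prop :=
  (∀ r, q ≤ r + K → r ≤ q + K → x r ∈ L) ∧
    (∀ n, n + K ≤ q → -M ≤ ∑ r ∈ Finset.Ico n (q - K), X (x r)) ∧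
    ∀ n, -M ≤ ∑ r ∈ Finset.Ico (q + K + 1) n, X (x r)

theorem measurableSet_lt_sum {X : S → ℝ} (hX : Measurable X) (n : ℕ) (M : ℝ) :
    MeasurableSet {x : ℕ → S | ∑ i ∈ Finset.range n, X (x i) < M} :=
  measurableSet_lt (Finset.measurable_fun_sum _ fun i _ => hX.comp (measurable_pi_apply i))
    measurable_const

/-- The walk that starts at `0` falls below `-M` at some time after `l`. -/
def lateDip (X : S → ℝ) (M : ℝ) (l : ℕ) : Set (ℕ → S) :=
  {x | ∃ n > l, ∑ i ∈ Finset.range n, X (x i) < -M}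

theorem measurableSet_lateDip {X : S → ℝ} (hX : Measurable X) (M : ℝ) (l : ℕ) :
    MeasurableSet (lateDip X M l) := by
  have : lateDip X M l = ⋃ n, ⋃ (_ : n > l), {x | ∑ i ∈ Finset.range n, X (x i) < -M} := by
    ext; simp [lateDip]
  rw [this]
  exact MeasurableSet.iUnion fun n => MeasurableSet.iUnion fun _ => measurableSet_lt_sum hX n _

theorem ae_tendsto_sum_atTop {X : S → ℝ} (hX : Measurable X) (hi : Integrable X ν)
    (hm : 0 < ∫ s, X s ∂ν) :
    ∀ᵐ x ∂Measure.infinitePi (fun _ : ℕ => ν),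
      Tendsto (fun n : ℕ => ∑ i ∈ Finset.range n, X (x i)) atTop atTop := by
  filter_upwards [ae_tendsto_sum_infinitePi hX hi] with x hx
  have := hx.pos_mul_atTop hm tendsto_natCast_atTop_atTop
  refine this.congr' ?_
  filter_upwards [eventually_gt_atTop 0] with n hn
  have : (n : ℝ) ≠ 0 := by positivity
  field_simp

theorem tendsto_measure_lateDip {X : S → ℝ} (hX : Measurable X) (hi : Integrable X ν)
    (hm : 0 < ∫ s, X s ∂ν) (M : ℝ) :
    Tendsto (fun l => Measure.infinitePi (fun _ : ℕ => ν) (lateDip X M l)) atTop (𝓝 0) := by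
  refine tendsto_measure_zero_of_ae (fun l => measurableSet_lateDip hX M l) ?_
  filter_upwards [ae_tendsto_sum_atTop hX hi hm] with x hx
  obtain ⟨N, hN⟩ := eventually_atTop.1 (hx.eventually_ge_atTop (-M))
  filter_upwards [eventually_ge_atTop N] with l hl
  rintro ⟨n, hn, hlt⟩
  have := hN n (by omega)
  linarith

/-- The walk tends to infinity, so it is almost surely bounded below. The bound 1 / 2 is an
arbitrary constant below 1. -/
theorem exists_measure_dip_le {X : S → ℝ} (hX : Measurable X) (hi : Integrable X ν)
    (hm : 0 < ∫ s, X s ∂ν) : ∃ M : ℕ, Measure.infinitePi (fun _ : ℕ => ν)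
      {x | ∃ n, ∑ i ∈ Finset.range n, X (x i) < -(M : ℝ)} ≤ 1 / 2 := by
  have h := tendsto_measure_zero_of_ae (μ := Measure.infinitePi (fun _ : ℕ => ν))
    (A := fun M : ℕ => {x | ∃ n, ∑ i ∈ Finset.range n, X (x i) < -(M : ℝ)})
    (fun M => by
      simp only [Set.ofPred_exists]
      exact MeasurableSet.iUnion fun n => measurableSet_lt_sum hX n _)
    (by
      filter_upwards [ae_tendsto_sum_atTop hX hi hm] with x hx
      obtain ⟨b, hb⟩ := bddBelow_range_of_tendsto_atTop_atTop hx
      obtain ⟨N, hN⟩ := exists_nat_ge (-b)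
      filter_upwards [eventually_ge_atTop N] with M hM
      rintro ⟨n, hn⟩
      have h1 := hb (Set.mem_range_self n)
      have h2 : (N : ℝ) ≤ M := by exact_mod_cast hM
      linarith)
  exact (h.eventually_le_const (by simp)).exists

/-- The part of the event that there is a cut at `l + K` that concerns the first
`2 * l + 2 * K + 1` terms. -/
def localCut (X : S → ℝ) (L : Set S) (K : ℕ) (M : ℝ) (l : ℕ) : Set (ℕ → S) :=
  {x | ∀ n ≤ l, ¬ ∑ i ∈ Finset.range n, X (reverseSeq l x i) < -M} ∩
    shiftSeq l ⁻¹' ({x | ∀ i < 2 * K + 1, x i ∈ L} ∩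
      shiftSeq (2 * K + 1) ⁻¹' {x | ∀ n ≤ l, ¬ ∑ i ∈ Finset.range n, X (x i) < -M})

theorem measurableSet_noDip {X : S → ℝ} (hX : Measurable X) (M : ℝ) (l : ℕ) :
    MeasurableSet {x : ℕ → S | ∀ n ≤ l, ¬ ∑ i ∈ Finset.range n, X (x i) < -M} := by
  have : {x : ℕ → S | ∀ n ≤ l, ¬ ∑ i ∈ Finset.range n, X (x i) < -M} =
      ⋂ n, ⋂ (_ : n ≤ l), {x | ∑ i ∈ Finset.range n, X (x i) < -M}ᶜ := by
    ext; simp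
  rw [this]
  exact MeasurableSet.iInter fun n => MeasurableSet.iInter fun _ => (measurableSet_lt_sum hX n _).compl

theorem measurableSet_forall_lt_mem {L : Set S} (hL : MeasurableSet L) (K : ℕ) :
    MeasurableSet {x : ℕ → S | ∀ i < K, x i ∈ L} := by
  have : {x : ℕ → S | ∀ i < K, x i ∈ L} = ⋂ i, ⋂ (_ : i < K), (fun x => x i) ⁻¹' L := by
    ext; simp
  rw [this]
  exact MeasurableSet.iInter fun i => MeasurableSet.iInter fun _ => measurable_pi_apply i hL

theorem measurable_reverseSeq (N : ℕ) : Measurable (reverseSeq N : (ℕ → S) → ℕ → S) := by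
  unfold reverseSeq; fun_prop

theorem measurableSet_localCut {X : S → ℝ} (hX : Measurable X) {L : Set S} (hL : MeasurableSet L)
    (K : ℕ) (M : ℝ) (l : ℕ) : MeasurableSet (localCut X L K M l) :=
  ((measurable_reverseSeq l) (measurableSet_noDip hX M l)).inter (measurable_shiftSeq l
    ((measurableSet_forall_lt_mem hL _).inter (measurable_shiftSeq _ (measurableSet_noDip hX M l))))

/-- The left part, the run in `L` and the right part concern disjoint blocks of coordinates, hence
are independent; reversal gives both outer parts the same probability. -/
theorem measure_localCut {X : S → ℝ} (hX : Measurable X) {L : Set S} (hL : MeasurableSet L)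
    (K : ℕ) (M : ℝ) (l : ℕ) :
    Measure.infinitePi (fun _ : ℕ => ν) (localCut X L K M l) =
      Measure.infinitePi (fun _ : ℕ => ν)
          {x | ∀ n ≤ l, ¬ ∑ i ∈ Finset.range n, X (x i) < -M} *
        (ν L ^ (2 * K + 1) * Measure.infinitePi (fun _ : ℕ => ν)
          {x | ∀ n ≤ l, ¬ ∑ i ∈ Finset.range n, X (x i) < -M}) := by
  have h1 := infinitePi_preimage_reverseSeq (ν := ν) l (measurableSet_noDip hX M l)
  have h2 := infinitePi_lt (ν := ν) (2 * K + 1) (fun _ => L) (fun _ => hL)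
  rw [Finset.prod_const, Finset.card_range] at h2
  rw [localCut, infinitePi_inter_shiftSeq l
    {x | ∀ n ≤ l, ¬ ∑ i ∈ Finset.range n, X (reverseSeq l x i) < -M} _
    ((measurable_reverseSeq l) (measurableSet_noDip hX M l))
    ((measurableSet_forall_lt_mem hL _).inter (measurable_shiftSeq _ (measurableSet_noDip hX M l))),
    infinitePi_inter_shiftSeq (2 * K + 1) _ _ (measurableSet_forall_lt_mem hL _)
      (measurableSet_noDip hX M l), h2, ← h1]
  · rfl
  · intro x y hxy hx i hi
    rw [← hxy i hi]
    exact hx i hi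
  · intro x y hxy hx n hn
    have : ∑ i ∈ Finset.range n, X (reverseSeq l y i) =
        ∑ i ∈ Finset.range n, X (reverseSeq l x i) := by
      refine Finset.sum_congr rfl fun i hi => ?_
      have := Finset.mem_range.1 hi
      simp only [reverseSeq]
      rw [hxy _ (by split_ifs <;> omega)]
    rw [this]
    exact hx n hn

/-- The event depends on `W` terms only, so its translates by multiples of `W` are independent. -/
theorem measure_forall_notMem_shift {A : Set (ℕ → S)} (hA : MeasurableSet A) {W : ℕ}
    (hdep : ∀ x y : ℕ → S, (∀ i < W, x i = y i) → x ∈ A → y ∈ A) (m : ℕ) :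
    Measure.infinitePi (fun _ : ℕ => ν) {x | ∀ j < m, shiftSeq (j * W) x ∉ A} =
      Measure.infinitePi (fun _ : ℕ => ν) Aᶜ ^ m := by
  induction m with
  | zero => simp
  | succ m ih =>
    have hB : MeasurableSet {x : ℕ → S | ∀ j < m, shiftSeq (j * W) x ∉ A} := by
      have : {x : ℕ → S | ∀ j < m, shiftSeq (j * W) x ∉ A} =
          ⋂ j, ⋂ (_ : j < m), (shiftSeq (j * W) ⁻¹' A)ᶜ := by
        ext; simp
      rw [this]
      exact MeasurableSet.iInter fun j => MeasurableSet.iInter fun _ =>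
        (measurable_shiftSeq _ hA).compl
    have e : {x : ℕ → S | ∀ j < m + 1, shiftSeq (j * W) x ∉ A} =
        Aᶜ ∩ shiftSeq W ⁻¹' {x | ∀ j < m, shiftSeq (j * W) x ∉ A} := by
      ext x
      have hz : shiftSeq (0 * W) x = x := by funext n; simp [shiftSeq]
      have hs : ∀ j, shiftSeq ((j + 1) * W) x = shiftSeq (j * W) (shiftSeq W x) := by
        intro j
        funext n
        simp only [shiftSeq]
        congr 1
        ring
      simp only [Set.mem_ofPred_eq, Set.mem_inter_iff, Set.mem_compl_iff, Set.mem_preimage]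
      constructor
      · intro h
        refine ⟨by have := h 0 (by omega); rwa [hz] at this, fun j hj => ?_⟩
        rw [← hs]
        exact h (j + 1) (by omega)
      · rintro ⟨h0, h1⟩ j hj
        cases j with
        | zero => rwa [hz]
        | succ j => rw [hs]; exact h1 j (by omega)
    rw [e, infinitePi_inter_shiftSeq W _ _ hA.compl hB, ih, pow_succ, mul_comm]
    intro x y hxy hx hy
    exact hx (hdep y x (fun i hi => (hxy i hi).symm) hy)

omit [MeasurableSpace S] in
theorem localCut_dep {X : S → ℝ} {L : Set S} {K : ℕ} {M : ℝ} {l : ℕ} (x y : ℕ → S)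
    (hxy : ∀ i < 2 * l + 2 * K + 1, x i = y i) (hx : x ∈ localCut X L K M l) :
    y ∈ localCut X L K M l := by
  obtain ⟨h1, h2, h3⟩ := hx
  refine ⟨fun n hn => ?_, fun i hi => ?_, fun n hn => ?_⟩
  · have : ∑ i ∈ Finset.range n, X (reverseSeq l y i) =
        ∑ i ∈ Finset.range n, X (reverseSeq l x i) := by
      refine Finset.sum_congr rfl fun i hi => ?_
      have := Finset.mem_range.1 hi
      simp only [reverseSeq]
      rw [hxy _ (by split_ifs <;> omega)]
    rw [this]
    exact h1 n hn
  · simp only [shiftSeq]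
    rw [← hxy _ (by omega)]
    exact h2 i hi
  · have : ∑ i ∈ Finset.range n, X (shiftSeq (2 * K + 1) (shiftSeq l y) i) =
        ∑ i ∈ Finset.range n, X (shiftSeq (2 * K + 1) (shiftSeq l x) i) := by
      refine Finset.sum_congr rfl fun i hi => ?_
      have := Finset.mem_range.1 hi
      simp only [shiftSeq]
      rw [hxy _ (by omega)]
    rw [this]
    exact h3 n hn

omit [MeasurableSpace S] in
/-- A local cut that is not a cut is spoilt by a late dip, of the walk or of the reversed walk. -/
theorem isCut_of_localCut {X : S → ℝ} {L : Set S} {K : ℕ} {M : ℝ} (hM : 0 ≤ M) {l a : ℕ} {x : ℕ → S}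
    (h : shiftSeq a x ∈ localCut X L K M l) (h1 : reverseSeq (a + l) x ∉ lateDip X M l)
    (h2 : shiftSeq (a + l + 2 * K + 1) x ∉ lateDip X M l) : IsCut X L K M x (a + l + K) := by
  obtain ⟨g1, g2, g3⟩ := h
  refine ⟨fun r hr1 hr2 => ?_, fun n hn => ?_, fun n => ?_⟩
  · have := g2 (r - (a + l)) (by omega)
    simp only [shiftSeq] at this
    rwa [show a + (l + (r - (a + l))) = r by omega] at this
  · rw [Nat.add_sub_cancel, sum_Ico_eq_sum_reverseSeq X (by omega : n ≤ a + l)]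
    -- Stretches longer than `l` are covered by the absence of a late dip, shorter ones by the local
    -- cut.
    rcases Nat.lt_or_ge l (a + l - n) with hl | hl
    · by_contra hc
      exact h1 ⟨_, hl, not_le.1 hc⟩
    · have := not_lt.1 (g1 (a + l - n) hl)
      refine this.trans (le_of_eq (Finset.sum_congr rfl fun i hi => ?_))
      have := Finset.mem_range.1 hi
      simp only [reverseSeq, shiftSeq]
      rw [if_pos (by omega), if_pos (by omega)]
      congr 2
      omega
  · rcases Nat.lt_or_ge n (a + l + K + K + 1) with hn | hn
    · rw [Finset.Ico_eq_empty (by omega), Finset.sum_empty]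
      linarith
    · rw [Finset.sum_Ico_eq_sum_range]
      rcases Nat.lt_or_ge l (n - (a + l + K + K + 1)) with hl | hl
      · by_contra hc
        refine h2 ⟨_, hl, ?_⟩
        simp only [shiftSeq]
        rw [show a + l + 2 * K + 1 = a + l + K + K + 1 by ring]
        exact not_le.1 hc
      · have := not_lt.1 (g3 _ hl)
        refine this.trans (le_of_eq (Finset.sum_congr rfl fun i hi => ?_))
        simp only [shiftSeq]
        congr 2
        ring

/-- Every long enough window contains a cut with a high probability, wherever it starts. -/
theorem exists_window_isCut {X : S → ℝ} (hX : Measurable X) (hi : Integrable X ν)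
    (hm : 0 < ∫ s, X s ∂ν) {L : Set S} (hL : MeasurableSet L) (hL0 : 0 < ν L) :
    ∃ M : ℕ, ∀ (K : ℕ) (ε : ENNReal), 0 < ε → ∃ w : ℕ, ∀ a : ℕ,
      Measure.infinitePi (fun _ : ℕ => ν)
        {x | ∀ q, a + K ≤ q → q < a + w → ¬ IsCut X L K M x q} ≤ ε := by
  set P := Measure.infinitePi (fun _ : ℕ => ν)
  obtain ⟨M, hM⟩ := exists_measure_dip_le hX hi hm
  refine ⟨M, fun K ε hε => ?_⟩
  -- A lower bound for the probability of a local cut that does not depend on the reach `l`. Hence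
  -- the number `m` of windows can be fixed first, and `l` chosen afterwards to make the `2 m` late
  -- dips unlikely.
  set p : ENNReal := 1 / 2 * (ν L ^ (2 * K + 1) * (1 / 2)) with hp
  have hp0 : 0 < p := by
    have : 0 < ν L ^ (2 * K + 1) := ENNReal.pow_pos hL0 _
    rw [hp]
    refine ENNReal.mul_pos (by simp) (ENNReal.mul_pos this.ne' (by simp)).ne'
  have hnodip : ∀ l, 1 / 2 ≤ P {x | ∀ n ≤ l, ¬ ∑ i ∈ Finset.range n, X (x i) < -(M : ℝ)} := by
    intro l
    have h1 : P {x | ∀ n ≤ l, ¬ ∑ i ∈ Finset.range n, X (x i) < -(M : ℝ)}ᶜ ≤ 1 / 2 := by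
      refine le_trans (measure_mono fun x hx => ?_) hM
      simp only [Set.mem_compl_iff, Set.mem_ofPred_eq, not_forall, not_not] at hx ⊢
      obtain ⟨n, -, hn⟩ := hx
      exact ⟨n, hn⟩
    have h2 := prob_compl_eq_one_sub (μ := P) (measurableSet_noDip hX (M : ℝ) l).compl
    rw [compl_compl] at h2
    rw [h2]
    calc (1 / 2 : ENNReal) = 1 - 1 / 2 := by simp
      _ ≤ _ := tsub_le_tsub_left h1 1
  have hloc : ∀ l, P (localCut X L K M l)ᶜ ≤ 1 - p := by
    intro l
    rw [prob_compl_eq_one_sub (measurableSet_localCut hX hL K M l)]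
    refine tsub_le_tsub_left ?_ 1
    rw [measure_localCut hX hL, hp]
    gcongr <;> exact hnodip l
  have hlt : 1 - p < 1 := ENNReal.sub_lt_self (by simp) (by simp) hp0.ne'
  have hpow := ENNReal.tendsto_pow_atTop_nhds_zero_of_lt_one hlt
  have hε2 : 0 < ε / 2 := ENNReal.div_pos hε.ne' (by simp)
  obtain ⟨m, hmε⟩ := (hpow.eventually_le_const hε2).exists
  have hlate : Tendsto (fun l => (m : ENNReal) * (2 * P (lateDip X M l))) atTop (𝓝 0) := by
    have h1 := ENNReal.Tendsto.const_mul (a := 2) (tendsto_measure_lateDip (ν := ν) hX hi hm M)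
      (Or.inr (by simp))
    rw [mul_zero] at h1
    have h2 := ENNReal.Tendsto.const_mul (a := (m : ENNReal)) h1 (Or.inr (by simp))
    rwa [mul_zero] at h2
  obtain ⟨l, hl⟩ := (hlate.eventually_le_const hε2).exists
  set W := 2 * l + 2 * K + 1 with hW
  refine ⟨m * W, fun a => ?_⟩
  -- Without a cut, either none of the `m` disjoint windows has a local cut, or some window meets a
  -- late dip in one of the two directions.
  have hsub : {x : ℕ → S | ∀ q, a + K ≤ q → q < a + m * W → ¬ IsCut X L K M x q} ⊆
      shiftSeq a ⁻¹' {x | ∀ j < m, shiftSeq (j * W) x ∉ localCut X L K M l} ∪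
        ⋃ j ∈ Finset.range m, (reverseSeq (a + j * W + l) ⁻¹' lateDip X M l ∪
          shiftSeq (a + j * W + l + 2 * K + 1) ⁻¹' lateDip X M l) := by
    intro x hx
    by_contra hc
    simp only [Set.mem_union, not_or, Set.mem_iUnion, not_exists, Finset.mem_range,
      Set.mem_preimage, Set.mem_ofPred_eq, not_forall, not_not] at hc
    obtain ⟨⟨j, hj, hcut⟩, hdip⟩ := hc
    have hs : shiftSeq (j * W) (shiftSeq a x) = shiftSeq (a + j * W) x := by
      funext n
      simp only [shiftSeq]
      congr 1
      ring
    rw [hs] at hcut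
    have h1 := isCut_of_localCut (Nat.cast_nonneg M) hcut (hdip j hj).1 (hdip j hj).2
    have h2 : (j + 1) * W ≤ m * W := Nat.mul_le_mul_right W hj
    rw [add_mul, one_mul] at h2
    exact hx _ (by omega) (by omega) h1
  calc P {x | ∀ q, a + K ≤ q → q < a + m * W → ¬ IsCut X L K M x q} ≤ _ := measure_mono hsub
    _ ≤ _ := measure_union_le _ _
    _ ≤ ε / 2 + ε / 2 := by
      refine add_le_add ?_ ?_
      · have hdep : ∀ x y : ℕ → S, (∀ i < W, x i = y i) → x ∈ localCut X L K (M : ℝ) l →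
            y ∈ localCut X L K (M : ℝ) l := fun x y h => localCut_dep x y h
        have hA := measurableSet_localCut hX hL K (M : ℝ) l
        rw [infinitePi_preimage_shiftSeq, measure_forall_notMem_shift hA hdep]
        · exact (pow_le_pow_left' (hloc l) m).trans hmε
        · have : {x : ℕ → S | ∀ j < m, shiftSeq (j * W) x ∉ localCut X L K (M : ℝ) l} =
              ⋂ j, ⋂ (_ : j < m), (shiftSeq (j * W) ⁻¹' localCut X L K (M : ℝ) l)ᶜ := by
            ext; simp
          rw [this]
          exact MeasurableSet.iInter fun j => MeasurableSet.iInter fun _ =>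
            (measurable_shiftSeq _ hA).compl
      · refine le_trans (measure_biUnion_finset_le _ _) ?_
        refine le_trans (Finset.sum_le_card_nsmul _ _ (2 * P (lateDip X M l)) fun j _ => ?_) ?_
        · refine (measure_union_le _ _).trans ?_
          rw [infinitePi_preimage_reverseSeq _ (measurableSet_lateDip hX _ l),
            infinitePi_preimage_shiftSeq _ (measurableSet_lateDip hX _ l), two_mul]
        · rw [Finset.card_range, nsmul_eq_mul]
          exact hl
    _ = ε := ENNReal.add_halves ε

end

/-! ### Cells of time -/

/-- The arrivals before time `t`, followed by dummy arrivals after it. -/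
noncomputable def arrivalCut (t : ℝ) (T : ℕ → ℝ) : ℕ → ℝ :=
  fun n => if T n < t then T n else t + n + 1

/-- The arrivals in the cell `[q * κ, (q + 1) * κ)` of time, timed from its beginning and followed by
dummy arrivals after its end. -/
noncomputable def cell (κ : ℝ) (q : ℕ) (T : ℕ → ℝ) : ℕ → ℝ := arrivalCut κ (arrivalAfter (q * κ) T)

theorem measurable_arrivalCut (t : ℝ) : Measurable (arrivalCut t) := by
  refine measurable_pi_lambda _ fun n => ?_
  exact Measurable.ite (measurableSet_lt (measurable_pi_apply n) measurable_const)
    (measurable_pi_apply n) measurable_const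

theorem measurable_cell (κ : ℝ) (q : ℕ) : Measurable (cell κ q) :=
  (measurable_arrivalCut κ).comp (measurable_arrivalAfter _)

theorem arrivalCut_past (t : ℝ) (T : ℕ → ℝ) : arrivalCut t (arrivalPast t T) = arrivalCut t T := by
  funext n
  simp only [arrivalCut, arrivalPast, min_lt_iff, lt_irrefl, or_false]
  split_ifs with h
  · exact min_eq_left h.le
  · rfl

section

variable {T : ℕ → ℝ}

theorem RegularArrivals.arrivalCount_mono (h : RegularArrivals T) {s t : ℝ} (hst : s ≤ t) :
    arrivalCount T s ≤ arrivalCount T t :=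
  h.arrivalCount_le.2 (hst.trans (h.arrivalCount_le.1 le_rfl))

theorem RegularArrivals.le_arrivalCount (h : RegularArrivals T) (t : ℝ) :
    t ≤ T (arrivalCount T t) := h.arrivalCount_le.1 le_rfl

theorem RegularArrivals.arrivalCount_after (h : RegularArrivals T) (t : ℝ) {κ : ℝ} (hκ : 0 ≤ κ) :
    arrivalCount (arrivalAfter t T) κ = arrivalCount T (t + κ) - arrivalCount T t := by
  have hle : arrivalCount T t ≤ arrivalCount T (t + κ) := h.arrivalCount_mono (by linarith)
  have e : arrivalCount T t + (arrivalCount T (t + κ) - arrivalCount T t) =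
      arrivalCount T (t + κ) := by omega
  have h1 := h.le_arrivalCount (t + κ)
  refine (arrivalCount_eq_iff ⟨arrivalCount T (t + κ) - arrivalCount T t, ?_⟩).2
    ⟨fun k hk => ?_, ?_⟩
  · simp only [arrivalAfter, e]; linarith
  · have : T (arrivalCount T t + k) < t + κ := h.lt_arrivalCount.1 (by omega)
    simp only [arrivalAfter]; linarith
  · simp only [arrivalAfter, e]; linarith

theorem RegularArrivals.arrivalAfter_after (h : RegularArrivals T) (t : ℝ) {κ : ℝ} (hκ : 0 ≤ κ) :
    arrivalAfter κ (arrivalAfter t T) = arrivalAfter (t + κ) T := by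
  have hle : arrivalCount T t ≤ arrivalCount T (t + κ) := h.arrivalCount_mono (by linarith)
  funext n
  have hc := h.arrivalCount_after t hκ
  simp only [arrivalAfter] at hc ⊢
  rw [hc, ← add_assoc, Nat.add_sub_cancel' hle]
  ring

theorem RegularArrivals.arrivalAfter_zero (h : RegularArrivals T) : arrivalAfter 0 T = T := by
  have : arrivalCount T 0 = 0 := Nat.le_zero.1 (h.arrivalCount_le.2 h.pos.le)
  funext n
  simp [arrivalAfter, this]

theorem RegularArrivals.iterate_arrivalAfter (h : RegularArrivals T) {κ : ℝ} (hκ : 0 ≤ κ) (q : ℕ) :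
    (arrivalAfter κ)^[q] T = arrivalAfter (q * κ) T := by
  induction q with
  | zero => simp [h.arrivalAfter_zero]
  | succ q ih =>
    rw [Function.iterate_succ_apply', ih, h.arrivalAfter_after _ hκ]
    congr 1
    push_cast
    ring

theorem cell_apply (κ : ℝ) (q n : ℕ) :
    cell κ q T n = if T (arrivalCount T (q * κ) + n) < (q + 1) * κ then
      T (arrivalCount T (q * κ) + n) - q * κ else κ + n + 1 := by
  simp only [cell, arrivalCut, arrivalAfter]
  refine if_congr ?_ rfl rfl
  constructor <;> intro <;> linarith

theorem RegularArrivals.cut (h : RegularArrivals T) {t : ℝ} (ht : 0 ≤ t) :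
    RegularArrivals (arrivalCut t T) where
  pos := by
    simp only [arrivalCut]
    split_ifs
    · exact h.pos
    · positivity
  strictMono := by
    refine strictMono_nat_of_lt_succ fun n => ?_
    have h1 := h.strictMono (Nat.lt_succ_self n)
    simp only [Nat.succ_eq_add_one] at h1
    simp only [arrivalCut]
    split_ifs
    · exact h1
    · push_cast; linarith
    · linarith
    · push_cast; linarith
  tendsto := by
    refine tendsto_atTop.2 fun b => ?_
    have h1 : Tendsto (fun n : ℕ => t + (n : ℝ) + 1) atTop atTop :=
      tendsto_atTop_add_const_right _ _ (tendsto_atTop_add_const_left _ _ tendsto_natCast_atTop_atTop)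
    filter_upwards [h1.eventually_ge_atTop b, h.tendsto.eventually_ge_atTop b] with n h3 h4
    simp only [arrivalCut]
    split_ifs
    · exact h4
    · exact h3

theorem eq_of_cell_lt {κ : ℝ} {q n : ℕ} (h : cell κ q T n < κ) :
    T (arrivalCount T (q * κ) + n) = q * κ + cell κ q T n := by
  rw [cell_apply] at h ⊢
  split_ifs at h ⊢
  · ring
  · linarith [(Nat.cast_nonneg n : (0 : ℝ) ≤ n)]

theorem RegularArrivals.exists_cell_eq (h : RegularArrivals T) {κ : ℝ} {q j : ℕ}
    (h1 : q * κ ≤ T j) (h2 : T j < (q + 1) * κ) :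
    ∃ n, j = arrivalCount T (q * κ) + n ∧ cell κ q T n = T j - q * κ := by
  have := h.arrivalCount_le.2 h1
  refine ⟨j - arrivalCount T (q * κ), by omega, ?_⟩
  rw [cell_apply, Nat.add_sub_cancel' this, if_pos h2]

/-- The thinned process meets a cell in at most one point more than the thinned cell. -/
theorem RegularArrivals.arrivalCount_thin_succ_le (h : RegularArrivals T) {κ d d' : ℝ} (hd : d ≤ d')
    {q : ℕ} (hz : RegularArrivals (cell κ q T)) :
    arrivalCount (thin d' T) ((q + 1) * κ) ≤
      arrivalCount (thin d' T) (q * κ) + (arrivalCount (thin d' (cell κ q T)) (κ - d) + 1) := by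
  set a := arrivalCount (thin d' T) (q * κ)
  have ha : q * κ ≤ thin d' T a := (h.thinned d').le_arrivalCount _
  -- Thinning the cell alone ignores the dead time inherited from before, so its selection is never
  -- behind that of the whole process.
  have key : ∀ k, thin d' T (a + k) < (q + 1) * κ →
      thin d' (cell κ q T) k ≤ thin d' T (a + k) - q * κ := by
    intro k
    induction k with
    | zero =>
      intro hk
      obtain ⟨n, -, hn⟩ := h.exists_cell_eq (κ := κ) (q := q) (j := thinIdx d' T a) ha hk
      change _ ≤ T (thinIdx d' T a) - q * κ
      rw [← hn]
      exact hz.thin_zero_le n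
    | succ k ih =>
      intro hk
      have hlt : thin d' T (a + k) < thin d' T (a + (k + 1)) :=
        (h.thinned d').strictMono (by omega)
      have h1 := ih (hlt.trans hk)
      have h2 := h.thin_gap d' (a + k)
      have h3 := (h.thinned d').strictMono.monotone (by omega : a ≤ a + (k + 1))
      obtain ⟨n, -, hn⟩ := h.exists_cell_eq (κ := κ) (q := q) (j := thinIdx d' T (a + (k + 1)))
        (ha.trans h3) hk
      change _ ≤ T (thinIdx d' T (a + (k + 1))) - q * κ
      have e1 : T (thinIdx d' T (a + (k + 1))) = thin d' T (a + (k + 1)) := rfl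
      rw [← hn]
      rw [add_assoc] at h2
      exact hz.thin_succ_le (by linarith) (by linarith)
  set g := arrivalCount (thin d' (cell κ q T)) (κ - d)
  rw [(h.thinned d').arrivalCount_le]
  by_contra hc
  have hc' : thin d' T (a + (g + 1)) < (q + 1) * κ := not_le.1 hc
  -- One more point of the whole process in the cell would put the point `a + g` at least `d' ≥ d`
  -- before the end of the cell, hence among those already counted.
  have h2 := h.thin_gap d' (a + g)
  rw [add_assoc] at h2
  have h1 := key g ((h.thinned d').strictMono (by omega : a + g < a + (g + 1)) |>.trans hc')
  have h3 := (hz.thinned d').le_arrivalCount (κ - d)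
  linarith

/-- The thinned process meets a cell in at most one point less than the thinned cell. -/
theorem RegularArrivals.le_arrivalCount_thin_succ (h : RegularArrivals T) {κ d : ℝ} (hκ : 0 ≤ κ)
    {q : ℕ} (hz : RegularArrivals (cell κ q T)) :
    arrivalCount (thin d T) (q * κ) + arrivalCount (thin d (cell κ q T)) κ ≤
      arrivalCount (thin d T) ((q + 1) * κ) + 1 := by
  set a := arrivalCount (thin d T) (q * κ) with hadef
  set g := arrivalCount (thin d (cell κ q T)) κ
  have hmono : a ≤ arrivalCount (thin d T) ((q + 1) * κ) :=
    (h.thinned d).arrivalCount_mono (by linarith)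
  rcases Nat.lt_or_ge g 2 with hg | hg
  · omega
  have hlt : ∀ k < g, thin d (cell κ q T) k < κ := fun k hk => (hz.thinned d).lt_arrivalCount.1 hk
  have hval : ∀ k < g, T (arrivalCount T (q * κ) + thinIdx d (cell κ q T) k) =
      q * κ + thin d (cell κ q T) k := fun k hk => eq_of_cell_lt (hlt k hk)
  -- The dead time inherited from before the cell can suppress the first point of the thinned cell,
  -- but not the second, which comes more than `d` after the start of the cell. This costs one
  -- index.
  have key : ∀ k, k + 1 < g → thin d T (a + k) ≤ q * κ + thin d (cell κ q T) (k + 1) := by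
    intro k
    induction k with
    | zero =>
      intro hk
      have e := hval 1 (by omega)
      have h1 := hz.thin_gap d 0
      have h2 : 0 < thin d (cell κ q T) 0 := (hz.thinned d).pos
      have h3 := (hz.thinned d).strictMono (by omega : 0 < 1)
      simp only [zero_add, add_zero] at h1 ⊢
      rw [← e]
      rcases Nat.eq_zero_or_pos a with h0 | h0
      · rw [h0]; exact h.thin_zero_le _
      · have h4 : thin d T (a - 1) < q * κ := (h.thinned d).lt_arrivalCount.1 (by omega)
        have := h.thin_succ_le (d := d) (n := a - 1)
          (j := arrivalCount T (q * κ) + thinIdx d (cell κ q T) 1) (by linarith) (by linarith)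
        rwa [Nat.sub_add_cancel h0] at this
    | succ k ih =>
      intro hk
      have e := hval (k + 2) (by omega)
      have h1 := hz.thin_gap d (k + 1)
      have h3 := (hz.thinned d).strictMono (by omega : k + 1 < k + 1 + 1)
      have h4 := ih (by omega)
      rw [← e, ← add_assoc]
      exact h.thin_succ_le (by linarith) (by linarith)
  have h1 := key (g - 2) (by omega)
  rw [show g - 2 + 1 = g - 1 by omega] at h1
  have h2 := hlt (g - 1) (by omega)
  have : a + (g - 2) < arrivalCount (thin d T) ((q + 1) * κ) :=
    (h.thinned d).lt_arrivalCount.2 (by linarith)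
  omega

end

/-! ### Growth of honest and adversarial chains cell by cell -/

section

variable {Δ Δa : ℝ} {ω : Arrivals} {x : Play}

/-- Arrivals before `κ - Δ` have reached every node by the end of the cell, so the bound `m` on all
tips can be passed on to the next cell. Spacing by `d > Δ` makes delivery strict in every cell
without an exceptional null set. -/
theorem Admissible.height_tip_cell_succ (hx : Admissible Δ Δa ω x) (h1 : RegularArrivals ω.1)
    (h2 : RegularArrivals ω.2) {κ d : ℝ} (hd : Δ < d) {q : ℕ}
    (hz : RegularArrivals (cell κ q ω.1)) (hΔ : 0 ≤ Δ) (hκ : 0 ≤ κ) {m : ℕ}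
    (hm : ∀ p t, q * κ ≤ t → m ≤ x.height (x.tip p t)) (p : ℕ) {t : ℝ} (ht : (q + 1) * κ ≤ t) :
    m + arrivalCount (thin d (cell κ q ω.1)) (κ - Δ) ≤ x.height (x.tip p t) := by
  set g := arrivalCount (thin d (cell κ q ω.1)) (κ - Δ)
  have hlt : ∀ k < g, thin d (cell κ q ω.1) k < κ - Δ := fun k hk =>
    (hz.thinned d).lt_arrivalCount.1 hk
  have hval : ∀ k < g, ω.1 (arrivalCount ω.1 (q * κ) + thinIdx d (cell κ q ω.1) k) =
      q * κ + thin d (cell κ q ω.1) k := fun k hk =>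
    eq_of_cell_lt (lt_of_lt_of_le (hlt k hk) (by linarith))
  have key : ∀ k < g, m + k <
      x.height (.honest (arrivalCount ω.1 (q * κ) + thinIdx d (cell κ q ω.1) k)) := by
    intro k
    induction k with
    | zero =>
      intro hk
      rw [hx.height_honest h1 h2]
      have h3 : 0 < thin d (cell κ q ω.1) 0 := (hz.thinned d).pos
      have := hm (arrivalCount ω.1 (q * κ) + thinIdx d (cell κ q ω.1) 0) _
        (show q * κ ≤ ω.1 (arrivalCount ω.1 (q * κ) + thinIdx d (cell κ q ω.1) 0) by
          rw [hval 0 hk]; linarith)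
      omega
    | succ k ih =>
      intro hk
      rw [hx.height_honest h1 h2]
      have := ih (by omega)
      have h4 := hx.height_honest_le_tip
        (p := arrivalCount ω.1 (q * κ) + thinIdx d (cell κ q ω.1) (k + 1))
        (i := arrivalCount ω.1 (q * κ) + thinIdx d (cell κ q ω.1) k)
        (t := ω.1 (arrivalCount ω.1 (q * κ) + thinIdx d (cell κ q ω.1) (k + 1))) (by
          rw [hval k (by omega), hval _ hk]
          linarith [hz.thin_gap d k])
      omega
  rcases Nat.eq_zero_or_pos g with h0 | h0
  · rw [h0]
    exact hm p t (le_trans (by linarith) ht)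
  · have h3 := key (g - 1) (by omega)
    have h4 := hx.height_honest_le_tip (p := p) (t := t)
      (i := arrivalCount ω.1 (q * κ) + thinIdx d (cell κ q ω.1) (g - 1)) (by
        rw [hval _ (by omega)]
        linarith [hlt (g - 1) (by omega)])
    omega

theorem Admissible.height_tip_cells (hx : Admissible Δ Δa ω x) (h1 : RegularArrivals ω.1)
    (h2 : RegularArrivals ω.2) {κ d : ℝ} (hd : Δ < d) (hz : ∀ q, RegularArrivals (cell κ q ω.1))
    (hΔ : 0 ≤ Δ) (hκ : 0 ≤ κ) {m q : ℕ} (hm : ∀ p t, q * κ ≤ t → m ≤ x.height (x.tip p t)) (n : ℕ)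
    (hn : q ≤ n) : ∀ (p : ℕ) (t : ℝ), n * κ ≤ t →
      m + ∑ r ∈ Finset.Ico q n, arrivalCount (thin d (cell κ r ω.1)) (κ - Δ) ≤
        x.height (x.tip p t) := by
  induction n, hn using Nat.le_induction with
  | base => simpa using hm
  | succ n hn ih =>
    intro p t ht
    rw [Finset.sum_Ico_succ_top hn, ← add_assoc]
    exact hx.height_tip_cell_succ h1 h2 hd (hz n) hΔ hκ ih p (by push_cast at ht; exact ht)

/-- The argument of `Admissible.thin_le_mineTime` inside one cell; what was mined before the cell is
not needed. -/
theorem Admissible.thin_cell_le_mineTime (hx : Admissible Δ Δa ω x)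
    (h2 : RegularArrivals ω.2) {κ : ℝ} {q : ℕ} (hz : RegularArrivals (cell κ q ω.2)) (d : ℕ) :
    ∀ b : Block, (∀ k < d + 1, (x.parent^[k] b).IsAdv ∧ q * κ ≤ mineTime ω (x.parent^[k] b)) →
      mineTime ω b < (q + 1) * κ → thin Δa (cell κ q ω.2) d ≤ mineTime ω b - q * κ := by
  induction d with
  | zero =>
    intro b hb hlt
    have := hb 0 (by omega)
    cases b with
    | genesis => exact absurd this.1 id
    | honest i => exact absurd this.1 id
    | adv j m =>
      obtain ⟨n, -, hn⟩ := h2.exists_cell_eq (κ := κ) (q := q) (j := j) this.2 hlt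
      simp only [mineTime]
      rw [← hn]
      exact hz.thin_zero_le n
  | succ d ih =>
    intro b hb hlt
    have hb0 := hb 0 (by omega)
    have hb1 := hb 1 (by omega)
    cases b with
    | genesis => exact absurd hb0.1 id
    | honest i => exact absurd hb0.1 id
    | adv j m =>
      simp only [Function.iterate_one] at hb1
      have he := hx.parent_earlier (.adv j m) (by simp)
      have hp := ih (x.parent (.adv j m)) (fun k hk => by
        have := hb (k + 1) (by omega)
        rwa [Function.iterate_succ_apply] at this) (he.trans hlt)
      generalize hc : x.parent (.adv j m) = c at hp hb1 he
      cases c with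
      | genesis => exact absurd hb1.1 id
      | honest i => exact absurd hb1.1 id
      | adv i l =>
        have hd := hx.adv_delay j m i l hc
        obtain ⟨n, -, hn⟩ := h2.exists_cell_eq (κ := κ) (q := q) (j := j) hb0.2 hlt
        simp only [mineTime] at hp he ⊢
        rw [← hn]
        exact hz.thin_succ_le (by linarith) (by linarith)

/-- A chain of adversarial blocks is bounded by the thinned adversarial arrivals of the cells in
which it is mined. -/
theorem Admissible.adv_chain_le_sum (hx : Admissible Δ Δa ω x)
    (h2 : RegularArrivals ω.2) {κ : ℝ} (hz : ∀ q, RegularArrivals (cell κ q ω.2)) {q : ℕ} (n : ℕ)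
    (hn : q ≤ n) : ∀ (d : ℕ) (b : Block),
      (∀ k < d, (x.parent^[k] b).IsAdv ∧ q * κ ≤ mineTime ω (x.parent^[k] b)) →
      mineTime ω b < n * κ →
      d ≤ ∑ r ∈ Finset.Ico q n, arrivalCount (thin Δa (cell κ r ω.2)) κ := by
  induction n, hn using Nat.le_induction with
  | base =>
    intro d b hb hlt
    rcases Nat.eq_zero_or_pos d with rfl | hd
    · omega
    · exact absurd (hb 0 hd).2 (not_le.2 hlt)
  | succ n hn ih =>
    intro d b hb hlt
    classical
    rw [Finset.sum_Ico_succ_top hn]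
    -- Split the chain at its first block mined before cell `n`: the part above it lies in that
    -- cell, and the rest is covered by the induction.
    have hex : ∃ k, k = d ∨ mineTime ω (x.parent^[k] b) < n * κ := ⟨d, Or.inl rfl⟩
    set k0 := Nat.find hex
    have hk0 : k0 ≤ d := Nat.find_le (h := hex) (n := d) (Or.inl rfl)
    have hbefore : ∀ k < k0, n * κ ≤ mineTime ω (x.parent^[k] b) := fun k hk => by
      have := Nat.find_min hex hk
      simp only [not_or, not_lt] at this
      exact this.2
    have hA : k0 ≤ arrivalCount (thin Δa (cell κ n ω.2)) κ := by
      rcases Nat.eq_zero_or_pos k0 with h0 | h0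
      · omega
      · have h3 := hx.thin_cell_le_mineTime h2 (hz n) (k0 - 1) b
          (fun k hk => ⟨(hb k (by omega)).1, hbefore k (by omega)⟩)
          (by push_cast at hlt; exact hlt)
        have h4 : k0 - 1 < arrivalCount (thin Δa (cell κ n ω.2)) κ :=
          ((hz n).thinned Δa).lt_arrivalCount.2 (by push_cast at hlt; linarith)
        omega
    rcases Nat.find_spec hex with h0 | h0
    · have : k0 = d := h0
      omega
    · have := ih (d - k0) (x.parent^[k0] b) (fun k hk => by
        rw [← Function.iterate_add_apply]
        exact hb _ (by omega)) h0
      omega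

end

/-! ### Blocks that stay on every chain -/

/-- The arrivals of both kinds in a cell. -/
noncomputable def cells (κ : ℝ) (ω : Arrivals) (q : ℕ) : Arrivals := (cell κ q ω.1, cell κ q ω.2)

/-- The growth of honest chains within a cell. -/
noncomputable def honestGrowth (κ Δ d : ℝ) (z : Arrivals) : ℕ := arrivalCount (thin d z.1) (κ - Δ)

/-- The growth of adversarial chains within a cell. -/
noncomputable def advGrowth (κ Δa : ℝ) (z : Arrivals) : ℕ := arrivalCount (thin Δa z.2) κ

/-- The lead that honest chains gain within a cell. -/
noncomputable def gain (κ Δ d Δa : ℝ) (z : Arrivals) : ℝ :=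
  (honestGrowth κ Δ d z : ℝ) - advGrowth κ Δa z

/-- Cells with a single arrival, which is honest and not close to the ends of the cell. -/
def loneCell (κ Δ : ℝ) : Set Arrivals := {z | Δ < z.1 0 ∧ z.1 0 < κ - Δ ∧ κ ≤ z.1 1 ∧ κ ≤ z.2 0}

/-- The arrivals of both kinds are regular, also within all cells. -/
structure RegularCells (κ : ℝ) (ω : Arrivals) : Prop where
  fst : RegularArrivals ω.1
  snd : RegularArrivals ω.2
  cells_fst : ∀ q, RegularArrivals (cell κ q ω.1)
  cells_snd : ∀ q, RegularArrivals (cell κ q ω.2)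

theorem RegularArrivals.mul_le_thin {T : ℕ → ℝ} (h : RegularArrivals T) (d : ℝ) (n : ℕ) :
    n * d ≤ thin d T n := by
  induction n with
  | zero => simpa using (h.thinned d).pos.le
  | succ n ih => push_cast; linarith [h.thin_gap d n]

/-- A bound on the growth per cell is the second reason for a spacing `d > Δ`: when Δ = 0, thinning
by Δ would leave the growth unbounded. -/
theorem honestGrowth_le {κ Δ d : ℝ} {z : Arrivals} (h : RegularArrivals z.1) (hΔ : 0 ≤ Δ) {B : ℕ}
    (hB : κ ≤ B * d) : honestGrowth κ Δ d z ≤ B :=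
  (h.thinned d).arrivalCount_le.2 (by linarith [h.mul_le_thin d B])

theorem one_le_honestGrowth {κ Δ d : ℝ} {z : Arrivals} (h : RegularArrivals z.1)
    (hz : z ∈ loneCell κ Δ) : 1 ≤ honestGrowth κ Δ d z :=
  (h.thinned d).lt_arrivalCount.2 ((h.thin_zero_le 0).trans_lt hz.2.1)

theorem advGrowth_eq_zero {κ Δ Δa : ℝ} {z : Arrivals} (h : RegularArrivals z.2)
    (hz : z ∈ loneCell κ Δ) : advGrowth κ Δa z = 0 :=
  Nat.le_zero.1 ((h.thinned Δa).arrivalCount_le.2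
    (hz.2.2.2.trans (h.strictMono.monotone (Nat.zero_le _))))

/-- In the neighbourhood of a cut the honest growth exceeds the adversarial growth over every range
of cells that contains the cut. -/
theorem sum_lt_sum_of_cut {G A : ℕ → ℕ} {K M B q : ℕ} (hK : M + 2 * B + 1 ≤ K)
    (hG : ∀ r, q ≤ r + K → r ≤ q + K → 1 ≤ G r) (hA : ∀ r, q ≤ r + K → r ≤ q + K → A r = 0)
    (hB : ∀ r, G r ≤ B)
    (hl : ∀ n, n + K ≤ q → ∑ r ∈ Finset.Ico n (q - K), A r ≤ ∑ r ∈ Finset.Ico n (q - K), G r + M)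
    (hr : ∀ n, ∑ r ∈ Finset.Ico (q + K + 1) n, A r ≤ ∑ r ∈ Finset.Ico (q + K + 1) n, G r + M)
    {u v m : ℕ} (hu : u < q) (hv : v = u + 1 ∧ q ≤ u + K ∨ v = u + 2 ∧ u + K < q) (hm : q < m) :
    ∑ r ∈ Finset.Ico u (m + 1), A r < ∑ r ∈ Finset.Ico v m, G r := by
  have hvq : v ≤ q := by omega
  -- If `u` is within `K` of `q` there is no adversarial growth on the left. Otherwise the honest
  -- side loses at most `M` by the cut and `2 * B` in the two cells before the root is known to all,
  -- and gains at least `K` in the run next to `q`.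
  have hleft : ∑ r ∈ Finset.Ico u q, A r ≤ ∑ r ∈ Finset.Ico v q, G r := by
    rcases hv with ⟨rfl, hv⟩ | ⟨rfl, hv⟩
    · rw [Finset.sum_eq_zero fun r hr => by
        rw [Finset.mem_Ico] at hr
        exact hA r (by omega) (by omega)]
      exact Nat.zero_le _
    · rw [← Finset.sum_Ico_consecutive A (by omega : u ≤ q - K) (by omega : q - K ≤ q),
        Finset.sum_eq_zero (s := Finset.Ico (q - K) q) fun r hr => by
          rw [Finset.mem_Ico] at hr
          exact hA r (by omega) (by omega)]
      have h1 := hl u (by omega)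
      have h2 := Finset.sum_Ico_consecutive G (by omega : u ≤ q - K) (by omega : q - K ≤ q)
      have h3 : K ≤ ∑ r ∈ Finset.Ico (q - K) q, G r := by
        calc K = ∑ r ∈ Finset.Ico (q - K) q, 1 := by simp; omega
          _ ≤ _ := Finset.sum_le_sum fun r hr => by
            rw [Finset.mem_Ico] at hr
            exact hG r (by omega) (by omega)
      have h4 := Finset.sum_Ico_consecutive G (by omega : u ≤ u + 2) (by omega : u + 2 ≤ q)
      have h5 : ∑ r ∈ Finset.Ico u (u + 2), G r = G u + G (u + 1) := by
        rw [Finset.sum_Ico_succ_top (by omega), Finset.sum_Ico_succ_top (by omega)]; simp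
      have := hB u
      have := hB (u + 1)
      omega
  -- The cell `m` is still running and counts for the adversary only. The loss `M + B` is again paid
  -- by the `K` cells next to `q`; the cell `q` itself then makes the total inequality strict.
  have hright : ∑ r ∈ Finset.Ico (q + 1) (m + 1), A r ≤ ∑ r ∈ Finset.Ico (q + 1) m, G r := by
    rcases Nat.lt_or_ge (q + K) m with h | h
    · rw [← Finset.sum_Ico_consecutive A (by omega : q + 1 ≤ q + K + 1)
          (by omega : q + K + 1 ≤ m + 1),
        Finset.sum_eq_zero (s := Finset.Ico (q + 1) (q + K + 1)) fun r hr => by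
          rw [Finset.mem_Ico] at hr
          exact hA r (by omega) (by omega)]
      have h1 := hr (m + 1)
      rw [Finset.sum_Ico_succ_top (f := G) (by omega)] at h1
      have h2 := Finset.sum_Ico_consecutive G (by omega : q + 1 ≤ q + K + 1)
        (by omega : q + K + 1 ≤ m)
      have h3 : K ≤ ∑ r ∈ Finset.Ico (q + 1) (q + K + 1), G r := by
        calc K = ∑ r ∈ Finset.Ico (q + 1) (q + K + 1), 1 := by simp
          _ ≤ _ := Finset.sum_le_sum fun r hr => by
            rw [Finset.mem_Ico] at hr
            exact hG r (by omega) (by omega)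
      have := hB m
      omega
    · rw [Finset.sum_eq_zero fun r hr => by
        rw [Finset.mem_Ico] at hr
        exact hA r (by omega) (by omega)]
      exact Nat.zero_le _
  have h1 := Finset.sum_Ico_consecutive A hu.le (by omega : q ≤ m + 1)
  have h2 := Finset.sum_Ico_consecutive G hvq hm.le
  have h3 := Finset.sum_eq_sum_Ico_succ_bot (by omega : q < m + 1) A
  have h4 := Finset.sum_eq_sum_Ico_succ_bot hm G
  have h5 := hG q (by omega) (by omega)
  have h6 := hA q (by omega) (by omega)
  omega

section

variable {Δ Δa κ d : ℝ} {ω : Arrivals} {x : Play}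

theorem exists_cell_index (hκ : 0 < κ) {t : ℝ} (ht : 0 ≤ t) :
    ∃ q : ℕ, q * κ ≤ t ∧ t < (q + 1) * κ := by
  refine ⟨⌊t / κ⌋₊, ?_, ?_⟩
  · rw [← le_div_iff₀ hκ]; exact Nat.floor_le (by positivity)
  · rw [← div_lt_iff₀ hκ]; exact Nat.lt_floor_add_one _

theorem Play.OnChain.trans {a b c : Block} (h : x.OnChain a b) (h' : x.OnChain b c) :
    x.OnChain a c := by
  obtain ⟨m, rfl⟩ := h
  obtain ⟨n, rfl⟩ := h'
  exact ⟨m + n, Function.iterate_add_apply _ _ _ _⟩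

/-- The first honest block of a cell. -/
noncomputable def cutBlock (κ : ℝ) (ω : Arrivals) (q : ℕ) : Block :=
  .honest (arrivalCount ω.1 (q * κ))

theorem mineTime_cutBlock (hΔ : 0 ≤ Δ) {q : ℕ} (hz : cells κ ω q ∈ loneCell κ Δ) :
    mineTime ω (cutBlock κ ω q) = q * κ + cell κ q ω.1 0 :=
  eq_of_cell_lt (T := ω.1) (κ := κ) (q := q) (n := 0) (lt_of_lt_of_le hz.2.1 (by linarith))

/-- A lone cell contains a single honest arrival. -/
theorem RegularCells.eq_cutBlock (hω : RegularCells κ ω) {q : ℕ}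
    (hz : cells κ ω q ∈ loneCell κ Δ) {b : Block} (hb : ¬ b.IsAdv) (hb0 : b ≠ .genesis)
    (h1 : q * κ ≤ mineTime ω b) (h2 : mineTime ω b < (q + 1) * κ) : b = cutBlock κ ω q := by
  cases b with
  | genesis => exact absurd rfl hb0
  | adv j m => exact absurd trivial hb
  | honest i =>
    obtain ⟨n, hn, hn'⟩ := hω.fst.exists_cell_eq (κ := κ) (q := q) (j := i) h1 h2
    rcases Nat.eq_zero_or_pos n with rfl | h0
    · rw [hn]; rfl
    · have h3 := (hω.cells_fst q).strictMono.monotone (show 1 ≤ n from h0)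
      have h4 : κ ≤ cell κ q ω.1 1 := hz.2.2.1
      simp only [mineTime] at h2
      linarith

theorem Admissible.exists_last_nonadv (hx : Admissible Δ Δa ω x) (h1 : RegularArrivals ω.1)
    (h2 : RegularArrivals ω.2) (b : Block) :
    ∃ n, ¬ (x.parent^[n] b).IsAdv ∧ (∀ k < n, (x.parent^[k] b).IsAdv) ∧ n ≤ x.height b := by
  classical
  have hex : ∃ n, ¬ (x.parent^[n] b).IsAdv := ⟨x.height b, by
    rw [hx.iterate_height h1 h2]; exact id⟩
  exact ⟨Nat.find hex, Nat.find_spec hex, fun k hk => not_not.1 (Nat.find_min hex hk),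
    Nat.find_min' hex (by rw [hx.iterate_height h1 h2]; exact id)⟩

theorem Admissible.mineTime_iterate_le (hx : Admissible Δ Δa ω x) (b : Block) {m n : ℕ}
    (hmn : m ≤ n) : mineTime ω (x.parent^[n] b) ≤ mineTime ω (x.parent^[m] b) := by
  induction n, hmn using Nat.le_induction with
  | base => exact le_rfl
  | succ n _ ih =>
    refine le_trans ?_ ih
    rw [Function.iterate_succ_apply']
    by_cases h : x.parent^[n] b = .genesis
    · rw [h, hx.parent_genesis]
    · exact (hx.parent_earlier _ h).le

theorem Admissible.mineTime_tip_lt (hx : Admissible Δ Δa ω x) {t : ℝ} (ht : 0 < t) (p : ℕ) :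
    mineTime ω (x.tip p t) < t := by
  by_cases h : x.tip p t = .genesis
  · rw [h]; exact ht
  · exact hx.view_past p t _ (hx.tip_mem p t) h

/-- The honest block at a cut is on every chain held later. -/
theorem Admissible.onChain_cutBlock (hx : Admissible Δ Δa ω x) (hω : RegularCells κ ω)
    (hΔ : 0 ≤ Δ) (hd : Δ < d) (hκ : Δ < κ) {K M B q : ℕ} (hB : κ ≤ B * d)
    (hK : M + 2 * B + 1 ≤ K) (hq : K ≤ q)
    (hcut : IsCut (gain κ Δ d Δa) (loneCell κ Δ) K M (cells κ ω) q) (p : ℕ) {t : ℝ}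
    (ht : (q + 1) * κ ≤ t) : x.OnChain (cutBlock κ ω q) (x.tip p t) := by
  have hκ0 : 0 < κ := hΔ.trans_lt hκ
  obtain ⟨hlone, hl, hr⟩ := hcut
  have hG : ∀ r, q ≤ r + K → r ≤ q + K → 1 ≤ honestGrowth κ Δ d (cells κ ω r) := fun r h1 h2 =>
    one_le_honestGrowth (hω.cells_fst r) (hlone r h1 h2)
  have hA : ∀ r, q ≤ r + K → r ≤ q + K → advGrowth κ Δa (cells κ ω r) = 0 := fun r h1 h2 =>
    advGrowth_eq_zero (hω.cells_snd r) (hlone r h1 h2)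
  have hGB : ∀ r, honestGrowth κ Δ d (cells κ ω r) ≤ B := fun r =>
    honestGrowth_le (hω.cells_fst r) hΔ hB
  have hsum : ∀ s : Finset ℕ, -(M : ℝ) ≤ ∑ r ∈ s, gain κ Δ d Δa (cells κ ω r) →
      ∑ r ∈ s, advGrowth κ Δa (cells κ ω r) ≤ ∑ r ∈ s, honestGrowth κ Δ d (cells κ ω r) + M := by
    intro s hs
    simp only [gain, Finset.sum_sub_distrib] at hs
    have : ((∑ r ∈ s, advGrowth κ Δa (cells κ ω r) : ℕ) : ℝ) ≤
        ((∑ r ∈ s, honestGrowth κ Δ d (cells κ ω r) + M : ℕ) : ℝ) := by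
      push_cast; linarith
    exact_mod_cast this
  have key : ∀ {u v m : ℕ}, u < q → (v = u + 1 ∧ q ≤ u + K ∨ v = u + 2 ∧ u + K < q) → q < m → _ :=
    fun {u v m} => sum_lt_sum_of_cut (G := fun r => honestGrowth κ Δ d (cells κ ω r))
      (A := fun r => advGrowth κ Δa (cells κ ω r)) (u := u) (v := v) (m := m)
      hK hG hA hGB (fun n hn => hsum _ (hl n hn)) (fun n => hsum _ (hr n))
  -- Induction on the number of honest arrivals: a chain whose last honest block comes after the cut
  -- extends the chain held by the miner of that block at an earlier time.
  have hmain : ∀ (N p : ℕ) (t : ℝ), (q + 1) * κ ≤ t → t ≤ ω.1 N →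
      x.OnChain (cutBlock κ ω q) (x.tip p t) := by
    intro N
    induction N using Nat.strong_induction_on with
    | _ N ih =>
    intro p t ht htN
    have ht0 : 0 < t := lt_of_lt_of_le (by positivity) ht
    have hbt := hx.mineTime_tip_lt ht0 p
    obtain ⟨n, hn, hnadv, hnh⟩ := hx.exists_last_nonadv hω.fst hω.snd (x.tip p t)
    set b := x.tip p t with hb
    set root := x.parent^[n] b with hroot
    have hchain : x.OnChain root b := ⟨n, rfl⟩
    have hrt : mineTime ω root < t := (hx.mineTime_iterate_le b (Nat.zero_le n)).trans_lt hbt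
    have hr0 : 0 ≤ mineTime ω root := mineTime_nonneg hω.fst hω.snd root
    -- Look at the last non-adversarial block of the chain. In cell `q` it must be the cut block;
    -- before cell `q` it leads to a contradiction, since honest heights have grown above it by more
    -- than the adversarial extension can; after cell `q` the induction applies.
    rcases lt_or_ge (mineTime ω root) ((q + 1) * κ) with hlt | hge
    · by_cases hcell : root ≠ .genesis ∧ q * κ ≤ mineTime ω root
      · exact (hω.eq_cutBlock (hlone q (by omega) (by omega)) hn hcell.1 hcell.2 hlt) ▸ hchain
      exfalso
      obtain ⟨u, hu1, hu2⟩ := exists_cell_index hκ0 hr0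
      obtain ⟨m, hm1, hm2⟩ := exists_cell_index hκ0 ht0.le
      have huq : u < q := by
        by_contra hc
        have h3 : (q : ℝ) ≤ u := by exact_mod_cast not_lt.1 hc
        have h4 : q * κ ≤ mineTime ω root := (by gcongr : (q : ℝ) * κ ≤ u * κ).trans hu1
        have h5 : root = .genesis := by
          by_contra hne
          exact hcell ⟨hne, h4⟩
        rw [h5] at h4
        have : (1 : ℝ) ≤ q := by exact_mod_cast (by omega : 1 ≤ q)
        have : 0 < (q : ℝ) * κ := by positivity
        exact absurd h4 (not_le.2 this)
      have hqm : q < m := by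
        have h3 : ((q : ℝ) + 1) * κ < (m + 1) * κ := ht.trans_lt hm2
        have h4 : (q : ℝ) + 1 < m + 1 := lt_of_mul_lt_mul_right h3 hκ0.le
        exact_mod_cast (by linarith : (q : ℝ) < m)
      -- `v` is a cell by whose start every node knows the root. In general this takes one further
      -- full cell, as Δ < κ; a block in a lone cell is more than Δ away from its end and is known
      -- at once in the next one.
      obtain ⟨v, hv, hvm⟩ : ∃ v : ℕ, (v = u + 1 ∧ q ≤ u + K ∨ v = u + 2 ∧ u + K < q) ∧
          ∀ p t, v * κ ≤ t → x.height root ≤ x.height (x.tip p t) := by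
        by_cases hg : root = .genesis
        · rw [hg, x.height_genesis]
          rcases Nat.lt_or_ge (u + K) q with h | h
          · exact ⟨u + 2, Or.inr ⟨rfl, h⟩, fun _ _ _ => Nat.zero_le _⟩
          · exact ⟨u + 1, Or.inl ⟨rfl, h⟩, fun _ _ _ => Nat.zero_le _⟩
        rcases Nat.lt_or_ge (u + K) q with h | h
        · refine ⟨u + 2, Or.inr ⟨rfl, h⟩, fun p t ht => ?_⟩
          clear_value root
          cases root with
          | genesis => exact absurd rfl hg
          | adv => exact absurd trivial hn
          | honest i =>
            refine hx.height_honest_le_tip ?_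
            simp only [mineTime] at hu2
            push_cast at ht
            nlinarith
        · refine ⟨u + 1, Or.inl ⟨rfl, h⟩, fun p t ht => ?_⟩
          have hz := hlone u (by omega) (by omega)
          have he := hω.eq_cutBlock hz hn hg hu1 hu2
          have h3 := mineTime_cutBlock hΔ hz
          have h4 : cell κ u ω.1 0 < κ - Δ := hz.2.1
          rw [he]
          refine hx.height_honest_le_tip ?_
          simp only [mineTime, cutBlock] at h3
          push_cast at ht
          linarith
      have h3 := hx.height_tip_cells hω.fst hω.snd hd hω.cells_fst hΔ hκ0.le hvm m (by omega) p t hm1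
      have h4 := hx.adv_chain_le_sum hω.snd hω.cells_snd (q := u) (m + 1) (by omega) n b
        (fun k hk => ⟨hnadv k hk, hu1.trans (hx.mineTime_iterate_le b hk.le)⟩)
        (by push_cast; exact hbt.trans hm2)
      have h5 := hx.height_iterate hω.fst hω.snd b n
      rw [← hroot] at h5
      have h6 := key huq hv hqm
      simp only [honestGrowth, advGrowth, cells] at h6
      rw [← hb] at h3
      omega
    · clear_value root
      cases root with
      | genesis =>
        have : 0 < ((q : ℝ) + 1) * κ := by positivity
        exact absurd hge (not_le.2 this)
      | adv => exact absurd trivial hn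
      | honest i =>
        refine Play.OnChain.trans ?_ hchain
        obtain ⟨e, he⟩ := ih i (hω.fst.strictMono.lt_iff_lt.1 (hrt.trans_le htN)) i (ω.1 i) hge le_rfl
        exact ⟨e + 1, by rw [Function.iterate_succ_apply, hx.honest_parent, he]⟩
  obtain ⟨N, hN⟩ := hω.fst.exists_le t
  exact hmain N p t ht hN

end

/-! ### Persistence and liveness from cuts -/

/-- The number of arrivals of both kinds before time `t`. -/
noncomputable def arrivalsBefore (ω : Arrivals) (t : ℝ) : ℕ :=
  arrivalCount ω.1 t + arrivalCount ω.2 t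

theorem measurable_arrivalsBefore (t : ℝ) : Measurable fun ω : Arrivals => arrivalsBefore ω t :=
  ((measurable_arrivalCount t).comp measurable_fst).add
    ((measurable_arrivalCount t).comp measurable_snd)

section

variable {Δ Δa κ d : ℝ} {ω : Arrivals} {x : Play}

theorem arrivalsBefore_zero (h1 : RegularArrivals ω.1) (h2 : RegularArrivals ω.2) :
    arrivalsBefore ω 0 = 0 := by
  have h3 := h1.arrivalCount_le.2 h1.pos.le
  have h4 := h2.arrivalCount_le.2 h2.pos.le
  simp only [arrivalsBefore]
  omega

theorem arrivalsBefore_mono (h1 : RegularArrivals ω.1) (h2 : RegularArrivals ω.2) {s t : ℝ}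
    (hst : s ≤ t) : arrivalsBefore ω s ≤ arrivalsBefore ω t :=
  add_le_add (h1.arrivalCount_mono hst) (h2.arrivalCount_mono hst)

theorem arrivalsBefore_after (h1 : RegularArrivals ω.1) (h2 : RegularArrivals ω.2) (t : ℝ) {u : ℝ}
    (hu : 0 ≤ u) : arrivalsBefore ω (t + u) =
      arrivalsBefore ω t + arrivalsBefore (arrivalAfter t ω.1, arrivalAfter t ω.2) u := by
  have h3 := h1.arrivalCount_mono (show t ≤ t + u by linarith)
  have h4 := h2.arrivalCount_mono (show t ≤ t + u by linarith)
  simp only [arrivalsBefore, h1.arrivalCount_after t hu, h2.arrivalCount_after t hu]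
  omega

theorem arrivalsBefore_mineTime_lt (h1 : RegularArrivals ω.1) (h2 : RegularArrivals ω.2) {b : Block}
    (hb : b ≠ .genesis) {v : ℝ} (hv : mineTime ω b < v) :
    arrivalsBefore ω (mineTime ω b) < arrivalsBefore ω v := by
  cases b with
  | genesis => exact absurd rfl hb
  | honest i =>
    exact add_lt_add_of_lt_of_le ((h1.arrivalCount_le.2 le_rfl).trans_lt (h1.lt_arrivalCount.2 hv))
      (h2.arrivalCount_mono hv.le)
  | adv j m =>
    exact add_lt_add_of_le_of_lt (h1.arrivalCount_mono hv.le)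
      ((h2.arrivalCount_le.2 le_rfl).trans_lt (h2.lt_arrivalCount.2 hv))

/-- A piece of a chain is no longer than the number of arrivals while it is mined. -/
theorem Admissible.chain_length_le (hx : Admissible Δ Δa ω x) (h1 : RegularArrivals ω.1)
    (h2 : RegularArrivals ω.2) {u : ℝ} (n : ℕ) : ∀ (b : Block) (v : ℝ), u ≤ v →
      (∀ k < n, x.parent^[k] b ≠ .genesis ∧ u ≤ mineTime ω (x.parent^[k] b)) →
      mineTime ω b < v → arrivalsBefore ω u + n ≤ arrivalsBefore ω v := by
  induction n with
  | zero => exact fun b v huv _ _ => arrivalsBefore_mono h1 h2 huv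
  | succ n ih =>
    intro b v huv hb hv
    have hb0 : b ≠ .genesis ∧ u ≤ mineTime ω b := hb 0 (by omega)
    have := ih (x.parent b) (mineTime ω b) hb0.2 (fun k hk => by
      rw [← Function.iterate_succ_apply]
      exact hb (k + 1) (by omega)) (hx.parent_earlier b hb0.1)
    have := arrivalsBefore_mineTime_lt h1 h2 hb0.1 hv
    omega

theorem Admissible.height_tip_le_arrivalsBefore (hx : Admissible Δ Δa ω x)
    (h1 : RegularArrivals ω.1) (h2 : RegularArrivals ω.2) {s : ℝ} (hs : 0 ≤ s) (p : ℕ) :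
    x.height (x.tip p s) ≤ arrivalsBefore ω s := by
  by_cases h : x.tip p s = .genesis
  · rw [h, x.height_genesis]; exact Nat.zero_le _
  · have := hx.chain_length_le h1 h2 (u := 0) (x.height (x.tip p s)) (x.tip p s) s hs
      (fun k hk => ⟨x.iterate_ne_genesis hk, mineTime_nonneg h1 h2 _⟩)
      (hx.view_past p s _ (hx.tip_mem p s) h)
    omega

theorem iterate_parent_genesis (hg : x.parent .genesis = .genesis) (n : ℕ) :
    x.parent^[n] .genesis = .genesis := Function.iterate_fixed hg n

/-- At most `k` arrivals occur from the time `u`, before which `c` is not mined, to `v`. A block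
with `k` blocks on top of it at time `s` therefore cannot lie strictly above `c`; it is on the chain
of `c` and stays with it. Its depth survives because the tip held at `s` is known to all after the
delay Δ. -/
theorem Admissible.not_persistenceFails_of_onChain (hx : Admissible Δ Δa ω x)
    (h1 : RegularArrivals ω.1) (h2 : RegularArrivals ω.2) {c : Block} (hc : c ≠ .genesis)
    {s u v : ℝ} (hs : 0 < s) (hsv : s ≤ v) (hus : u ≤ s) (hu : u ≤ mineTime ω c)
    (hΔ : 0 ≤ Δ) (hon : ∀ p t, s ≤ t → x.OnChain c (x.tip p t)) {k : ℕ}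
    (hk : arrivalsBefore ω v ≤ arrivalsBefore ω u + k) : ¬ PersistenceFails Δ k s x := by
  rintro ⟨tx, hconf, t, ht, p, hp⟩
  apply hp
  obtain ⟨b, hb, ⟨n, hn⟩, hh⟩ := hconf 0
  obtain ⟨m, hm⟩ := hon 0 s le_rfl
  have hkn : k ≤ n := by
    rw [← hn, hx.height_iterate h1 h2] at hh
    omega
  have hmn : m ≤ n := by
    by_contra hlt
    have := hx.chain_length_le h1 h2 (u := u) (n + 1) (x.tip 0 s) v (hus.trans hsv) (fun k hk => by
      refine ⟨fun h0 => hc ?_, ?_⟩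
      · rw [← hm, ← Nat.sub_add_cancel (show k ≤ m by omega), Function.iterate_add_apply, h0,
          iterate_parent_genesis hx.parent_genesis]
      · rw [← hm] at hu
        exact hu.trans (hx.mineTime_iterate_le _ (by omega))) ((hx.mineTime_tip_lt hs 0).trans_le hsv)
    omega
  have hbc : x.OnChain b c := ⟨n - m, by
    rw [← hm, ← Function.iterate_add_apply, Nat.sub_add_cancel hmn, hn]⟩
  refine ⟨b, hb, hbc.trans (hon p t (by linarith)), hh.trans ?_⟩
  exact hx.tip_longest p t _ (hx.view_delay 0 p s t ht.le (hx.tip_mem 0 s))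

/-- An honest block mined after `s + Δ` has the transaction on its chain. If that block stays on
every chain and `k` blocks of growth follow, the transaction is confirmed. -/
theorem Admissible.not_livenessFails_of_onChain (hx : Admissible Δ Δa ω x)
    (h1 : RegularArrivals ω.1) (h2 : RegularArrivals ω.2) {i : ℕ} {s T : ℝ} (hi : s + Δ < ω.1 i)
    {k : ℕ} (hon : ∀ p t, s + T < t → x.OnChain (.honest i) (x.tip p t))
    (hgrow : ∀ p t, s + T < t → x.height (.honest i) + k ≤ x.height (x.tip p t)) :
    ¬ LivenessFails Δ k T s ω x := by
  rintro ⟨tx, hsub, t, ht, p, hp⟩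
  apply hp
  obtain ⟨b, hb, hbc⟩ := hsub.2 i hi
  refine ⟨b, hb, hbc.trans (hon p t ht), le_trans ?_ (hgrow p t ht)⟩
  obtain ⟨n, rfl⟩ := hbc
  rw [hx.height_iterate h1 h2]
  omega

theorem Admissible.not_persistenceFails_of_isCut (hx : Admissible Δ Δa ω x)
    (hω : RegularCells κ ω) (hΔ : 0 ≤ Δ) (hd : Δ < d) (hκ : Δ < κ) {K M B w k : ℕ}
    (hB : κ ≤ B * d) (hK : M + 2 * B + 1 ≤ K) {s : ℝ} (hs : 0 ≤ s) {a : ℕ}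
    (ha : a = ⌊s / κ⌋₊ - w)
    (hcut : ∃ q, a + K ≤ q ∧ q < a + w ∧
      IsCut (gain κ Δ d Δa) (loneCell κ Δ) K M (cells κ ω) q)
    (hk : arrivalsBefore ω (a * κ + (w + 1) * κ) < arrivalsBefore ω (a * κ) + k) :
    ¬ PersistenceFails Δ k s x := by
  have hκ0 : 0 < κ := hΔ.trans_lt hκ
  have hfl : s < (⌊s / κ⌋₊ + 1) * κ := by
    rw [← div_lt_iff₀ hκ0]; exact Nat.lt_floor_add_one _
  have hfl' : ⌊s / κ⌋₊ * κ ≤ s := by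
    rw [← le_div_iff₀ hκ0]; exact Nat.floor_le (by positivity)
  have hsv : s ≤ a * κ + (w + 1) * κ := by
    refine hfl.le.trans ?_
    rw [← add_mul]
    have : (⌊s / κ⌋₊ : ℝ) ≤ a + w := by exact_mod_cast (by omega : ⌊s / κ⌋₊ ≤ a + w)
    exact mul_le_mul_of_nonneg_right (by linarith) hκ0.le
  -- When `s` is too early for a window of `w` cells before it, the truncated subtraction gives `a =
  -- 0`, and fewer than `k` blocks exist, so nothing is confirmed with depth `k`.
  rcases Nat.lt_or_ge ⌊s / κ⌋₊ w with h | h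
  · have ha0 : a = 0 := by omega
    subst ha0
    simp only [Nat.cast_zero, zero_mul, zero_add, arrivalsBefore_zero hω.fst hω.snd] at hk hsv
    rintro ⟨tx, hconf, -⟩
    obtain ⟨b, -, -, hh⟩ := hconf 0
    have := hx.height_tip_le_arrivalsBefore hω.fst hω.snd hs 0
    have := arrivalsBefore_mono hω.fst hω.snd hsv
    omega
  · obtain ⟨q, hq1, hq2, hq⟩ := hcut
    have hqs : ((q : ℝ) + 1) * κ ≤ s := by
      refine le_trans ?_ hfl'
      have : (q : ℝ) + 1 ≤ ⌊s / κ⌋₊ := by exact_mod_cast (by omega : q + 1 ≤ ⌊s / κ⌋₊)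
      gcongr
    have hlone := hq.1 q (by omega) (by omega)
    have haq : (a : ℝ) * κ ≤ q * κ := by gcongr; omega
    refine hx.not_persistenceFails_of_onChain hω.fst hω.snd (c := cutBlock κ ω q)
      (by simp [cutBlock]) (lt_of_lt_of_le (by positivity) hqs) hsv (u := a * κ) (by nlinarith) ?_ hΔ
      (fun p t ht => hx.onChain_cutBlock hω hΔ hd hκ hB hK (by omega) hq p (hqs.trans ht)) hk.le
    rw [mineTime_cutBlock hΔ hlone]
    have : Δ < cell κ q ω.1 0 := hlone.1
    linarith

/-- The waiting time covers the delay Δ, up to one cell lost by rounding, `w` cells to find a cut,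
and `w'` cells in which the chains grow by `k`. -/
theorem Admissible.not_livenessFails_of_isCut (hx : Admissible Δ Δa ω x)
    (hω : RegularCells κ ω) (hΔ : 0 ≤ Δ) (hd : Δ < d) (hκ : Δ < κ) {K M B w w' k : ℕ}
    (hB : κ ≤ B * d) (hK : M + 2 * B + 1 ≤ K) {s : ℝ} (hs : 0 ≤ s) {a : ℕ}
    (ha : a = ⌈(s + Δ) / κ⌉₊)
    (hcut : ∃ q, a + K ≤ q ∧ q < a + w ∧
      IsCut (gain κ Δ d Δa) (loneCell κ Δ) K M (cells κ ω) q)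
    (hk : (k : ℝ) ≤ ∑ i ∈ Finset.range w', gain κ Δ d Δa (cells κ ω (a + w + i))) :
    ¬ LivenessFails Δ k (Δ + (1 + w + w') * κ) s ω x := by
  have hκ0 : 0 < κ := hΔ.trans_lt hκ
  have ha1 : s + Δ ≤ a * κ := by
    rw [← div_le_iff₀ hκ0, ha]; exact Nat.le_ceil _
  have ha2 : a * κ < s + Δ + κ := by
    have := Nat.ceil_lt_add_one (show 0 ≤ (s + Δ) / κ by positivity)
    rw [← ha, div_add_one hκ0.ne', lt_div_iff₀ hκ0] at this
    exact this
  obtain ⟨q, hq1, hq2, hq⟩ := hcut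
  have hlone := hq.1 q (by omega) (by omega)
  have hz0 : Δ < cell κ q ω.1 0 := hlone.1
  have hz1 : cell κ q ω.1 0 < κ - Δ := hlone.2.1
  have hct := mineTime_cutBlock hΔ hlone
  have hct' : ω.1 (arrivalCount ω.1 (q * κ)) = q * κ + cell κ q ω.1 0 := hct
  have haq : (a : ℝ) * κ ≤ q * κ := by gcongr; omega
  have hqt : ∀ t, s + (Δ + (1 + w + w') * κ) < t → ((a + w + w' : ℕ) : ℝ) * κ ≤ t := by
    intro t ht
    push_cast
    linarith
  have hqm : ((q : ℝ) + 1) * κ ≤ ((a + w + w' : ℕ) : ℝ) * κ := by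
    gcongr
    exact_mod_cast (by omega : q + 1 ≤ a + w + w')
  refine hx.not_livenessFails_of_onChain hω.fst hω.snd (i := arrivalCount ω.1 (q * κ))
    (by linarith) (fun p t ht =>
      hx.onChain_cutBlock hω hΔ hd hκ hB hK (by omega) hq p (hqm.trans (hqt t ht))) ?_
  intro p t ht
  have h3 := hx.height_tip_cells hω.fst hω.snd hd hω.cells_fst hΔ hκ0.le
    (m := x.height (.honest (arrivalCount ω.1 (q * κ)))) (q := a + w) (fun p t ht => by
      refine hx.height_honest_le_tip ?_
      have : ((q : ℝ) + 1) * κ ≤ ((a + w : ℕ) : ℝ) * κ := by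
        gcongr
        exact_mod_cast (by omega : q + 1 ≤ a + w)
      linarith) (a + w + w') (by omega) p t (hqt t ht)
  have h4 : k ≤ ∑ r ∈ Finset.Ico (a + w) (a + w + w'),
      arrivalCount (thin d (cell κ r ω.1)) (κ - Δ) := by
    rw [Finset.sum_Ico_eq_sum_range, Nat.add_sub_cancel_left]
    have h5 : ∑ i ∈ Finset.range w', gain κ Δ d Δa (cells κ ω (a + w + i)) ≤
        ∑ i ∈ Finset.range w', (honestGrowth κ Δ d (cells κ ω (a + w + i)) : ℝ) :=
      Finset.sum_le_sum fun i _ => by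
        simp only [gain, tsub_le_iff_right, le_add_iff_nonneg_right]
        positivity
    exact_mod_cast hk.trans h5
  omega

end

/-! ### The law of the cells -/

theorem IsMemoryless.map_cut_after {ν : Measure ℝ} {μ : Measure (ℕ → ℝ)} [IsProbabilityMeasure ν]
    [IsProbabilityMeasure μ] (h : IsMemoryless ν μ) {t : ℝ} (ht : 0 ≤ t) :
    μ.map (fun T => (arrivalCut t T, arrivalAfter t T)) = (μ.map (arrivalCut t)).prod μ := by
  have : IsProbabilityMeasure (μ.map (arrivalPast t)) :=
    Measure.isProbabilityMeasure_map (measurable_arrivalPast t).aemeasurable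
  have e := congrArg (Measure.map (Prod.map (arrivalCut t) id)) (h.map_past_after ht)
  rw [Measure.map_map ((measurable_arrivalCut t).prodMap measurable_id)
    ((measurable_arrivalPast t).prodMk (measurable_arrivalAfter t)),
    ← Measure.map_prod_map _ _ (measurable_arrivalCut t) measurable_id, Measure.map_id,
    Measure.map_map (measurable_arrivalCut t) (measurable_arrivalPast t)] at e
  convert e using 2
  · funext T
    simp [arrivalCut_past]
  · congr 1
    funext T
    simp [arrivalCut_past]

/-- The law of the arrivals in a cell. -/
noncomputable def cellLaw (lh la κ : ℝ) : Measure Arrivals :=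
  (arrivalLaw lh la).map fun ω => (arrivalCut κ ω.1, arrivalCut κ ω.2)

theorem measurable_cut_prod (κ : ℝ) :
    Measurable fun ω : Arrivals => ((arrivalCut κ ω.1, arrivalCut κ ω.2) : Arrivals) :=
  ((measurable_arrivalCut κ).comp measurable_fst).prodMk
    ((measurable_arrivalCut κ).comp measurable_snd)

instance isProbabilityMeasure_cellLaw (lh la κ : ℝ) : IsProbabilityMeasure (cellLaw lh la κ) :=
  Measure.isProbabilityMeasure_map (measurable_cut_prod κ).aemeasurable

theorem measurable_cells (κ : ℝ) : Measurable (cells κ) :=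
  measurable_pi_lambda _ fun q =>
    ((measurable_cell κ q).comp measurable_fst).prodMk ((measurable_cell κ q).comp measurable_snd)

section

variable {lh la : ℝ}

/-- The arrivals in the cells are independent and identically distributed. -/
theorem map_cells (hlh : 0 < lh) (hla : 0 < la) {κ : ℝ} (hκ : 0 ≤ κ) :
    (arrivalLaw lh la).map (cells κ) = Measure.infinitePi fun _ => cellLaw lh la κ := by
  have hp1 : IsProbabilityMeasure ((poissonArrivals lh).map (arrivalCut κ)) :=
    Measure.isProbabilityMeasure_map (measurable_arrivalCut κ).aemeasurable
  have hp2 : IsProbabilityMeasure ((poissonArrivals la).map (arrivalCut κ)) :=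
    Measure.isProbabilityMeasure_map (measurable_arrivalCut κ).aemeasurable
  have h := map_prodMk_prod (measurable_arrivalAfter κ) (measurable_arrivalCut κ)
    (measurable_arrivalAfter κ) (measurable_arrivalCut κ)
    ((isMemoryless_poissonArrivals hlh).map_cut_after hκ)
    ((isMemoryless_poissonArrivals hla).map_cut_after hκ)
  have hθ : Measurable fun ω : Arrivals => ((arrivalAfter κ ω.1, arrivalAfter κ ω.2) : Arrivals) :=
    ((measurable_arrivalAfter κ).comp measurable_fst).prodMk
      ((measurable_arrivalAfter κ).comp measurable_snd)
  have h2 := map_fst_of_map_prodMk hθ (measurable_cut_prod κ) h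
  have h3 := map_orbit_eq_infinitePi (μ := arrivalLaw lh la) hθ (measurable_cut_prod κ) (by
    change _ = (((poissonArrivals lh).prod (poissonArrivals la)).map _).prod _
    rw [h2]; exact h)
  rw [show (fun _ : ℕ => cellLaw lh la κ) = fun _ => (arrivalLaw lh la).map _ from rfl, ← h3]
  -- Iterated restarts agree with restarts at multiples of `κ` only for regular arrivals, hence
  -- almost surely.
  refine Measure.map_congr ?_
  filter_upwards [ae_arrivalLaw_fst (ae_regular_poissonArrivals hlh),
    ae_arrivalLaw_snd (ae_regular_poissonArrivals hla)] with ω h1 h2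
  funext q
  simp only [iterate_prodMap, h1.iterate_arrivalAfter hκ, h2.iterate_arrivalAfter hκ]
  rfl

theorem ae_regular_cell {r : ℝ} (hr : 0 < r) {κ : ℝ} (hκ : 0 ≤ κ) :
    ∀ᵐ T ∂poissonArrivals r, ∀ q, RegularArrivals (cell κ q T) := by
  refine ae_all_iff.2 fun q => ?_
  have hmp := (isMemoryless_poissonArrivals hr).measurePreserving_after
    (t := q * κ) (by positivity)
  filter_upwards [hmp.quasiMeasurePreserving.ae (ae_regular_poissonArrivals hr)] with T hT
  exact hT.cut hκ

theorem ae_regularCells (hlh : 0 < lh) (hla : 0 < la) {κ : ℝ} (hκ : 0 ≤ κ) :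
    ∀ᵐ ω ∂arrivalLaw lh la, RegularCells κ ω := by
  filter_upwards [ae_arrivalLaw_fst (ae_regular_poissonArrivals hlh),
    ae_arrivalLaw_snd (ae_regular_poissonArrivals hla), ae_arrivalLaw_fst (ae_regular_cell hlh hκ),
    ae_arrivalLaw_snd (ae_regular_cell hla hκ)] with ω h1 h2 h3 h4
  exact ⟨h1, h2, h3, h4⟩

theorem ae_cellLaw_regular (hlh : 0 < lh) {κ : ℝ} (hκ : 0 ≤ κ) :
    ∀ᵐ z ∂cellLaw lh la κ, RegularArrivals z.1 := by
  refine (ae_map_iff (measurable_cut_prod κ).aemeasurable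
    (measurable_fst measurableSet_regularArrivals)).2 ?_
  filter_upwards [ae_arrivalLaw_fst (ae_regular_poissonArrivals hlh)] with ω h1
  exact h1.cut hκ

theorem measurable_honestGrowth (κ Δ d : ℝ) : Measurable (honestGrowth κ Δ d) :=
  (measurable_arrivalCount _).comp ((measurable_thin d).comp measurable_fst)

theorem measurable_advGrowth (κ Δa : ℝ) : Measurable (advGrowth κ Δa) :=
  (measurable_arrivalCount _).comp ((measurable_thin Δa).comp measurable_snd)

theorem measurable_gain (κ Δ d Δa : ℝ) : Measurable (gain κ Δ d Δa) :=
  (measurable_from_nat.comp (measurable_honestGrowth κ Δ d)).sub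
    (measurable_from_nat.comp (measurable_advGrowth κ Δa))

theorem measurableSet_loneCell (κ Δ : ℝ) : MeasurableSet (loneCell κ Δ) := by
  have h1 : ∀ n, Measurable fun z : Arrivals => z.1 n := fun n =>
    (measurable_pi_apply n).comp measurable_fst
  have h2 : ∀ n, Measurable fun z : Arrivals => z.2 n := fun n =>
    (measurable_pi_apply n).comp measurable_snd
  exact (measurableSet_lt measurable_const (h1 0)).inter
    ((measurableSet_lt (h1 0) measurable_const).inter
      ((measurableSet_le measurable_const (h1 1)).inter (measurableSet_le measurable_const (h2 0))))

/-- Thinning cell by cell forgets the dead times that cross cell boundaries; each boundary costs at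
most one point, so the sums remain comparable with the thinned process of known rate. -/
theorem RegularCells.sum_advGrowth_le {κ Δa : ℝ} {ω : Arrivals} (hω : RegularCells κ ω)
    (hκ : 0 ≤ κ) (n : ℕ) : ∑ r ∈ Finset.range n, advGrowth κ Δa (cells κ ω r) ≤
      arrivalCount (thin Δa ω.2) (n * κ) + n := by
  induction n with
  | zero => simp
  | succ n ih =>
    have := hω.snd.le_arrivalCount_thin_succ (d := Δa) hκ (hω.cells_snd n)
    rw [Finset.sum_range_succ]
    simp only [advGrowth, cells] at ih ⊢
    push_cast
    omega

theorem RegularCells.le_sum_honestGrowth {κ Δ d : ℝ} {ω : Arrivals} (hω : RegularCells κ ω)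
    (hd : Δ ≤ d) (n : ℕ) : arrivalCount (thin d ω.1) (n * κ) ≤
      ∑ r ∈ Finset.range n, honestGrowth κ Δ d (cells κ ω r) + n := by
  induction n with
  | zero =>
    simp only [Nat.cast_zero, zero_mul, Finset.range_zero, Finset.sum_empty, add_zero]
    exact (hω.fst.thinned d).arrivalCount_le.2 (hω.fst.thinned d).pos.le
  | succ n ih =>
    have := hω.fst.arrivalCount_thin_succ_le hd (hω.cells_fst n)
    rw [Finset.sum_range_succ]
    simp only [honestGrowth, cells] at ih ⊢
    push_cast
    omega

end

/-! ### Means from linear bounds on sums -/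

section

variable {Ω S : Type*} [MeasurableSpace Ω] [MeasurableSpace S] {μ : Measure Ω} {ν : Measure S}
  [IsProbabilityMeasure μ] [IsProbabilityMeasure ν]

omit [IsProbabilityMeasure μ] in
theorem ae_tendsto_sum_div {Z : Ω → ℕ → S} (hZ : Measurable Z)
    (hmap : μ.map Z = Measure.infinitePi fun _ : ℕ => ν) {X : S → ℝ} (hX : Measurable X)
    (hi : Integrable X ν) :
    ∀ᵐ ω ∂μ, Tendsto (fun n : ℕ => (∑ i ∈ Finset.range n, X (Z ω i)) / n) atTop
      (𝓝 (∫ s, X s ∂ν)) := by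
  have := ae_tendsto_sum_infinitePi (ν := ν) hX hi
  rw [← hmap] at this
  exact ae_of_ae_map hZ.aemeasurable this

/-- The law of large numbers holds at almost every sample, so a single sample at which the bound
holds too gives the comparison of means. -/
theorem integral_le_of_sum_le {Z : Ω → ℕ → S} (hZ : Measurable Z)
    (hmap : μ.map Z = Measure.infinitePi fun _ : ℕ => ν) {X : S → ℝ} (hX : Measurable X)
    (hi : Integrable X ν) {c : ℝ}
    (h : ∀ᵐ ω ∂μ, ∃ u : ℕ → ℝ, Tendsto (fun n : ℕ => u n / n) atTop (𝓝 c) ∧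
      ∀ n, ∑ i ∈ Finset.range n, X (Z ω i) ≤ u n) : ∫ s, X s ∂ν ≤ c := by
  obtain ⟨ω, h1, u, h2, h3⟩ := ((ae_tendsto_sum_div hZ hmap hX hi).and h).exists
  exact le_of_tendsto_of_tendsto' h1 h2 fun n => div_le_div_of_nonneg_right (h3 n) (by positivity)

/-- A nonnegative observable whose sums grow at most linearly is integrable. -/
theorem integrable_of_sum_le {Z : Ω → ℕ → S} (hZ : Measurable Z)
    (hmap : μ.map Z = Measure.infinitePi fun _ : ℕ => ν) {f : S → ℕ} (hf : Measurable f) {c : ℝ}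
    (h : ∀ᵐ ω ∂μ, ∃ u : ℕ → ℝ, Tendsto (fun n : ℕ => u n / n) atTop (𝓝 c) ∧
      ∀ n, ∑ i ∈ Finset.range n, (f (Z ω i) : ℝ) ≤ u n) :
    Integrable (fun s => (f s : ℝ)) ν := by
  have hfm : Measurable fun s => (f s : ℝ) := measurable_from_nat.comp hf
  have hmin : ∀ m : ℕ, Measurable fun s => ((min (f s) m : ℕ) : ℝ) := fun m =>
    measurable_from_nat.comp (hf.min measurable_const)
  have hint : ∀ m : ℕ, Integrable (fun s => ((min (f s) m : ℕ) : ℝ)) ν := fun m =>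
    Integrable.of_bound (hmin m).aestronglyMeasurable m (Eventually.of_forall fun s => by
      rw [Real.norm_of_nonneg (by positivity)]
      exact_mod_cast min_le_right _ _)
  -- Truncations are bounded, so the comparison of means applies to them uniformly in `m`; monotone
  -- convergence then removes the truncation.
  have hle : ∀ m : ℕ, ∫⁻ s, ((min (f s) m : ℕ) : ENNReal) ∂ν ≤ ENNReal.ofReal c := fun m => by
    have h1 := integral_le_of_sum_le hZ hmap (hmin m) (hint m) (c := c) (h.mono fun ω hω => by
      obtain ⟨u, h2, h3⟩ := hω
      refine ⟨u, h2, fun n => le_trans (Finset.sum_le_sum fun i _ => ?_) (h3 n)⟩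
      exact_mod_cast min_le_left _ _)
    refine le_trans (le_of_eq ?_) (ENNReal.ofReal_le_ofReal h1)
    rw [ofReal_integral_eq_lintegral_ofReal (hint m) (Eventually.of_forall fun s => by positivity)]
    simp only [ENNReal.ofReal_natCast]
  refine ⟨hfm.aestronglyMeasurable, ?_⟩
  have hsup : ∀ s, ((f s : ℕ) : ENNReal) = ⨆ m : ℕ, ((min (f s) m : ℕ) : ENNReal) := fun s =>
    le_antisymm (le_iSup_of_le (f s) (by simp)) (iSup_le fun m => by
      exact_mod_cast min_le_left _ _)
  have henorm : ∀ s, ‖(f s : ℝ)‖ₑ = ((f s : ℕ) : ENNReal) := fun s => by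
    rw [Real.enorm_of_nonneg (by positivity), ENNReal.ofReal_natCast]
  simp only [HasFiniteIntegral, henorm, hsup]
  have hmin' : ∀ m : ℕ, Measurable fun s => ((min (f s) m : ℕ) : ENNReal) := fun m =>
    measurable_from_nat.comp (hf.min measurable_const)
  rw [lintegral_iSup hmin' (fun m n hmn s => by
    change ((min (f s) m : ℕ) : ENNReal) ≤ ((min (f s) n : ℕ) : ENNReal)
    exact_mod_cast min_le_min_left _ hmn)]
  exact (iSup_le hle).trans_lt ENNReal.ofReal_lt_top

end

/-! ### Positive mean gain, and security -/

section

variable {lh la : ℝ}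

theorem tendsto_nat_mul_div {c : ℝ → ℝ} {r κ : ℝ} (hκ : 0 < κ)
    (hc : Tendsto (fun t => c t / t) atTop (𝓝 r)) :
    Tendsto (fun n : ℕ => c (n * κ) / n) atTop (𝓝 (r * κ)) := by
  have h1 : Tendsto (fun n : ℕ => (n : ℝ) * κ) atTop atTop :=
    tendsto_natCast_atTop_atTop.atTop_mul_const hκ
  refine ((hc.comp h1).mul_const κ).congr fun n => ?_
  simp only [Function.comp]
  field_simp

/-- The error per cell does not grow with `κ`, so it is negligible for long cells. Integrability
needs an argument because the adversarial growth is unbounded when Δa = 0. -/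
theorem advGrowth_mean_le (hlh : 0 < lh) (hla : 0 < la) {κ Δa : ℝ} (hκ : 0 < κ) (hΔa : 0 ≤ Δa) :
    Integrable (fun z => (advGrowth κ Δa z : ℝ)) (cellLaw lh la κ) ∧
      ∫ z, (advGrowth κ Δa z : ℝ) ∂cellLaw lh la κ ≤ lamEff la Δa * κ + 1 := by
  have h : ∀ᵐ ω ∂arrivalLaw lh la, ∃ u : ℕ → ℝ,
      Tendsto (fun n : ℕ => u n / n) atTop (𝓝 (lamEff la Δa * κ + 1)) ∧
      ∀ n, ∑ i ∈ Finset.range n, (advGrowth κ Δa (cells κ ω i) : ℝ) ≤ u n := by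
    filter_upwards [ae_regularCells hlh hla hκ.le,
      ae_arrivalLaw_snd (ae_tendsto_thinCount_div hla hΔa)] with ω h1 h2
    refine ⟨fun n => arrivalCount (thin Δa ω.2) (n * κ) + n, ?_, fun n => ?_⟩
    · refine ((tendsto_nat_mul_div hκ h2).add_const 1).congr' ?_
      filter_upwards [eventually_gt_atTop 0] with n hn
      have : (n : ℝ) ≠ 0 := by positivity
      field_simp
    · have h3 := h1.sum_advGrowth_le (Δa := Δa) hκ.le n
      beta_reduce
      exact_mod_cast h3
  have hi := integrable_of_sum_le (measurable_cells κ) (map_cells hlh hla hκ.le)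
    (measurable_advGrowth κ Δa) h
  exact ⟨hi, integral_le_of_sum_le (measurable_cells κ) (map_cells hlh hla hκ.le)
    (measurable_from_nat.comp (measurable_advGrowth κ Δa)) hi h⟩

theorem le_honestGrowth_mean (hlh : 0 < lh) (hla : 0 < la) {κ Δ d : ℝ} (hκ : 0 < κ) (hΔ : 0 ≤ Δ)
    (hd : Δ < d) :
    Integrable (fun z => (honestGrowth κ Δ d z : ℝ)) (cellLaw lh la κ) ∧
      lamGrowth lh d * κ - 1 ≤ ∫ z, (honestGrowth κ Δ d z : ℝ) ∂cellLaw lh la κ := by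
  have hd0 : 0 < d := hΔ.trans_lt hd
  have hm : Measurable fun z => (honestGrowth κ Δ d z : ℝ) :=
    measurable_from_nat.comp (measurable_honestGrowth κ Δ d)
  have hi : Integrable (fun z => (honestGrowth κ Δ d z : ℝ)) (cellLaw lh la κ) := by
    obtain ⟨B, hB⟩ := exists_nat_ge (κ / d)
    rw [div_le_iff₀ hd0] at hB
    refine Integrable.of_bound hm.aestronglyMeasurable B ?_
    filter_upwards [ae_cellLaw_regular hlh hκ.le] with z hz
    rw [Real.norm_of_nonneg (by positivity)]
    exact_mod_cast honestGrowth_le hz hΔ hB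
  refine ⟨hi, ?_⟩
  have := integral_le_of_sum_le (measurable_cells κ) (map_cells hlh hla hκ.le) hm.neg hi.neg
    (c := -(lamGrowth lh d * κ) + 1) (by
      filter_upwards [ae_regularCells hlh hla hκ.le,
        ae_arrivalLaw_fst (ae_tendsto_thinCount_div hlh hd0.le)] with ω h1 h2
      refine ⟨fun n => -(arrivalCount (thin d ω.1) (n * κ) : ℝ) + n, ?_, fun n => ?_⟩
      · refine ((tendsto_nat_mul_div hκ h2).neg.add_const 1).congr' ?_
        filter_upwards [eventually_gt_atTop 0] with n hn
        have : (n : ℝ) ≠ 0 := by positivity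
        field_simp
      · have h3 : (arrivalCount (thin d ω.1) (n * κ) : ℝ) ≤
            ∑ r ∈ Finset.range n, (honestGrowth κ Δ d (cells κ ω r) : ℝ) + n := by
          exact_mod_cast h1.le_sum_honestGrowth (Δ := Δ) hd.le n
        simp only [Pi.neg_apply, Finset.sum_neg_distrib]
        linarith)
  simp only [Pi.neg_apply, integral_neg] at this
  linarith

theorem gain_mean_pos (hlh : 0 < lh) (hla : 0 < la) {κ Δ d Δa : ℝ} (hκ : 0 < κ) (hΔ : 0 ≤ Δ)
    (hΔa : 0 ≤ Δa) (hd : Δ < d) (h : 2 < (lamGrowth lh d - lamEff la Δa) * κ) :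
    Integrable (gain κ Δ d Δa) (cellLaw lh la κ) ∧ 0 < ∫ z, gain κ Δ d Δa z ∂cellLaw lh la κ := by
  obtain ⟨h1, h2⟩ := advGrowth_mean_le hlh hla hκ hΔa
  obtain ⟨h3, h4⟩ := le_honestGrowth_mean hlh hla hκ hΔ hd
  refine ⟨h3.sub h1, ?_⟩
  simp only [gain]
  rw [integral_sub h3 h1]
  linarith

theorem expGap_Ioo_pos {r a b : ℝ} (hr : 0 < r) (ha : 0 ≤ a) (hab : a < b) :
    0 < expGap r (Set.Ioo a b) := by
  have := nullSingletonClass_expGap hr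
  rw [pos_iff_ne_zero]
  intro h0
  have h1 : expGap r (Set.Ici a) ≤ expGap r (Set.Ici b) := by
    calc expGap r (Set.Ici a) ≤ expGap r ({a} ∪ (Set.Ioo a b ∪ Set.Ici b)) := by
          refine measure_mono fun x hx => ?_
          rcases eq_or_lt_of_le (show a ≤ x from hx) with h | h
          · exact Or.inl h.symm
          · rcases lt_or_ge x b with h' | h'
            · exact Or.inr (Or.inl ⟨h, h'⟩)
            · exact Or.inr (Or.inr h')
      _ ≤ expGap r {a} + (expGap r (Set.Ioo a b) + expGap r (Set.Ici b)) :=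
          (measure_union_le _ _).trans (add_le_add le_rfl (measure_union_le _ _))
      _ = _ := by rw [measure_singleton, h0, zero_add, zero_add]
  rw [expGap_Ici hr ha, expGap_Ici hr (ha.trans hab.le),
    ENNReal.ofReal_le_ofReal_iff (Real.exp_nonneg _), Real.exp_le_exp] at h1
  nlinarith

theorem poissonArrivals_head_ge_pos {r : ℝ} (hr : 0 < r) {t : ℝ} (ht : 0 ≤ t) :
    0 < poissonArrivals r {T | t ≤ T 0} := by
  have h := map_fst_of_map_prodMk measurable_arrivalTail (measurable_pi_apply 0)
    (isMemoryless_poissonArrivals hr).map_head_tail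
  have e : poissonArrivals r {T | t ≤ T 0} = expGap r (Set.Ici t) := by
    rw [← h, Measure.map_apply (measurable_pi_apply 0) measurableSet_Ici]; rfl
  rw [e, expGap_Ici hr ht]
  exact ENNReal.ofReal_pos.2 (Real.exp_pos _)

/-- Three independent requirements of positive probability suffice: the first honest arrival lies in
the inner part of the cell, the next honest gap is at least `κ`, and so is the first adversarial
arrival. The room for the inner part requires `2 * Δ < κ`. -/
theorem cellLaw_loneCell_pos (hlh : 0 < lh) (hla : 0 < la) {κ Δ : ℝ} (hΔ : 0 ≤ Δ)
    (hκ : 2 * Δ < κ) : 0 < cellLaw lh la κ (loneCell κ Δ) := by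
  have hκ0 : 0 < κ := by linarith
  have h1 : 0 < poissonArrivals lh
      {T | T 0 ∈ Set.Ioo Δ (κ - Δ) ∧ κ ≤ arrivalTail T 0} := by
    have hm : Measurable fun T : ℕ → ℝ => (T 0, arrivalTail T) :=
      (measurable_pi_apply 0).prodMk measurable_arrivalTail
    have hs : MeasurableSet (Set.Ioo Δ (κ - Δ) ×ˢ {T : ℕ → ℝ | κ ≤ T 0}) :=
      measurableSet_Ioo.prod (measurableSet_le measurable_const (measurable_pi_apply 0))
    have e := congrArg (fun m => m (Set.Ioo Δ (κ - Δ) ×ˢ {T : ℕ → ℝ | κ ≤ T 0}))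
      (isMemoryless_poissonArrivals hlh).map_head_tail
    simp only [Measure.map_apply hm hs, Measure.prod_prod] at e
    refine lt_of_lt_of_eq ?_ e.symm
    exact ENNReal.mul_pos (expGap_Ioo_pos hlh hΔ (by linarith)).ne'
      (poissonArrivals_head_ge_pos hlh hκ0.le).ne'
  have h2 := poissonArrivals_head_ge_pos hla hκ0.le
  have h3 := ENNReal.mul_pos h1.ne' h2.ne'
  rw [← Measure.prod_prod] at h3
  refine h3.trans_le ?_
  rw [cellLaw, Measure.map_apply (measurable_cut_prod κ) (measurableSet_loneCell κ Δ)]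
  refine measure_mono fun ω hω => ?_
  obtain ⟨⟨⟨h4, h5⟩, h6⟩, h7⟩ := hω
  simp only [Set.mem_ofPred_eq, arrivalTail, zero_add] at h6 h7
  have h8 : ω.1 0 < κ := by linarith
  simp only [Set.mem_preimage, loneCell, Set.mem_ofPred_eq, arrivalCut, if_pos h8,
    if_neg (show ¬ ω.1 1 < κ by linarith), if_neg (not_lt.2 h7)]
  refine ⟨h4, h5, ?_, ?_⟩ <;> push_cast <;> linarith

theorem measurePreserving_arrivalAfter_prod (hlh : 0 < lh) (hla : 0 < la) {t : ℝ} (ht : 0 ≤ t) :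
    MeasurePreserving (fun ω : Arrivals => ((arrivalAfter t ω.1, arrivalAfter t ω.2) : Arrivals))
      (arrivalLaw lh la) (arrivalLaw lh la) :=
  ((isMemoryless_poissonArrivals hlh).measurePreserving_after ht).prod
    ((isMemoryless_poissonArrivals hla).measurePreserving_after ht)

/-- The number of arrivals in a period of a given length is tight. -/
theorem exists_arrivals_le (hlh : 0 < lh) (hla : 0 < la) {u : ℝ} (hu : 0 ≤ u) {ε : ENNReal}
    (hε : 0 < ε) : ∃ k : ℕ, ∀ t : ℝ, 0 ≤ t →
      arrivalLaw lh la {ω | arrivalsBefore ω t + k ≤ arrivalsBefore ω (t + u)} ≤ ε := by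
  obtain ⟨k, hk⟩ := exists_measure_le_le (arrivalLaw lh la)
    (measurable_from_nat (f := fun n : ℕ => (n : ℝ)) |>.comp (measurable_arrivalsBefore u)) hε
  -- By stationarity the count in a period of length `u` has the law of the count from time 0, so
  -- one `k` serves all `t`.
  refine ⟨k, fun t ht => ?_⟩
  have hmp := measurePreserving_arrivalAfter_prod hlh hla ht
  have hms : MeasurableSet {ω : Arrivals | (k : ℝ) ≤ (arrivalsBefore ω u : ℝ)} :=
    measurableSet_le measurable_const (measurable_from_nat.comp (measurable_arrivalsBefore u))
  refine le_trans (measure_mono_ae ?_) ((hmp.measure_preimage hms.nullMeasurableSet).le.trans hk)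
  filter_upwards [ae_arrivalLaw_fst (ae_regular_poissonArrivals hlh),
    ae_arrivalLaw_snd (ae_regular_poissonArrivals hla)] with ω h1 h2 hω
  have h3 : arrivalsBefore ω t + k ≤ arrivalsBefore ω (t + u) := hω
  rw [arrivalsBefore_after h1 h2 t hu, add_le_add_iff_left] at h3
  exact (Nat.cast_le (α := ℝ)).2 h3

theorem exists_sum_lt_le {S : Type*} [MeasurableSpace S] {ν : Measure S} [IsProbabilityMeasure ν]
    {X : S → ℝ} (hX : Measurable X) (hi : Integrable X ν) (hm : 0 < ∫ s, X s ∂ν) (c : ℝ)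
    {ε : ENNReal} (hε : 0 < ε) : ∃ w : ℕ, ∀ m : ℕ, Measure.infinitePi (fun _ : ℕ => ν)
      {x | ∑ i ∈ Finset.range w, X (x (m + i)) < c} ≤ ε := by
  have hms : ∀ w : ℕ, MeasurableSet {x : ℕ → S | ∑ i ∈ Finset.range w, X (x i) < c} := fun w =>
    measurableSet_lt (Finset.measurable_fun_sum _ fun i _ => hX.comp (measurable_pi_apply i))
      measurable_const
  have h := tendsto_measure_zero_of_ae (μ := Measure.infinitePi fun _ : ℕ => ν) hms (by
    filter_upwards [ae_tendsto_sum_atTop hX hi hm] with x hx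
    filter_upwards [hx.eventually_ge_atTop c] with n hn
    simpa using hn)
  obtain ⟨w, hw⟩ := (h.eventually_le_const hε).exists
  exact ⟨w, fun m => (infinitePi_preimage_shiftSeq m (hms w)).le.trans hw⟩

/-- Continuity of the rate in the delay: the slack in the strict inequality pays for replacing Δ by
a slightly longer spacing. -/
theorem exists_delay_lt_lamGrowth (hlh : 0 < lh) {Δ r : ℝ} (hΔ : 0 ≤ Δ) (h : r < lamGrowth lh Δ) :
    ∃ d, Δ < d ∧ r < lamGrowth lh d := by
  have hc : ContinuousAt (lamGrowth lh) Δ := by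
    unfold lamGrowth
    exact continuousAt_const.div (by fun_prop) (by positivity)
  have h1 : ∀ᶠ d in 𝓝[>] Δ, r < lamGrowth lh d :=
    (hc.eventually (lt_mem_nhds h)).filter_mono nhdsWithin_le_nhds
  obtain ⟨d, hd, hd'⟩ := (h1.and self_mem_nhdsWithin).exists
  exact ⟨d, hd', hd⟩

/-- If honest chains grow faster than adversarial ones, then no attack succeeds. -/
theorem secure_of_lamEff_lt (hlh : 0 < lh) (hla : 0 < la) {Δ Δa : ℝ} (hΔ : 0 ≤ Δ) (hΔa : 0 ≤ Δa)
    (h : lamEff la Δa < lamGrowth lh Δ) : Secure lh la Δ Δa := by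
  obtain ⟨d, hd, hgap⟩ := exists_delay_lt_lamGrowth hlh hΔ h
  have hd0 : 0 < d := hΔ.trans_lt hd
  have hg : 0 < lamGrowth lh d - lamEff la Δa := sub_pos.2 hgap
  -- The first term makes the gain in rate over a cell exceed the 2 lost at the boundaries; the
  -- others ensure `2 * Δ < κ`.
  set κ : ℝ := 3 / (lamGrowth lh d - lamEff la Δa) + 2 * Δ + 1 with hκdef
  have h3 : 0 < 3 / (lamGrowth lh d - lamEff la Δa) := by positivity
  have hκ0 : 0 < κ := by linarith
  have hκ1 : Δ < κ := by linarith
  have hκ2 : 2 * Δ < κ := by linarith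
  have hκ3 : 2 < (lamGrowth lh d - lamEff la Δa) * κ := by
    have : (lamGrowth lh d - lamEff la Δa) * (3 / (lamGrowth lh d - lamEff la Δa)) = 3 := by
      field_simp
    nlinarith [mul_le_mul_of_nonneg_left
      (show 3 / (lamGrowth lh d - lamEff la Δa) ≤ κ by linarith) hg.le]
  clear_value κ
  obtain ⟨B, hB⟩ := exists_nat_ge (κ / d)
  rw [div_le_iff₀ hd0] at hB
  obtain ⟨hi, hmean⟩ := gain_mean_pos hlh hla hκ0 hΔ hΔa hd hκ3
  have hX := measurable_gain κ Δ d Δa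
  obtain ⟨M, hM⟩ := exists_window_isCut hX hi hmean (measurableSet_loneCell κ Δ)
    (cellLaw_loneCell_pos hlh hla hΔ hκ2)
  intro ε hε
  have hε2 : 0 < ENNReal.ofReal ε / 2 := ENNReal.div_pos (ENNReal.ofReal_pos.2 hε).ne' (by simp)
  -- The bound `M` on the dips was chosen for the walk alone, before the length of the run. So the
  -- run may now be taken long enough to pay for `M`, for the two cells before a root is known, and
  -- for the cell in progress.
  obtain ⟨w, hw⟩ := hM (M + 2 * B + 1) _ hε2
  obtain ⟨k, hk⟩ := exists_arrivals_le (lh := lh) (la := la) hlh hla (u := (w + 1) * κ)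
    (by positivity) hε2
  obtain ⟨w', hw'⟩ := exists_sum_lt_le hX hi hmean k hε2
  -- This inequality needs no measurability of `E`. The failure events too are only estimated from
  -- above, as they range over all admissible runs.
  have hpull : ∀ E : Set (ℕ → Arrivals), arrivalLaw lh la (cells κ ⁻¹' E) ≤
      Measure.infinitePi (fun _ : ℕ => cellLaw lh la κ) E := fun E => by
    rw [← map_cells hlh hla hκ0.le]
    exact Measure.le_map_apply (measurable_cells κ).aemeasurable E
  have hbound : ∀ {F E E' : Set Arrivals}, arrivalLaw lh la E ≤ ENNReal.ofReal ε / 2 →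
      arrivalLaw lh la E' ≤ ENNReal.ofReal ε / 2 →
      (∀ ω, RegularCells κ ω → ω ∈ F → ω ∉ E → ω ∈ E') →
      arrivalLaw lh la F ≤ ENNReal.ofReal ε := by
    intro F E E' hE hE' hF
    calc arrivalLaw lh la F ≤ arrivalLaw lh la (E ∪ E') := by
          refine measure_mono_ae ?_
          filter_upwards [ae_regularCells hlh hla hκ0.le] with ω hω hωF
          by_cases hωE : ω ∈ E
          · exact Or.inl hωE
          · exact Or.inr (hF ω hω hωF hωE)
      _ ≤ arrivalLaw lh la E + arrivalLaw lh la E' := measure_union_le _ _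
      _ ≤ ENNReal.ofReal ε / 2 + ENNReal.ofReal ε / 2 := add_le_add hE hE'
      _ = ENNReal.ofReal ε := ENNReal.add_halves _
  refine ⟨k, Δ + (1 + w + w') * κ, fun s hs => ⟨?_, ?_⟩⟩
  · refine hbound ((hpull _).trans (hw (⌊s / κ⌋₊ - w)))
      (hk (((⌊s / κ⌋₊ - w : ℕ) : ℝ) * κ) (by positivity)) ?_
    rintro ω hω ⟨x, -, hx, hf⟩ hcut
    simp only [Set.mem_preimage, Set.mem_ofPred_eq, not_forall, not_not] at hcut
    obtain ⟨q, hq1, hq2, hq⟩ := hcut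
    by_contra hn
    exact hx.not_persistenceFails_of_isCut hω hΔ hd hκ1 hB le_rfl hs rfl ⟨q, hq1, hq2, hq⟩
      (not_le.1 hn) hf
  · refine hbound ((hpull _).trans (hw ⌈(s + Δ) / κ⌉₊))
      ((hpull _).trans (hw' (⌈(s + Δ) / κ⌉₊ + w))) ?_
    rintro ω hω ⟨x, -, hx, hf⟩ hcut
    simp only [Set.mem_preimage, Set.mem_ofPred_eq, not_forall, not_not] at hcut
    obtain ⟨q, hq1, hq2, hq⟩ := hcut
    by_contra hn
    exact hx.not_livenessFails_of_isCut hω hΔ hd hκ1 hB le_rfl hs rfl ⟨q, hq1, hq2, hq⟩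
      (not_lt.1 hn) hf

theorem Secure.secureAgainst {Δ Δa : ℝ} (h : Secure lh la Δ Δa) (A : Attack) :
    SecureAgainst lh la Δ Δa A := by
  intro ε hε
  obtain ⟨k, T, hkT⟩ := h ε hε
  refine ⟨k, T, fun s hs => ⟨(measure_mono ?_).trans (hkT s hs).1,
    (measure_mono ?_).trans (hkT s hs).2⟩⟩ <;>
  · rintro ω ⟨x, -, hx⟩
    exact ⟨x, trivial, hx⟩

end

/-! ### Thresholds -/

theorem secure_iff {lh la Δ Δa : ℝ} (hlh : 0 < lh) (hla : 0 < la) (hΔ : 0 ≤ Δ) (hΔa : 0 ≤ Δa) :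
    Secure lh la Δ Δa ↔ lamEff la Δa < lamGrowth lh Δ := by
  refine ⟨fun h => ?_, secure_of_lamEff_lt hlh hla hΔ hΔa⟩
  by_contra hc
  exact not_secureAgainst_privateAttack hlh hla hΔ hΔa (not_lt.1 hc) (h.secureAgainst _)

theorem secureAgainst_privateAttack_iff {lh la Δ Δa : ℝ} (hlh : 0 < lh) (hla : 0 < la)
    (hΔ : 0 ≤ Δ) (hΔa : 0 ≤ Δa) :
    SecureAgainst lh la Δ Δa (PrivateAttack Δ Δa) ↔ lamEff la Δa < lamGrowth lh Δ := by
  refine ⟨fun h => ?_, fun h => (secure_of_lamEff_lt hlh hla hΔ hΔa h).secureAgainst _⟩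
  by_contra hc
  exact not_secureAgainst_privateAttack hlh hla hΔ hΔa (not_lt.1 hc) h

theorem strictMonoOn_div_one_add_mul {D : ℝ} (hD : 0 ≤ D) :
    StrictMonoOn (fun r : ℝ => r / (1 + r * D)) (Set.Ici 0) := by
  intro r hr s hs hrs
  have hr' : (0 : ℝ) ≤ r := hr
  have hs' : (0 : ℝ) ≤ s := hs
  simp only
  rw [div_lt_div_iff₀ (by positivity) (by positivity)]
  linarith [mul_comm r s, mul_left_comm r s D, mul_left_comm s r D]

/-- The difference of the adversarial and the honest growth rate changes sign once. -/
theorem exists_share_threshold {lam Δ Δa : ℝ} (hlam : 0 < lam) (hΔ : 0 ≤ Δ) (hΔa : 0 ≤ Δa) :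
    ∃ β₀ ∈ Set.Ioo (0 : ℝ) 1, ∀ β ∈ Set.Ioo (0 : ℝ) 1,
      (lamEff (β * lam) Δa = lamGrowth ((1 - β) * lam) Δ ↔ β = β₀) ∧
      (lamEff (β * lam) Δa < lamGrowth ((1 - β) * lam) Δ ↔ β < β₀) := by
  set h : ℝ → ℝ := fun β => lamEff (β * lam) Δa - lamGrowth ((1 - β) * lam) Δ with hdef
  -- A larger share speeds up the adversary and slows down the honest nodes, so the difference of
  -- the rates is strictly increasing; the intermediate value theorem and injectivity give its only
  -- zero.
  have hmono : StrictMonoOn h (Set.Icc 0 1) := by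
    intro a ha b hb hab
    have h1 := strictMonoOn_div_one_add_mul hΔa (mul_nonneg ha.1 hlam.le)
      (mul_nonneg hb.1 hlam.le) (mul_lt_mul_of_pos_right hab hlam)
    have h2 := strictMonoOn_div_one_add_mul hΔ (mul_nonneg (sub_nonneg.2 hb.2) hlam.le)
      (mul_nonneg (sub_nonneg.2 ha.2) hlam.le)
      (mul_lt_mul_of_pos_right (sub_lt_sub_left hab 1) hlam)
    exact sub_lt_sub h1 h2
  have hcont : ContinuousOn h (Set.Icc 0 1) := by
    intro β hβ
    have h1 : 0 ≤ β * lam * Δa := mul_nonneg (mul_nonneg hβ.1 hlam.le) hΔa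
    have h2 : 0 ≤ (1 - β) * lam * Δ := mul_nonneg (mul_nonneg (sub_nonneg.2 hβ.2) hlam.le) hΔ
    refine ContinuousAt.continuousWithinAt ?_
    refine ContinuousAt.sub (ContinuousAt.div (by fun_prop) (by fun_prop) (by positivity))
      (ContinuousAt.div (by fun_prop) (by fun_prop) (by positivity))
  have h0 : h 0 < 0 := by
    simp only [hdef, lamEff, lamGrowth, zero_mul, zero_div, sub_zero, one_mul, zero_sub,
      Left.neg_neg_iff]
    positivity
  have h1 : 0 < h 1 := by
    simp only [hdef, lamEff, lamGrowth, sub_self, zero_mul, zero_div, sub_zero, one_mul]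
    positivity
  obtain ⟨β₀, hβ₀, hz⟩ := intermediate_value_Ioo zero_le_one hcont ⟨h0, h1⟩
  refine ⟨β₀, hβ₀, fun β hβ => ⟨?_, ?_⟩⟩
  · rw [← sub_eq_zero, ← hz]
    exact hmono.injOn.eq_iff (Set.Ioo_subset_Icc_self hβ) (Set.Ioo_subset_Icc_self hβ₀)
  · rw [← sub_neg, ← hz]
    exact hmono.lt_iff_lt (Set.Ioo_subset_Icc_self hβ) (Set.Ioo_subset_Icc_self hβ₀)

theorem csSup_share_eq {β₀ : ℝ} (hβ₀ : β₀ ∈ Set.Ioo (0 : ℝ) 1) {p : ℝ → Prop}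
    (hp : ∀ β ∈ Set.Ioo (0 : ℝ) 1, p β ↔ β < β₀) :
    sSup {β | β ∈ Set.Ioo (0 : ℝ) 1 ∧ p β} = β₀ := by
  have : {β | β ∈ Set.Ioo (0 : ℝ) 1 ∧ p β} = Set.Ioo 0 β₀ := by
    ext β
    exact ⟨fun h => ⟨h.1.1, (hp β h.1).1 h.2⟩, fun h =>
      have h' : β ∈ Set.Ioo (0 : ℝ) 1 := ⟨h.1, h.2.trans hβ₀.2⟩
      ⟨h', (hp β h').2 h.2⟩⟩
  rw [this, csSup_Ioo hβ₀.1]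

end DelayRace

theorem theorem3 (lh la Δ Δa : ℝ) (hlh : 0 < lh) (hla : 0 < la) (hΔ : 0 ≤ Δ) (hΔa : 0 ≤ Δa) :
    -- under every attack, every adversarial subtree grows at rate at most `lamEff`
    (∀ᵐ ω ∂arrivalLaw lh la, ∀ x, Admissible Δ Δa ω x → ∀ root : Block, ¬ root.IsAdv →
      GrowsAtMost (x.subtreeDepths ω root) (lamEff la Δa)) ∧
    -- the private attack can be carried out, and its private chain attains this rate
    (∀ᵐ ω ∂arrivalLaw lh la, ∀ s : ℝ, 0 ≤ s →
      (∃ x ∈ PrivateAttack Δ Δa s ω, Admissible Δ Δa ω x) ∧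
      ∀ x ∈ PrivateAttack Δ Δa s ω, Admissible Δ Δa ω x →
        GrowsAtLeast (x.subtreeDepths ω .genesis) (lamEff la Δa)) ∧
    -- under every attack, the chains of honest nodes grow at rate at least `lamGrowth`
    (∀ᵐ ω ∂arrivalLaw lh la, ∀ x, Admissible Δ Δa ω x → ∀ p,
      GrowsAtLeast (fun t => {x.height (x.tip p t)}) (lamGrowth lh Δ)) ∧
    -- and while a private attack is withheld, they grow no faster
    (∀ᵐ ω ∂arrivalLaw lh la, ∀ p,
      GrowsAtMost (fun s => {d | ∃ x ∈ PrivateAttack Δ Δa s ω, Admissible Δ Δa ω x ∧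
        d = x.height (x.tip p s)}) (lamGrowth lh Δ)) ∧
    -- no attack succeeds unless the private attack does
    (∀ A : Attack, SecureAgainst lh la Δ Δa (PrivateAttack Δ Δa) → SecureAgainst lh la Δ Δa A) ∧
    -- the exact condition, for all attacks and for the private attack alone
    (Secure lh la Δ Δa ↔ lamEff la Δa < lamGrowth lh Δ) ∧
    (SecureAgainst lh la Δ Δa (PrivateAttack Δ Δa) ↔ lamEff la Δa < lamGrowth lh Δ) ∧
    -- the threshold
    (∀ lam : ℝ, 0 < lam → ∃ βpa ∈ Set.Ioo (0 : ℝ) 1,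
      (∀ β ∈ Set.Ioo (0 : ℝ) 1,
        (β / (1 + β * lam * Δa) = (1 - β) / (1 + (1 - β) * lam * Δ) ↔ β = βpa) ∧
        (Secure ((1 - β) * lam) (β * lam) Δ Δa ↔ β < βpa)) ∧
      securityThreshold lam Δ Δa = βpa ∧ privateAttackThreshold lam Δ Δa = βpa) := by
  refine ⟨(ae_subtree_growsAtMost hla hΔa).mono fun _ h x hx root _ => h x hx root, ?_, ae_honest_growsAtLeast hlh hla hΔ,
    ae_private_growsAtMost hlh hla hΔ, fun A h => ?_, secure_iff hlh hla hΔ hΔa,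
    secureAgainst_privateAttack_iff hlh hla hΔ hΔa, fun lam hlam => ?_⟩
  · filter_upwards [ae_exists_privateAttack hlh hla hΔ, ae_private_growsAtLeast hlh hla hΔa]
      with ω h1 h2 s _
    exact ⟨h1 s, h2 s⟩
  · exact ((secure_iff hlh hla hΔ hΔa).2
      ((secureAgainst_privateAttack_iff hlh hla hΔ hΔa).1 h)).secureAgainst A
  · obtain ⟨β₀, hβ₀, h⟩ := exists_share_threshold hlam hΔ hΔa
    have hpos : ∀ β ∈ Set.Ioo (0 : ℝ) 1, 0 < (1 - β) * lam ∧ 0 < β * lam := fun β hβ =>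
      ⟨mul_pos (sub_pos.2 hβ.2) hlam, mul_pos hβ.1 hlam⟩
    have hsec : ∀ β ∈ Set.Ioo (0 : ℝ) 1, Secure ((1 - β) * lam) (β * lam) Δ Δa ↔ β < β₀ :=
      fun β hβ => (secure_iff (hpos β hβ).1 (hpos β hβ).2 hΔ hΔa).trans (h β hβ).2
    refine ⟨β₀, hβ₀, fun β hβ => ⟨?_, hsec β hβ⟩, csSup_share_eq hβ₀ hsec,
      csSup_share_eq hβ₀ fun β hβ =>
        (secureAgainst_privateAttack_iff (hpos β hβ).1 (hpos β hβ).2 hΔ hΔa).trans (h β hβ).2⟩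
    -- The equation for the shares is the equality of the two rates divided by the total rate.
    rw [← (h β hβ).1, lamEff, lamGrowth, mul_div_right_comm, mul_div_right_comm (1 - β),
      mul_left_inj' hlam.ne']
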